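/- Let $\mathbb{F}$ be the real or complex field, let $1\le p<\infty$ and let $w=(w_j)_{j\ge 1}\in\mathcal{W}$, where $\mathcal{W}$ is the class of non-increasing sequences of positive reals in $c_0\setminus\ell_1$ with $w_1=1$. Let $g(w,p)$ be the Garling sequence space of all scalar sequences $(a_j)$ with $\|(a_j)\|_g=\sup_\phi\big(\sum_j|a_{\phi(j)}|^p w_j\big)^{1/p}<\infty$, the supremum being over all strictly increasing $\phi:\mathbb{N}\to\mathbb{N}$, and let $d(w,p)$ be the Lorentz sequence space of all $(a_j)\in c_0$ with $\|(a_j)\|_d=\big(\sum_j (a_j^*)^p w_j\big)^{1/p}<\infty$, where $(a_j^*)$ is the decreasing rearrangement of $(|a_j|)$. A sequence $(x_n)$ in a quasi-Banach space over $\mathbb{F}$ is a basic sequence if every vector of its closed linear span $[x_n]$ has a unique expansion as a convergent series $\sum_n a_nx_n$ with $a_n\in\mathbb{F}$. Two sequences $(x_n)$, $(y_n)$, in possibly different spaces, are equivalent if there are bounded linear operators $[x_n]\to[y_n]$ and $[y_n]\to[x_n]$ which map $x_n$ to $y_n$ and $y_n$ to $x_n$, respectively, for all $n$. A basic sequence $(x_n)$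 is subsymmetric if $(x_{\pi(n)})$ is a basic sequence for every permutation $\pi$ of $\mathbb{N}$, and $(x_{\phi(n)})$ is equivalent to $(x_n)$ for every strictly increasing $\phi:\mathbb{N}\to\mathbb{N}$. If a subsymmetric basic sequence in a quasi-Banach space is equivalent to a basic sequence of $g(w,p)$ and also to a basic sequence of $d(w,p)$, then it is equivalent to the unit vector basis of $\ell_p$. Moreover, $d(w,p)$ is not isomorphic to a subspace of $g(w,p)$, and $g(w,p)$ is not isomorphic to a subspace of $d(w,p)$. -/

import Mathlib

open Filter Topology
open scoped ENNReal

/-! ### Weights and weighted `ℓ_p` functionals -/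

/-- The class of weights: non-increasing sequences of positive reals, with first term `1`,
in `c₀ \ ℓ₁` (the first term has index `0`). -/
def weightClass : Set (ℕ → ℝ) :=
  {w | w 0 = 1 ∧ Antitone w ∧ (∀ j, 0 < w j) ∧ Tendsto w atTop (𝓝 0) ∧ ¬ Summable w}

/-- `(∑_j b_j ^ p * w_j) ^ (1/p)`, with values in `[0, ∞]`. -/
noncomputable def weightedSum (w : ℕ → ℝ) (p : ℝ) (b : ℕ → ℝ≥0∞) : ℝ≥0∞ :=
  (∑' j, b j ^ p * ENNReal.ofReal (w j)) ^ (1 / p)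

theorem weightedSum_mono (w : ℕ → ℝ) {p : ℝ} (hp : 1 ≤ p) {b c : ℕ → ℝ≥0∞} (h : ∀ j, b j ≤ c j) :
    weightedSum w p b ≤ weightedSum w p c := by
  have hp0 : 0 ≤ p := by linarith
  have hp1 : 0 ≤ 1 / p := by positivity
  refine ENNReal.rpow_le_rpow (ENNReal.tsum_le_tsum fun j => ?_) hp1
  exact mul_le_mul_left (ENNReal.rpow_le_rpow (h j) hp0) _

theorem weightedSum_add_le (w : ℕ → ℝ) {p : ℝ} (hp : 1 ≤ p) (b c : ℕ → ℝ≥0∞) :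
    weightedSum w p (fun j => b j + c j) ≤ weightedSum w p b + weightedSum w p c := by
  have hp0 : 0 < p := by linarith
  have key : ∀ d : ℕ → ℝ≥0∞, (∑' j, d j ^ p * ENNReal.ofReal (w j)) =
      ∫⁻ j, (d j * ENNReal.ofReal (w j) ^ (1 / p)) ^ p ∂MeasureTheory.Measure.count := by
    intro d
    rw [MeasureTheory.lintegral_count]
    refine tsum_congr fun j => ?_
    rw [ENNReal.mul_rpow_of_nonneg _ _ hp0.le, ← ENNReal.rpow_mul, one_div,
      inv_mul_cancel₀ hp0.ne', ENNReal.rpow_one]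
  unfold weightedSum
  rw [key, key, key]
  have := ENNReal.lintegral_Lp_add_le (μ := MeasureTheory.Measure.count)
    (f := fun j => b j * ENNReal.ofReal (w j) ^ (1 / p))
    (g := fun j => c j * ENNReal.ofReal (w j) ^ (1 / p))
    (measurable_of_countable _).aemeasurable (measurable_of_countable _).aemeasurable hp
  simpa [add_mul] using this

theorem weightedSum_mul (w : ℕ → ℝ) {p : ℝ} (hp : 1 ≤ p) (r : ℝ≥0∞) (b : ℕ → ℝ≥0∞) :
    weightedSum w p (fun j => r * b j) = r * weightedSum w p b := by
  have hp0 : 0 < p := by linarith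
  unfold weightedSum
  simp only [ENNReal.mul_rpow_of_nonneg _ _ hp0.le, mul_assoc, ENNReal.tsum_mul_left]
  rw [ENNReal.mul_rpow_of_nonneg _ _ (by positivity), ← ENNReal.rpow_mul, one_div,
    mul_inv_cancel₀ hp0.ne', ENNReal.rpow_one]

theorem le_weightedSum_zero {w : ℕ → ℝ} (hw : w 0 = 1) {p : ℝ} (hp : 1 ≤ p) (b : ℕ → ℝ≥0∞) :
    b 0 ≤ weightedSum w p b := by
  have hp0 : 0 < p := by linarith
  have h1 : b 0 ^ p ≤ ∑' j, b j ^ p * ENNReal.ofReal (w j) := by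
    refine le_trans ?_ (ENNReal.le_tsum 0)
    simp [hw]
  calc b 0 = (b 0 ^ p) ^ (1 / p) := by
        rw [← ENNReal.rpow_mul, one_div, mul_inv_cancel₀ hp0.ne', ENNReal.rpow_one]
    _ ≤ _ := ENNReal.rpow_le_rpow h1 (by positivity)

/-! ### The Garling and Lorentz functionals -/

/-- `sup_φ (∑_j |a_{φ(j)}|^p w_j)^{1/p}`, over all strictly increasing `φ : ℕ → ℕ`. -/
noncomputable def garlingENorm {𝕜 : Type*} [RCLike 𝕜] (w : ℕ → ℝ) (p : ℝ) (a : ℕ → 𝕜) : ℝ≥0∞ :=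
  ⨆ φ : {φ : ℕ → ℕ // StrictMono φ}, weightedSum w p fun j => ‖a (φ.1 j)‖ₑ

/-- The decreasing rearrangement `(a*_n)` of the moduli of a sequence, through the distribution
function: `a*_n = inf {t ≥ 0 : #{j : |a_j| > t} ≤ n}`, where `n = 0, 1, 2, …`. -/
noncomputable def decrRearr {𝕜 : Type*} [RCLike 𝕜] (a : ℕ → 𝕜) (n : ℕ) : ℝ≥0∞ :=
  sInf {t : ℝ≥0∞ | {j | t < ‖a j‖ₑ}.encard ≤ n}

/-- `(∑_j (a*_j)^p w_j)^{1/p}`. -/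
noncomputable def lorentzENorm {𝕜 : Type*} [RCLike 𝕜] (w : ℕ → ℝ) (p : ℝ) (a : ℕ → 𝕜) : ℝ≥0∞ :=
  weightedSum w p (decrRearr a)

theorem le_decrRearr {𝕜 : Type*} [RCLike 𝕜] (a : ℕ → 𝕜) {n : ℕ} {s : ℝ≥0∞}
    (f : Fin (n + 1) → ℕ) (hf : Function.Injective f) (hs : ∀ i, s ≤ ‖a (f i)‖ₑ) :
    s ≤ decrRearr a n := by
  refine le_sInf fun t ht => ?_
  by_contra hlt
  rw [not_le] at hlt
  have hsub : Set.range f ⊆ {j | t < ‖a j‖ₑ} := by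
    rintro _ ⟨i, rfl⟩
    exact hlt.trans_le (hs i)
  have h1 : (Set.range f).encard = ((n + 1 : ℕ) : ℕ∞) := by
    rw [← Set.image_univ, hf.encard_image, Set.encard_univ]
    simp
  have h2 : ((n + 1 : ℕ) : ℕ∞) ≤ (n : ℕ∞) := h1 ▸ (Set.encard_le_encard hsub).trans ht
  have h3 : n + 1 ≤ n := by exact_mod_cast h2
  omega

theorem exists_injective_of_lt_decrRearr {𝕜 : Type*} [RCLike 𝕜] (a : ℕ → 𝕜) (t : ℕ → ℝ≥0∞)
    (N : ℕ) (ht : ∀ k < N, t k = 0 ∨ t k < decrRearr a k) :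
    ∃ f : Fin N → ℕ, Function.Injective f ∧ ∀ k : Fin N, t k ≤ ‖a (f k)‖ₑ := by
  induction N with
  | zero => exact ⟨Fin.elim0, fun i => i.elim0, fun i => i.elim0⟩
  | succ N ih =>
    obtain ⟨f, hf, hft⟩ := ih fun k hk => ht k (by omega)
    obtain ⟨i, hi, hti⟩ : ∃ i, i ∉ Set.range f ∧ t N ≤ ‖a i‖ₑ := by
      rcases ht N (by omega) with h0 | hlt
      · obtain ⟨i, hi⟩ := (Set.finite_range f).infinite_compl.nonempty
        exact ⟨i, hi, by simp [h0]⟩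
      · by_contra! hcon
        have hsub : {j | t N < ‖a j‖ₑ} ⊆ Set.range f := by
          intro j hj
          by_contra hjf
          exact absurd (hcon j hjf) (not_lt.mpr (le_of_lt hj))
        have hcard : {j | t N < ‖a j‖ₑ}.encard ≤ (N : ℕ∞) := by
          refine (Set.encard_le_encard hsub).trans ?_
          rw [← Set.image_univ]
          refine (Set.encard_image_le _ _).trans ?_
          rw [Set.encard_univ]
          simp
        have hle : decrRearr a N ≤ t N := sInf_le hcard
        exact absurd hle (not_le.mpr hlt)
    refine ⟨Fin.snoc f i, ?_, ?_⟩
    · exact Fin.snoc_injective_iff.mpr ⟨hf, hi⟩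
    · intro k
      refine Fin.lastCases ?_ (fun k => ?_) k
      · simpa using hti
      · simpa using hft k

/-- The Lorentz functional is obtained from the Garling one when the supremum is taken over all
permutations of `ℕ` instead of all increasing maps. -/
theorem lorentzENorm_eq_iSup {𝕜 : Type*} [RCLike 𝕜] {w : ℕ → ℝ} (hw : Antitone w)
    (hw0 : ∀ j, 0 < w j) {p : ℝ} (hp : 1 ≤ p) (a : ℕ → 𝕜) :
    lorentzENorm w p a = ⨆ π : Equiv.Perm ℕ, weightedSum w p fun j => ‖a (π j)‖ₑ := by
  have hp0 : 0 < p := by linarith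
  have hp1 : 0 ≤ 1 / p := by positivity
  apply le_antisymm
  · set S := ⨆ π : Equiv.Perm ℕ, weightedSum w p fun j => ‖a (π j)‖ₑ with hS
    have hSle : ∀ π : Equiv.Perm ℕ, ∑' j, ‖a (π j)‖ₑ ^ p * ENNReal.ofReal (w j) ≤ S ^ p := by
      intro π
      have : weightedSum w p (fun j => ‖a (π j)‖ₑ) ≤ S := le_iSup
        (fun π : Equiv.Perm ℕ => weightedSum w p fun j => ‖a (π j)‖ₑ) π
      have h2 := ENNReal.rpow_le_rpow this hp0.le
      unfold weightedSum at h2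
      rwa [← ENNReal.rpow_mul, one_div, inv_mul_cancel₀ hp0.ne', ENNReal.rpow_one] at h2
    have hu : ∀ k, ∃ u : ℕ → ℝ≥0∞, (∀ n, u n = 0 ∨ u n < decrRearr a k) ∧
        Tendsto u atTop (𝓝 (decrRearr a k)) := by
      intro k
      rcases eq_or_ne (decrRearr a k) 0 with h | h
      · exact ⟨fun _ => 0, fun _ => Or.inl rfl, by rw [h]; exact tendsto_const_nhds⟩
      · obtain ⟨u, -, hu, hlim⟩ := exists_seq_strictMono_tendsto' (pos_iff_ne_zero.mpr h)
        exact ⟨u, fun n => Or.inr (hu n).2, hlim⟩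
    choose u hu hlim using hu
    have hfin : ∀ N, ∑ k ∈ Finset.range N, decrRearr a k ^ p * ENNReal.ofReal (w k) ≤ S ^ p := by
      intro N
      have hl : Tendsto (fun n => ∑ k ∈ Finset.range N, u k n ^ p * ENNReal.ofReal (w k)) atTop
          (𝓝 (∑ k ∈ Finset.range N, decrRearr a k ^ p * ENNReal.ofReal (w k))) := by
        refine tendsto_finsetSum _ fun k _ => ?_
        refine ENNReal.Tendsto.mul_const ?_ (Or.inr ENNReal.ofReal_ne_top)
        exact ((ENNReal.continuous_rpow_const (y := p)).tendsto _).comp (hlim k)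
      refine le_of_tendsto' hl fun n => ?_
      obtain ⟨f, hf, hft⟩ := exists_injective_of_lt_decrRearr a (fun k => u k n) N
        fun k _ => hu k n
      obtain ⟨π, hπ⟩ := Cardinal.extend_function_of_lt (α := ℕ) (β := ℕ) (s := {k | k < N})
        ⟨fun k => f ⟨k.1, k.2⟩, fun x y hxy => by
          have := hf hxy
          simp only [Fin.mk.injEq] at this
          exact Subtype.ext this⟩
        (by
          rw [Cardinal.mk_nat]
          exact Cardinal.lt_aleph0_iff_finite.mpr (Set.finite_lt_nat N).to_subtype) ⟨Equiv.refl ℕ⟩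
      refine le_trans (Finset.sum_le_sum fun k hk => ?_)
        ((ENNReal.sum_le_tsum (Finset.range N)).trans (hSle π))
      have hk' : k < N := Finset.mem_range.mp hk
      have h1 : π k = f ⟨k, hk'⟩ := hπ ⟨k, hk'⟩
      rw [h1]
      exact mul_le_mul_left (ENNReal.rpow_le_rpow (hft ⟨k, hk'⟩) hp0.le) _
    have htot : ∑' k, decrRearr a k ^ p * ENNReal.ofReal (w k) ≤ S ^ p := by
      rw [ENNReal.tsum_eq_iSup_nat]
      exact iSup_le hfin
    calc lorentzENorm w p a ≤ (S ^ p) ^ (1 / p) := ENNReal.rpow_le_rpow htot hp1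
      _ = S := by rw [← ENNReal.rpow_mul, one_div, mul_inv_cancel₀ hp0.ne', ENNReal.rpow_one]
  · refine iSup_le fun π => ENNReal.rpow_le_rpow ?_ hp1
    rw [ENNReal.tsum_eq_iSup_nat]
    refine iSup_le fun N => le_trans ?_ (ENNReal.sum_le_tsum (Finset.range N))
    rw [← Fin.sum_univ_eq_sum_range (fun j => ‖a (π j)‖ₑ ^ p * ENNReal.ofReal (w j)),
      ← Fin.sum_univ_eq_sum_range (fun j => decrRearr a j ^ p * ENNReal.ofReal (w j))]
    let b : Fin N → ℝ := fun j => ‖a (π j)‖ ^ p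
    let σ : Equiv.Perm (Fin N) := Tuple.sort (fun j => OrderDual.toDual (b j))
    have hσ : Antitone (b ∘ σ) := by
      intro i j hij
      exact Tuple.monotone_sort (fun j => OrderDual.toDual (b j)) hij
    have hbw : Monovary (b ∘ σ) (fun j : Fin N => w j) := by
      intro i j hij
      have hji : j ≤ i := by
        by_contra hcon
        exact absurd (hw (Fin.le_iff_val_le_val.mp (le_of_lt (not_le.mp hcon)))) (not_le.mpr hij)
      exact hσ hji
    have hre := hbw.sum_comp_perm_mul_le_sum_mul (σ := σ⁻¹)
    have hreal : ∑ j : Fin N, b j * w j ≤ ∑ j : Fin N, b (σ j) * w j := by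
      simpa using hre
    have hcast : ∀ (τ : Fin N → Fin N),
        ∑ j : Fin N, ‖a (π (τ j))‖ₑ ^ p * ENNReal.ofReal (w j) =
          ENNReal.ofReal (∑ j : Fin N, b (τ j) * w j) := by
      intro τ
      have hnn : ∀ j ∈ (Finset.univ : Finset (Fin N)), 0 ≤ b (τ j) * w j := fun j _ =>
        mul_nonneg (Real.rpow_nonneg (norm_nonneg _) _) (hw0 j).le
      rw [ENNReal.ofReal_sum_of_nonneg hnn]
      refine Finset.sum_congr rfl fun j _ => ?_
      rw [ENNReal.ofReal_mul (Real.rpow_nonneg (norm_nonneg _) _),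
        ← ENNReal.ofReal_rpow_of_nonneg (norm_nonneg _) hp0.le, ofReal_norm]
    have h1 := hcast id
    have h2 := hcast σ
    simp only [id] at h1
    rw [h1]
    refine (ENNReal.ofReal_le_ofReal hreal).trans ?_
    rw [← h2]
    refine Finset.sum_le_sum fun k _ => ?_
    refine mul_le_mul_left (ENNReal.rpow_le_rpow ?_ hp0.le) _
    refine le_decrRearr a (fun i : Fin (k.1 + 1) => π (σ ⟨i.1, by omega⟩)) ?_ ?_
    · intro i j hij
      have h3 := σ.injective (Fin.val_injective (π.injective hij))
      simpa [Fin.ext_iff] using h3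
    · intro i
      have h4 : b (σ k) ≤ b (σ ⟨i.1, by omega⟩) :=
        hσ (Fin.le_iff_val_le_val.mpr (by simpa using Nat.lt_succ_iff.mp i.2))
      have h5 : ‖a (π (σ k))‖ ≤ ‖a (π (σ ⟨i.1, by omega⟩))‖ :=
        (Real.rpow_le_rpow_iff (norm_nonneg _) (norm_nonneg _) hp0).mp h4
      exact enorm_le_iff_norm_le.mpr h5

theorem garlingENorm_add_le {𝕜 : Type*} [RCLike 𝕜] (w : ℕ → ℝ) {p : ℝ} (hp : 1 ≤ p)
    (a b : ℕ → 𝕜) : garlingENorm w p (a + b) ≤ garlingENorm w p a + garlingENorm w p b := by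
  refine iSup_le fun φ => ?_
  refine (weightedSum_mono w hp fun j => enorm_add_le (a (φ.1 j)) (b (φ.1 j))).trans ?_
  refine (weightedSum_add_le w hp _ _).trans (add_le_add ?_ ?_)
  · exact le_iSup (fun φ : {φ : ℕ → ℕ // StrictMono φ} => weightedSum w p fun j => ‖a (φ.1 j)‖ₑ) φ
  · exact le_iSup (fun φ : {φ : ℕ → ℕ // StrictMono φ} => weightedSum w p fun j => ‖b (φ.1 j)‖ₑ) φ

theorem garlingENorm_smul {𝕜 : Type*} [RCLike 𝕜] (w : ℕ → ℝ) {p : ℝ} (hp : 1 ≤ p)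
    (c : 𝕜) (a : ℕ → 𝕜) : garlingENorm w p (c • a) = ‖c‖ₑ * garlingENorm w p a := by
  simp [garlingENorm, ENNReal.mul_iSup, enorm_mul, weightedSum_mul w hp]

theorem enorm_le_garlingENorm {𝕜 : Type*} [RCLike 𝕜] {w : ℕ → ℝ} (hw : w 0 = 1) {p : ℝ}
    (hp : 1 ≤ p) (a : ℕ → 𝕜) (n : ℕ) : ‖a n‖ₑ ≤ garlingENorm w p a := by
  refine le_trans ?_ (le_iSup (fun φ : {φ : ℕ → ℕ // StrictMono φ} =>
    weightedSum w p fun j => ‖a (φ.1 j)‖ₑ) ⟨fun j => n + j, fun i j h => by simpa using h⟩)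
  exact le_weightedSum_zero hw hp (fun j => ‖a (n + j)‖ₑ)

theorem lorentzENorm_add_le {𝕜 : Type*} [RCLike 𝕜] {w : ℕ → ℝ} (hw : Antitone w)
    (hw0 : ∀ j, 0 < w j) {p : ℝ} (hp : 1 ≤ p) (a b : ℕ → 𝕜) :
    lorentzENorm w p (a + b) ≤ lorentzENorm w p a + lorentzENorm w p b := by
  simp only [lorentzENorm_eq_iSup hw hw0 hp]
  refine iSup_le fun π => ?_
  refine (weightedSum_mono w hp fun j => enorm_add_le (a (π j)) (b (π j))).trans ?_
  refine (weightedSum_add_le w hp _ _).trans (add_le_add ?_ ?_)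
  · exact le_iSup (fun π : Equiv.Perm ℕ => weightedSum w p fun j => ‖a (π j)‖ₑ) π
  · exact le_iSup (fun π : Equiv.Perm ℕ => weightedSum w p fun j => ‖b (π j)‖ₑ) π

theorem lorentzENorm_smul {𝕜 : Type*} [RCLike 𝕜] {w : ℕ → ℝ} (hw : Antitone w)
    (hw0 : ∀ j, 0 < w j) {p : ℝ} (hp : 1 ≤ p) (c : 𝕜) (a : ℕ → 𝕜) :
    lorentzENorm w p (c • a) = ‖c‖ₑ * lorentzENorm w p a := by
  simp [lorentzENorm_eq_iSup hw hw0 hp, ENNReal.mul_iSup, enorm_mul, weightedSum_mul w hp]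

theorem enorm_le_lorentzENorm {𝕜 : Type*} [RCLike 𝕜] {w : ℕ → ℝ} (hw : w 0 = 1) {p : ℝ}
    (hp : 1 ≤ p) (a : ℕ → 𝕜) (n : ℕ) : ‖a n‖ₑ ≤ lorentzENorm w p a :=
  (le_decrRearr a (n := 0) (fun _ => n) (fun i j _ => by omega)
    fun _ => le_rfl).trans (le_weightedSum_zero hw hp _)

/-! ### The spaces `g(w,p)` and `d(w,p)` as normed spaces -/

/-- The sequences with finite Garling norm. -/
def garlingSubmodule (w : weightClass) (p : ℝ) [hp : Fact (1 ≤ p)] (𝕜 : Type*) [RCLike 𝕜] :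
    Submodule 𝕜 (ℕ → 𝕜) where
  carrier := {a | garlingENorm w.1 p a < ∞}
  zero_mem' := by
    have h := garlingENorm_smul w.1 hp.out (0 : 𝕜) 0
    have h0 : garlingENorm w.1 p (0 : ℕ → 𝕜) = 0 := by simpa using h
    simp [h0]
  add_mem' {a b} ha hb :=
    (garlingENorm_add_le w.1 hp.out a b).trans_lt (ENNReal.add_lt_top.mpr ⟨ha, hb⟩)
  smul_mem' c a ha := by
    simp only [Set.mem_ofPred_eq, garlingENorm_smul w.1 hp.out]
    exact ENNReal.mul_lt_top enorm_lt_top ha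

/-- The null sequences with finite Lorentz norm. -/
def lorentzSubmodule (w : weightClass) (p : ℝ) [hp : Fact (1 ≤ p)] (𝕜 : Type*) [RCLike 𝕜] :
    Submodule 𝕜 (ℕ → 𝕜) where
  carrier := {a | Tendsto a atTop (𝓝 0) ∧ lorentzENorm w.1 p a < ∞}
  zero_mem' := by
    refine ⟨tendsto_const_nhds, ?_⟩
    have h := lorentzENorm_smul w.2.2.1 w.2.2.2.1 hp.out (0 : 𝕜) 0
    have h0 : lorentzENorm w.1 p (0 : ℕ → 𝕜) = 0 := by simpa using h
    simp [h0]
  add_mem' {a b} ha hb := by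
    refine ⟨?_, (lorentzENorm_add_le w.2.2.1 w.2.2.2.1 hp.out a b).trans_lt
      (ENNReal.add_lt_top.mpr ⟨ha.2, hb.2⟩)⟩
    have h := ha.1.add hb.1
    rw [add_zero] at h
    exact h
  smul_mem' c a ha := by
    refine ⟨?_, ?_⟩
    · have h := ha.1.const_smul c
      rw [smul_zero] at h
      exact h
    · rw [lorentzENorm_smul w.2.2.1 w.2.2.2.1 hp.out]
      exact ENNReal.mul_lt_top enorm_lt_top ha.2

/-- The Garling sequence space `g(w,p)`: a type copy of `garlingSubmodule w p 𝕜`, which keeps its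
norm topology apart from the topology of coordinatewise convergence. -/
def GarlingSpace (w : weightClass) (p : ℝ) [Fact (1 ≤ p)] (𝕜 : Type*) [RCLike 𝕜] : Type _ :=
  garlingSubmodule w p 𝕜

/-- The weighted Lorentz sequence space `d(w,p)`: a type copy of `lorentzSubmodule w p 𝕜`. -/
def LorentzSpace (w : weightClass) (p : ℝ) [Fact (1 ≤ p)] (𝕜 : Type*) [RCLike 𝕜] : Type _ :=
  lorentzSubmodule w p 𝕜

namespace GarlingSpace

instance (w : weightClass) (p : ℝ) [Fact (1 ≤ p)] (𝕜 : Type*) [RCLike 𝕜] :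
    AddCommGroup (GarlingSpace w p 𝕜) :=
  inferInstanceAs (AddCommGroup (garlingSubmodule w p 𝕜))

instance (w : weightClass) (p : ℝ) [Fact (1 ≤ p)] (𝕜 : Type*) [RCLike 𝕜] :
    Module 𝕜 (GarlingSpace w p 𝕜) :=
  inferInstanceAs (Module 𝕜 (garlingSubmodule w p 𝕜))

/-- `‖a‖ = sup_φ (∑_j |a_{φ(j)}|^p w_j)^{1/p}`, a finite number for `a ∈ g(w,p)`. -/
noncomputable instance (w : weightClass) (p : ℝ) [Fact (1 ≤ p)] (𝕜 : Type*) [RCLike 𝕜] :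
    Norm (GarlingSpace w p 𝕜) :=
  ⟨fun a => (garlingENorm w.1 p a.1).toReal⟩

theorem core (w : weightClass) (p : ℝ) [hp : Fact (1 ≤ p)] (𝕜 : Type*) [RCLike 𝕜] :
    NormedSpace.Core 𝕜 (GarlingSpace w p 𝕜) where
  norm_nonneg a := ENNReal.toReal_nonneg
  norm_smul c a := by
    change (garlingENorm w.1 p (c • a.1)).toReal = ‖c‖ * (garlingENorm w.1 p a.1).toReal
    rw [garlingENorm_smul w.1 hp.out, ENNReal.toReal_mul, toReal_enorm]
  norm_triangle a b := by
    change (garlingENorm w.1 p (a.1 + b.1)).toReal ≤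
      (garlingENorm w.1 p a.1).toReal + (garlingENorm w.1 p b.1).toReal
    rw [← ENNReal.toReal_add (ne_of_lt a.2) (ne_of_lt b.2)]
    exact ENNReal.toReal_mono (ENNReal.add_ne_top.mpr ⟨ne_of_lt a.2, ne_of_lt b.2⟩)
      (garlingENorm_add_le w.1 hp.out a.1 b.1)
  norm_eq_zero_iff a := by
    change (garlingENorm w.1 p a.1).toReal = 0 ↔ a = 0
    constructor
    · intro h
      have h0 : garlingENorm w.1 p a.1 = 0 :=
        ((ENNReal.toReal_eq_zero_iff _).mp h).resolve_right (ne_of_lt a.2)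
      refine Subtype.ext (funext fun n => ?_)
      have h1 := enorm_le_garlingENorm w.2.1 hp.out a.1 n
      rw [h0, nonpos_iff_eq_zero, enorm_eq_zero] at h1
      exact h1
    · rintro rfl
      have h := garlingENorm_smul w.1 hp.out (0 : 𝕜) (0 : ℕ → 𝕜)
      have h0 : garlingENorm w.1 p (0 : ℕ → 𝕜) = 0 := by simpa using h
      change (garlingENorm w.1 p (0 : ℕ → 𝕜)).toReal = 0
      simp [h0]

noncomputable instance (w : weightClass) (p : ℝ) [Fact (1 ≤ p)] (𝕜 : Type*) [RCLike 𝕜] :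
    NormedAddCommGroup (GarlingSpace w p 𝕜) :=
  NormedAddCommGroup.ofCore (core w p 𝕜)

noncomputable instance (w : weightClass) (p : ℝ) [Fact (1 ≤ p)] (𝕜 : Type*) [RCLike 𝕜] :
    NormedSpace 𝕜 (GarlingSpace w p 𝕜) :=
  NormedSpace.ofCore (core w p 𝕜)

end GarlingSpace

namespace LorentzSpace

instance (w : weightClass) (p : ℝ) [Fact (1 ≤ p)] (𝕜 : Type*) [RCLike 𝕜] :
    AddCommGroup (LorentzSpace w p 𝕜) :=
  inferInstanceAs (AddCommGroup (lorentzSubmodule w p 𝕜))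

instance (w : weightClass) (p : ℝ) [Fact (1 ≤ p)] (𝕜 : Type*) [RCLike 𝕜] :
    Module 𝕜 (LorentzSpace w p 𝕜) :=
  inferInstanceAs (Module 𝕜 (lorentzSubmodule w p 𝕜))

/-- `‖a‖ = (∑_j (a*_j)^p w_j)^{1/p}`, a finite number for `a ∈ d(w,p)`. -/
noncomputable instance (w : weightClass) (p : ℝ) [Fact (1 ≤ p)] (𝕜 : Type*) [RCLike 𝕜] :
    Norm (LorentzSpace w p 𝕜) :=
  ⟨fun a => (lorentzENorm w.1 p a.1).toReal⟩

theorem core (w : weightClass) (p : ℝ) [hp : Fact (1 ≤ p)] (𝕜 : Type*) [RCLike 𝕜] :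
    NormedSpace.Core 𝕜 (LorentzSpace w p 𝕜) where
  norm_nonneg a := ENNReal.toReal_nonneg
  norm_smul c a := by
    change (lorentzENorm w.1 p (c • a.1)).toReal = ‖c‖ * (lorentzENorm w.1 p a.1).toReal
    rw [lorentzENorm_smul w.2.2.1 w.2.2.2.1 hp.out, ENNReal.toReal_mul, toReal_enorm]
  norm_triangle a b := by
    change (lorentzENorm w.1 p (a.1 + b.1)).toReal ≤
      (lorentzENorm w.1 p a.1).toReal + (lorentzENorm w.1 p b.1).toReal
    rw [← ENNReal.toReal_add (ne_of_lt a.2.2) (ne_of_lt b.2.2)]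
    exact ENNReal.toReal_mono (ENNReal.add_ne_top.mpr ⟨ne_of_lt a.2.2, ne_of_lt b.2.2⟩)
      (lorentzENorm_add_le w.2.2.1 w.2.2.2.1 hp.out a.1 b.1)
  norm_eq_zero_iff a := by
    change (lorentzENorm w.1 p a.1).toReal = 0 ↔ a = 0
    constructor
    · intro h
      have h0 : lorentzENorm w.1 p a.1 = 0 :=
        ((ENNReal.toReal_eq_zero_iff _).mp h).resolve_right (ne_of_lt a.2.2)
      refine Subtype.ext (funext fun n => ?_)
      have h1 := enorm_le_lorentzENorm w.2.1 hp.out a.1 n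
      rw [h0, nonpos_iff_eq_zero, enorm_eq_zero] at h1
      exact h1
    · rintro rfl
      have h := lorentzENorm_smul w.2.2.1 w.2.2.2.1 hp.out (0 : 𝕜) (0 : ℕ → 𝕜)
      have h0 : lorentzENorm w.1 p (0 : ℕ → 𝕜) = 0 := by simpa using h
      change (lorentzENorm w.1 p (0 : ℕ → 𝕜)).toReal = 0
      simp [h0]

noncomputable instance (w : weightClass) (p : ℝ) [Fact (1 ≤ p)] (𝕜 : Type*) [RCLike 𝕜] :
    NormedAddCommGroup (LorentzSpace w p 𝕜) :=
  NormedAddCommGroup.ofCore (core w p 𝕜)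

noncomputable instance (w : weightClass) (p : ℝ) [Fact (1 ≤ p)] (𝕜 : Type*) [RCLike 𝕜] :
    NormedSpace 𝕜 (LorentzSpace w p 𝕜) :=
  NormedSpace.ofCore (core w p 𝕜)

end LorentzSpace

instance fact_one_le_ofReal (p : ℝ) [hp : Fact (1 ≤ p)] : Fact (1 ≤ ENNReal.ofReal p) :=
  ⟨ENNReal.one_le_ofReal.mpr hp.out⟩

/-- The unit vector basis of `ℓ_p`, where `1 ≤ p < ∞`. -/
noncomputable def ellpUnitVector (p : ℝ) [Fact (1 ≤ p)] (𝕜 : Type*) [RCLike 𝕜] (n : ℕ) :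
    lp (fun _ : ℕ => 𝕜) (ENNReal.ofReal p) :=
  lp.single (ENNReal.ofReal p) n (1 : 𝕜)

/-! ### Basic sequences -/

/-- A quasi-Banach space, in topological terms: a complete Hausdorff topological vector space
with a bounded neighbourhood of the origin (equivalently, one whose topology is given by a
complete quasi-norm). -/
structure IsQuasiBanach (𝕜 X : Type*) [RCLike 𝕜] [AddCommGroup X] [Module 𝕜 X] [UniformSpace X]
    [IsUniformAddGroup X] [ContinuousSMul 𝕜 X] : Prop where
  complete : CompleteSpace X
  hausdorff : T2Space X
  locally_bounded : ∃ U ∈ 𝓝 (0 : X), Bornology.IsVonNBounded 𝕜 U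

section

variable (𝕜 : Type*) [RCLike 𝕜]
  {X : Type*} [AddCommGroup X] [Module 𝕜 X] [TopologicalSpace X] [IsTopologicalAddGroup X]
  [ContinuousSMul 𝕜 X]
  {Y : Type*} [AddCommGroup Y] [Module 𝕜 Y] [TopologicalSpace Y] [IsTopologicalAddGroup Y]
  [ContinuousSMul 𝕜 Y]

/-- The closed linear span of a sequence. -/
def closedSpan (x : ℕ → X) : Submodule 𝕜 X :=
  (Submodule.span 𝕜 (Set.range x)).topologicalClosure

theorem mem_closedSpan (x : ℕ → X) (n : ℕ) : x n ∈ closedSpan 𝕜 x :=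
  Submodule.le_topologicalClosure _ (Submodule.subset_span ⟨n, rfl⟩)

/-- A basic sequence: every vector of its closed linear span has a unique expansion as a
convergent series `∑ a_n x_n`. -/
def IsBasicSequence (x : ℕ → X) : Prop :=
  ∀ v ∈ closedSpan 𝕜 x, ∃! a : ℕ → 𝕜,
    Tendsto (fun N => ∑ n ∈ Finset.range N, a n • x n) atTop (𝓝 v)

/-- `x` dominates `y`: some bounded linear operator from the closed linear span of `x` to that of
`y` maps `x n` to `y n` for every `n`. -/
def Dominates (x : ℕ → X) (y : ℕ → Y) : Prop :=
  ∃ T : closedSpan 𝕜 x →L[𝕜] closedSpan 𝕜 y,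
    ∀ n, T ⟨x n, mem_closedSpan 𝕜 x n⟩ = ⟨y n, mem_closedSpan 𝕜 y n⟩

/-- Equivalence of basic sequences. -/
def EquivalentSequences (x : ℕ → X) (y : ℕ → Y) : Prop :=
  Dominates 𝕜 x y ∧ Dominates 𝕜 y x

/-- A subsymmetric basic sequence: an unconditional basic sequence (all its rearrangements are
basic sequences) that is equivalent to all its subsequences. -/
structure IsSubsymmetric (x : ℕ → X) : Prop where
  basic : IsBasicSequence 𝕜 x
  unconditional : ∀ π : Equiv.Perm ℕ, IsBasicSequence 𝕜 fun n => x (π n)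
  subsequences : ∀ φ : ℕ → ℕ, StrictMono φ → EquivalentSequences 𝕜 (fun n => x (φ n)) x

end

/-- `X` is isomorphic to a (linear) subspace of `Y`. -/
def IsIsomorphicToSubspace (𝕜 X Y : Type*) [RCLike 𝕜] [NormedAddCommGroup X] [NormedSpace 𝕜 X]
    [NormedAddCommGroup Y] [NormedSpace 𝕜 Y] : Prop :=
  ∃ V : Submodule 𝕜 Y, Nonempty (X ≃L[𝕜] V)

/-! Both norms are suprema of `(∑_j ‖a (L_j)‖ ^ p * w j) ^ (1/p)` over finite lists `L` of indices:
increasing lists for `g(w,p)`, lists without repetition for `d(w,p)`. `IsListNormed r` treats the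
two spaces together; the difference between the two kinds of list matters only when blocks of the
two spaces are compared.

Let `y` in `g(w,p)` and `z` in `d(w,p)` be equivalent to one subsymmetric sequence.

Upper `ℓ_p` estimate (`exists_upper_estimate`). For `p = 1` it is the triangle inequality. For `p >
1`, a subsequence of `y` converges coordinatewise to some `v`, and its differences from `v` are,
along a further subsequence and up to a summable error, disjoint blocks, which satisfy an upper
`p`-estimate. Hence averages of the subsequence tend to `v`. Convergent combinations supported
further and further out can only tend to `0`, so `v = 0` and the estimate passes to `y`.

Lower `ℓ_p` estimate (`exists_finNorm_estimates`). No subsequence of `y` is Cauchy, so suitable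
differences of two subsequences stay away from zero while being coordinatewise null in both spaces;
up to small errors they are blocks `b` in `g(w,p)` and `d` in `d(w,p)`. If list sums of `b n` that
start at the weight `w t` do not become small as `t` and `n` grow, then infinitely many blocks can
be visited one after another, each contributing a fixed amount, and `y` has a lower estimate
(`exists_lower_estimate`). The same holds with `d` and `z`.

There remains the case `EventuallySmallShifts` for both, excluded by
`not_equivalent_of_eventuallySmallShifts`. There very flat normalised vectors are stacked, each new
one in front of the old stack. An increasing list must visit the new vector first: either it spends
many positions there, and the old stack then meets only late weights, or it spends few, and gains
almost nothing from a flat vector. So the norm in `g(w,p)` stays bounded. In `d(w,p)` a list may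
visit the old stack first and the flat vector afterwards with little loss, so the `p`-th powers of
the norms grow linearly in the number of vectors.

For the embeddings, the unit vectors of either space satisfy all that the argument needs, so an
isomorphic copy in the other space would give them a lower `ℓ_p` estimate. This is impossible
because the averages of `w` tend to `0`. -/

/-! ### Weighted sums along lists of indices -/

section ListSums

variable {𝕜 : Type*} [RCLike 𝕜]

/-- The sum `∑_j ‖a (L_j)‖ ^ p * w (t + j)` along a list `L` of indices. -/
noncomputable def listSum (w : ℕ → ℝ) (p : ℝ) (a : ℕ → 𝕜) : ℕ → List ℕ → ℝ
  | _, [] => 0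
  | t, i :: L => ‖a i‖ ^ p * w t + listSum w p a (t + 1) L

variable {w : ℕ → ℝ} {p : ℝ} (a b : ℕ → 𝕜)

@[simp] theorem listSum_nil (t : ℕ) : listSum w p a t [] = 0 := rfl

@[simp] theorem listSum_cons (t i : ℕ) (L : List ℕ) :
    listSum w p a t (i :: L) = ‖a i‖ ^ p * w t + listSum w p a (t + 1) L := rfl

theorem listSum_append (t : ℕ) (L M : List ℕ) :
    listSum w p a t (L ++ M) = listSum w p a t L + listSum w p a (t + L.length) M := by
  induction L generalizing t with
  | nil => simp
  | cons i L ih =>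
    simp only [List.cons_append, listSum_cons, List.length_cons, ih (t + 1)]
    rw [show t + 1 + L.length = t + (L.length + 1) by ring]
    ring

theorem listSum_eq_sum (t : ℕ) (L : List ℕ) :
    listSum w p a t L = ∑ j ∈ Finset.range L.length, ‖a (L.getD j 0)‖ ^ p * w (t + j) := by
  induction L generalizing t with
  | nil => simp
  | cons i L ih =>
    rw [listSum_cons, ih, List.length_cons, Finset.sum_range_succ']
    simp only [List.getD_cons_zero, List.getD_cons_succ, add_zero]
    rw [add_comm]
    congr 1
    refine Finset.sum_congr rfl fun j _ => ?_
    rw [show t + 1 + j = t + (j + 1) by ring]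

theorem listSum_map (f : ℕ → ℕ) (t : ℕ) (L : List ℕ) :
    listSum w p a t (L.map f) = listSum w p (fun i => a (f i)) t L := by
  induction L generalizing t with
  | nil => rfl
  | cons i L ih => simp [ih]

variable {a b}

theorem listSum_congr {t : ℕ} {L : List ℕ} (h : ∀ i ∈ L, ‖a i‖ = ‖b i‖) :
    listSum w p a t L = listSum w p b t L := by
  induction L generalizing t with
  | nil => rfl
  | cons i L ih =>
    rw [listSum_cons, listSum_cons, h i (by simp), ih fun j hj => h j (by simp [hj])]

theorem listSum_smul (c : 𝕜) (t : ℕ) (L : List ℕ) :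
    listSum w p (c • a) t L = ‖c‖ ^ p * listSum w p a t L := by
  induction L generalizing t with
  | nil => simp
  | cons i L ih =>
    rw [listSum_cons, listSum_cons, ih, Pi.smul_apply, norm_smul,
      Real.mul_rpow (norm_nonneg _) (norm_nonneg _)]
    ring

theorem listSum_eq_zero (hp : 1 ≤ p) {t : ℕ} {L : List ℕ} (h : ∀ i ∈ L, a i = 0) :
    listSum w p a t L = 0 := by
  induction L generalizing t with
  | nil => rfl
  | cons i L ih =>
    rw [listSum_cons, h i (by simp), ih fun j hj => h j (by simp [hj]), norm_zero,
      Real.zero_rpow (by linarith), zero_mul, zero_add]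

theorem listSum_add_of_disjoint (hp : 1 ≤ p) {t : ℕ} {L : List ℕ}
    (h : ∀ i, a i = 0 ∨ b i = 0) :
    listSum w p (a + b) t L = listSum w p a t L + listSum w p b t L := by
  have hp0 : p ≠ 0 := by linarith
  induction L generalizing t with
  | nil => simp
  | cons i L ih =>
    rw [listSum_cons, listSum_cons, listSum_cons, ih]
    rcases h i with h | h <;> simp [h, Real.zero_rpow hp0] <;> ring

theorem listSum_nonneg (hw : w ∈ weightClass) (t : ℕ) (L : List ℕ) : 0 ≤ listSum w p a t L := by
  induction L generalizing t with
  | nil => simp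
  | cons i L ih =>
    have := hw.2.2.1 t
    exact add_nonneg (by positivity) (ih _)

theorem weight_le_one (hw : w ∈ weightClass) (t : ℕ) : w t ≤ 1 := hw.1 ▸ hw.2.1 (Nat.zero_le t)

theorem listSum_mono (hw : w ∈ weightClass) (hp : 1 ≤ p) {t : ℕ} {L : List ℕ}
    (h : ∀ i ∈ L, ‖a i‖ ≤ ‖b i‖) : listSum w p a t L ≤ listSum w p b t L := by
  induction L generalizing t with
  | nil => simp
  | cons i L ih =>
    have := hw.2.2.1 t
    rw [listSum_cons, listSum_cons]
    refine add_le_add (mul_le_mul_of_nonneg_right ?_ this.le) (ih fun j hj => h j (by simp [hj]))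
    exact Real.rpow_le_rpow (norm_nonneg _) (h i (by simp)) (by linarith)

theorem listSum_anti (hw : w ∈ weightClass) {s t : ℕ} (hst : s ≤ t) (L : List ℕ) :
    listSum w p a t L ≤ listSum w p a s L := by
  induction L generalizing s t with
  | nil => simp
  | cons i L ih =>
    rw [listSum_cons, listSum_cons]
    refine add_le_add (mul_le_mul_of_nonneg_left (hw.2.1 hst) (by positivity)) (ih (by omega))

/-- Deleting entries at which `a` vanishes moves the others to earlier positions, hence to larger
weights. -/
theorem listSum_le_filter (hw : w ∈ weightClass) (hp : 1 ≤ p) (P : ℕ → Prop) [DecidablePred P]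
    {t : ℕ} {L : List ℕ} (h : ∀ i ∈ L, ¬ P i → a i = 0) :
    listSum w p a t L ≤ listSum w p a t (L.filter P) := by
  have hp0 : p ≠ 0 := by linarith
  induction L generalizing t with
  | nil => simp
  | cons i L ih =>
    have ih' := fun t => ih (t := t) fun j hj => h j (by simp [hj])
    by_cases hi : P i
    · rw [List.filter_cons_of_pos (by simpa using hi), listSum_cons, listSum_cons]
      linarith [ih' (t + 1)]
    · rw [List.filter_cons_of_neg (by simpa using hi), listSum_cons, h i (by simp) hi, norm_zero,
        Real.zero_rpow hp0, zero_mul, zero_add]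
      exact (listSum_anti hw (Nat.le_succ t) L).trans (ih' t)

theorem listSum_le_length (hw : w ∈ weightClass) (hp : 1 ≤ p) {t : ℕ} {L : List ℕ} {δ : ℝ}
    (h : ∀ i ∈ L, ‖a i‖ ≤ δ) : listSum w p a t L ≤ L.length * δ ^ p := by
  induction L generalizing t with
  | nil => simp
  | cons i L ih =>
    have h1 : ‖a i‖ ^ p ≤ δ ^ p :=
      Real.rpow_le_rpow (norm_nonneg _) (h i (by simp)) (by linarith)
    have h2 : ‖a i‖ ^ p * w t ≤ ‖a i‖ ^ p :=
      mul_le_of_le_one_right (by positivity) (weight_le_one hw t)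
    have h3 := ih (t := t + 1) fun j hj => h j (by simp [hj])
    rw [listSum_cons, List.length_cons]
    push_cast
    linarith

theorem le_listSum (hw : w ∈ weightClass) (hp : 1 ≤ p) {t : ℕ} {L : List ℕ} {δ : ℝ} (hδ : 0 ≤ δ)
    (h : ∀ i ∈ L, δ ≤ ‖a i‖) :
    δ ^ p * ∑ j ∈ Finset.range L.length, w (t + j) ≤ listSum w p a t L := by
  rw [listSum_eq_sum, Finset.mul_sum]
  refine Finset.sum_le_sum fun j hj => mul_le_mul_of_nonneg_right ?_ (hw.2.2.1 _).le
  refine Real.rpow_le_rpow hδ (h _ ?_) (by linarith)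
  rw [List.getD_eq_getElem _ _ (Finset.mem_range.mp hj)]
  exact List.getElem_mem _

theorem tendsto_sum_weight (hw : w ∈ weightClass) :
    Tendsto (fun n => ∑ j ∈ Finset.range n, w j) atTop atTop :=
  (not_summable_iff_tendsto_nat_atTop_of_nonneg fun j => (hw.2.2.1 j).le).mp hw.2.2.2.2

end ListSums

/-! ### Spaces normed by suprema of list sums -/

/-- A normed space of scalar sequences (through the coordinate map `co`) whose norm is the supremum
of `(∑_j ‖a (L_j)‖ ^ p * w j) ^ (1/p)` over the lists `L` that are pairwise related by `r`, and
which contains all sequences for which this supremum is finite. -/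
structure IsListNormed {𝕜 : Type*} [RCLike 𝕜] (r : ℕ → ℕ → Prop) (w : ℕ → ℝ) (p : ℝ) {E : Type*}
    [NormedAddCommGroup E] [NormedSpace 𝕜 E] (co : E →ₗ[𝕜] (ℕ → 𝕜)) : Prop where
  weight : w ∈ weightClass
  one_le : 1 ≤ p
  of_lt : ∀ i j, i < j → r i j
  ne_of : ∀ i j, r i j → i ≠ j
  strictMono : ∀ φ : ℕ → ℕ, StrictMono φ → ∀ i j, r (φ i) (φ j) ↔ r i j
  listSum_le : ∀ a L, L.Pairwise r → listSum w p (co a) 0 L ≤ ‖a‖ ^ p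
  norm_le : ∀ a M, 0 ≤ M → (∀ L, L.Pairwise r → listSum w p (co a) 0 L ≤ M ^ p) → ‖a‖ ≤ M
  exists_co : ∀ (b : ℕ → 𝕜) (M : ℝ), (∀ L, L.Pairwise r → listSum w p b 0 L ≤ M) → ∃ a, co a = b

/-! ### Splitting list sums, flat vectors and null sequences -/

section ListSums

variable {𝕜 : Type*} [RCLike 𝕜] {w : ℕ → ℝ} {p : ℝ} {a b : ℕ → 𝕜}

theorem listSum_eq_take_add_drop (t n : ℕ) (L : List ℕ) :
    listSum w p a t L = listSum w p a t (L.take n) + listSum w p a (t + n) (L.drop n) := by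
  conv_lhs => rw [← List.take_append_drop n L, listSum_append]
  rcases le_total n L.length with h | h
  · rw [List.length_take, min_eq_left h]
  · rw [List.drop_eq_nil_of_le h, listSum_nil, listSum_nil]

theorem listSum_sum_of_disjoint (hp : 1 ≤ p) {ι : Type*} (s : Finset ι) (u : ι → ℕ → 𝕜)
    (hu : ∀ k ∈ s, ∀ l ∈ s, k ≠ l → ∀ i, u k i = 0 ∨ u l i = 0) (t : ℕ) (L : List ℕ) :
    listSum w p (∑ k ∈ s, u k) t L = ∑ k ∈ s, listSum w p (u k) t L := by
  classical
  induction s using Finset.induction_on with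
  | empty => simpa using listSum_eq_zero hp (a := (0 : ℕ → 𝕜)) fun _ _ => rfl
  | insert k s hk ih =>
    rw [Finset.sum_insert hk, Finset.sum_insert hk, ← ih fun l hl m hm =>
      hu l (Finset.mem_insert_of_mem hl) m (Finset.mem_insert_of_mem hm)]
    refine listSum_add_of_disjoint hp fun i => ?_
    by_cases h : u k i = 0
    · exact Or.inl h
    · right
      rw [Finset.sum_apply]
      refine Finset.sum_eq_zero fun l hl => ?_
      exact (hu k (Finset.mem_insert_self k s) l (Finset.mem_insert_of_mem hl)
        (fun hkl => hk (hkl ▸ hl)) i).resolve_left h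

/-- Supplies a height at which `N` coordinates together are negligible. The cap `1 / 2` serves in
`HasStackedCombinations.succ`, where the perturbation error must stay below half of the norm. -/
theorem exists_pos_mul_rpow_le (hp : 1 ≤ p) (N : ℕ) {ε : ℝ} (hε : 0 < ε) :
    ∃ θ : ℝ, 0 < θ ∧ θ ≤ 1 / 2 ∧ N * θ ^ p ≤ ε := by
  have hp0 : 0 < p := by linarith
  have h1 : 0 < ε / (N + 1) := by positivity
  refine ⟨min (1 / 2) ((ε / (N + 1)) ^ (1 / p)), by positivity, min_le_left _ _, ?_⟩
  have h2 : (min (1 / 2) ((ε / (N + 1)) ^ (1 / p))) ^ p ≤ ε / (N + 1) := by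
    refine (Real.rpow_le_rpow (by positivity) (min_le_right _ _) hp0.le).trans ?_
    rw [← Real.rpow_mul h1.le, one_div, inv_mul_cancel₀ hp0.ne', Real.rpow_one]
  calc N * (min (1 / 2) ((ε / (N + 1)) ^ (1 / p))) ^ p ≤ N * (ε / (N + 1)) := by gcongr
    _ ≤ ε := by
      rw [mul_div_assoc', div_le_iff₀ (by positivity)]
      nlinarith

/-- Otherwise infinitely many coordinates have modulus at least some `ε > 0`, and increasing lists
of `n` of them have sums at least `ε ^ p * ∑_{j<n} w j`, which is unbounded because `w` is not
summable. -/
theorem tendsto_zero_of_listSum_le (hw : w ∈ weightClass) (hp : 1 ≤ p) {M : ℝ}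
    (h : ∀ L : List ℕ, L.Pairwise (· < ·) → listSum w p a 0 L ≤ M) :
    Tendsto a atTop (𝓝 0) := by
  by_contra hcon
  rw [Metric.tendsto_atTop] at hcon
  push Not at hcon
  obtain ⟨ε, hε, hfr⟩ := hcon
  have key : ∀ n, ∃ L : List ℕ, L.length = n ∧ L.Pairwise (· < ·) ∧ ∀ i ∈ L, ε ≤ ‖a i‖ := by
    intro n
    suffices ∃ L : List ℕ, ∃ B, L.length = n ∧ L.Pairwise (· < ·) ∧ (∀ i ∈ L, ε ≤ ‖a i‖) ∧
        ∀ i ∈ L, i < B by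
      obtain ⟨L, B, h1, h2, h3, -⟩ := this
      exact ⟨L, h1, h2, h3⟩
    induction n with
    | zero => exact ⟨[], 0, by simp⟩
    | succ n ih =>
      obtain ⟨L, B, h1, h2, h3, h4⟩ := ih
      obtain ⟨k, hk, hka⟩ := hfr B
      rw [dist_zero_right] at hka
      refine ⟨L ++ [k], k + 1, by simp [h1], ?_, ?_, ?_⟩
      · rw [List.pairwise_append]
        refine ⟨h2, by simp, fun i hi j hj => ?_⟩
        rw [List.mem_singleton.mp hj]
        exact (h4 i hi).trans_le hk
      · intro i hi
        rcases List.mem_append.mp hi with hi | hi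
        · exact h3 i hi
        · rw [List.mem_singleton.mp hi]; exact hka
      · intro i hi
        rcases List.mem_append.mp hi with hi | hi
        · have := h4 i hi; omega
        · rw [List.mem_singleton.mp hi]; omega
  have hδ : 0 < ε ^ p := by positivity
  obtain ⟨n, hn⟩ := ((tendsto_sum_weight hw).eventually_gt_atTop (M / ε ^ p)).exists
  obtain ⟨L, h1, h2, h3⟩ := key n
  have h4 := (le_listSum hw hp (t := 0) hε.le h3).trans (h L h2)
  rw [h1] at h4
  simp only [zero_add] at h4
  rw [div_lt_iff₀ hδ] at hn
  linarith

end ListSums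

/-- An increasing list is bound to visit everything below `m` first. This is the restriction that
separates the Garling norm from the Lorentz norm. -/
theorem List.pairwise_lt_eq_filter_append (m : ℕ) {L : List ℕ} (hL : L.Pairwise (· < ·)) :
    L = L.filter (· < m) ++ L.filter (m ≤ ·) := by
  induction L with
  | nil => simp
  | cons i L ih =>
    rw [List.pairwise_cons] at hL
    by_cases hi : i < m
    · have h2 : ¬ m ≤ i := by omega
      rw [List.filter_cons_of_pos (by simpa using hi), List.filter_cons_of_neg (by simpa using h2),
        List.cons_append, ← ih hL.2]
    · have h2 : m ≤ i := by omega
      have h3 : L.filter (· < m) = [] := by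
        rw [List.filter_eq_nil_iff]
        intro j hj
        have := hL.1 j hj
        simp only [decide_eq_true_eq]
        omega
      have h4 : L.filter (m ≤ ·) = L := by
        rw [List.filter_eq_self]
        intro j hj
        have := hL.1 j hj
        simp only [decide_eq_true_eq]
        omega
      rw [List.filter_cons_of_neg (by simpa using hi), List.filter_cons_of_pos (by simpa using h2),
        h3, h4, List.nil_append]

theorem List.exists_forall_lt (L : List ℕ) : ∃ B, ∀ i ∈ L, i < B :=
  ⟨L.sum + 1, fun _ hi => Nat.lt_succ_of_le (List.le_sum_of_mem hi)⟩

/-! ### Coordinates, restrictions and tails in list-normed spaces -/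

namespace IsListNormed

variable {𝕜 : Type*} [RCLike 𝕜] {r : ℕ → ℕ → Prop} {w : ℕ → ℝ} {p : ℝ} {E : Type*}
    [NormedAddCommGroup E] [NormedSpace 𝕜 E] {co : E →ₗ[𝕜] (ℕ → 𝕜)}
    (h : IsListNormed r w p co)
include h

theorem pos : 0 < p := by have := h.one_le; linarith

theorem pairwise_of_lt {L : List ℕ} (hL : L.Pairwise (· < ·)) : L.Pairwise r :=
  hL.imp fun {i j} => h.of_lt i j

theorem norm_co_le (a : E) (i : ℕ) : ‖co a i‖ ≤ ‖a‖ := by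
  have h1 := h.listSum_le a [i] (by simp)
  rw [listSum_cons, listSum_nil, h.weight.1, mul_one, add_zero] at h1
  exact (Real.rpow_le_rpow_iff (norm_nonneg _) (norm_nonneg _) h.pos).mp h1

theorem norm_le_of_norm_co_le {a b : E} (hab : ∀ i, ‖co a i‖ ≤ ‖co b i‖) : ‖a‖ ≤ ‖b‖ :=
  h.norm_le a _ (norm_nonneg _) fun L hL =>
    (listSum_mono h.weight h.one_le fun i _ => hab i).trans (h.listSum_le b L hL)

theorem injective : Function.Injective co := by
  rw [injective_iff_map_eq_zero]
  intro a ha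
  rw [← norm_le_zero_iff]
  have h1 := h.norm_le_of_norm_co_le (a := a) (b := 0) fun i => by rw [ha, map_zero]
  simpa using h1

theorem tendsto_co (a : E) : Tendsto (co a) atTop (𝓝 0) :=
  tendsto_zero_of_listSum_le h.weight h.one_le fun L hL => h.listSum_le a L (h.pairwise_of_lt hL)

theorem exists_restrict (S : Set ℕ) (a : E) : ∃ b, co b = S.indicator (co a) := by
  refine h.exists_co _ (‖a‖ ^ p) fun L hL => ?_
  refine (listSum_mono h.weight h.one_le fun i _ => ?_).trans (h.listSum_le a L hL)
  exact norm_indicator_le_norm_self _ _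

theorem exists_lt_listSum (a : E) {M : ℝ} (hM : 0 ≤ M) (hMa : M < ‖a‖) :
    ∃ L : List ℕ, L.Pairwise r ∧ M ^ p < listSum w p (co a) 0 L := by
  by_contra! hcon
  exact absurd (h.norm_le a M hM hcon) (not_le.mpr hMa)

theorem pairwise_append {L L' : List ℕ} {B : ℕ} (hL : L.Pairwise r) (hL' : L'.Pairwise r)
    (h1 : ∀ i ∈ L, i < B) (h2 : ∀ i ∈ L', B ≤ i) : (L ++ L').Pairwise r :=
  List.pairwise_append.mpr ⟨hL, hL', fun i hi j hj => h.of_lt i j ((h1 i hi).trans_le (h2 j hj))⟩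

/-- The tails of a vector tend to zero in norm. -/
theorem exists_norm_tail_le (a : E) {ε : ℝ} (hε : 0 < ε) :
    ∃ N, ∀ b, (∀ i, co b i ≠ 0 → N ≤ i) → (∀ i, ‖co b i‖ ≤ ‖co a i‖) → ‖b‖ ≤ ε := by
  by_contra! hcon
  have hp0 := h.pos
  have hη : 0 < ε ^ p := by positivity
  -- Far out the coordinates of `a` are so small that the first `t` entries of a list contribute at
  -- most half of `ε ^ p`; the rest of the list therefore contributes the other half from position
  -- `t` on.
  have step : ∀ N t : ℕ, ∃ L : List ℕ, L.Pairwise r ∧ (∀ i ∈ L, N ≤ i) ∧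
      ε ^ p / 2 ≤ listSum w p (co a) t L := by
    intro N t
    obtain ⟨θ, hθ, -, hθt⟩ := exists_pos_mul_rpow_le h.one_le t (half_pos hη)
    obtain ⟨N', hN'⟩ := (Metric.tendsto_atTop.mp (h.tendsto_co a)) θ hθ
    obtain ⟨b, hb1, hb2, hb3⟩ := hcon (max N N')
    obtain ⟨L, hL, hLb⟩ := h.exists_lt_listSum b hε.le hb3
    have h1 : listSum w p (co b) 0 L ≤ listSum w p (co b) 0 (L.filter (max N N' ≤ ·)) :=
      listSum_le_filter h.weight h.one_le _ fun i _ hi => by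
        by_contra hne
        exact hi (hb1 i hne)
    have h2 := h1.trans (listSum_mono (b := co a) h.weight h.one_le fun i _ => hb2 i)
    have hmem : ∀ i ∈ L.filter (max N N' ≤ ·), max N N' ≤ i := fun i hi => by
      simpa using (List.mem_filter.mp hi).2
    have h5 := listSum_eq_take_add_drop (w := w) (p := p) (a := co a) 0 t
      (L.filter (max N N' ≤ ·))
    rw [zero_add] at h5
    have h3 : listSum w p (co a) 0 ((L.filter (max N N' ≤ ·)).take t) ≤ t * θ ^ p := by
      refine (listSum_le_length h.weight h.one_le (δ := θ) fun i hi => ?_).trans ?_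
      · have h4 := hN' i ((le_max_right _ _).trans (hmem i (List.mem_of_mem_take hi)))
        rw [dist_zero_right] at h4
        exact h4.le
      · have : (((L.filter (max N N' ≤ ·)).take t).length : ℝ) ≤ t := by
          exact_mod_cast List.length_take_le _ _
        gcongr
    refine ⟨(L.filter (max N N' ≤ ·)).drop t, (hL.filter _).drop, fun i hi =>
      (le_max_left _ _).trans (hmem i (List.mem_of_mem_drop hi)), ?_⟩
    linarith
  -- Since `step` allows any starting position and any region far out, such lists can be
  -- concatenated, which makes the list sums of `a` unbounded.
  have key : ∀ K : ℕ, ∃ L : List ℕ, L.Pairwise r ∧ K * (ε ^ p / 2) ≤ listSum w p (co a) 0 L := by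
    intro K
    induction K with
    | zero => exact ⟨[], by simp⟩
    | succ K ih =>
      obtain ⟨L, hL, hK⟩ := ih
      obtain ⟨B, hB⟩ := L.exists_forall_lt
      obtain ⟨L', hL', hB', hK'⟩ := step B L.length
      refine ⟨L ++ L', h.pairwise_append hL hL' hB hB', ?_⟩
      rw [listSum_append, zero_add]
      push_cast
      linarith
  obtain ⟨K, hK⟩ := exists_nat_gt (‖a‖ ^ p / (ε ^ p / 2))
  obtain ⟨L, hL, hLK⟩ := key K
  rw [div_lt_iff₀ (by positivity)] at hK
  linarith [h.listSum_le a L hL]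

end IsListNormed

section ConstOn

variable {𝕜 : Type*} [RCLike 𝕜]

/-- The finitely supported family with the constant value `c` on `A`. -/
noncomputable def constOn (A : Finset ℕ) (c : 𝕜) : ℕ →₀ 𝕜 := Finsupp.indicator A fun _ _ => c

theorem constOn_apply (A : Finset ℕ) (c : 𝕜) (k : ℕ) : constOn A c k = if k ∈ A then c else 0 := by
  simp [constOn, Finsupp.indicator_apply]

theorem support_constOn_subset (A : Finset ℕ) (c : 𝕜) : (constOn A c).support ⊆ A :=
  Finsupp.support_indicator_subset _ _

theorem norm_constOn_le (A : Finset ℕ) (c : 𝕜) (k : ℕ) : ‖constOn A c k‖ ≤ ‖c‖ := by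
  rw [constOn_apply]
  split_ifs <;> simp

theorem linearCombination_constOn {E : Type*} [AddCommGroup E] [Module 𝕜 E] (b : ℕ → E)
    (A : Finset ℕ) (c : 𝕜) :
    Finsupp.linearCombination 𝕜 b (constOn A c) = c • ∑ k ∈ A, b k := by
  rw [Finsupp.linearCombination_apply,
    Finsupp.sum_of_support_subset _ (support_constOn_subset A c) _ (by simp), Finset.smul_sum]
  refine Finset.sum_congr rfl fun k hk => ?_
  rw [constOn_apply, if_pos hk]

end ConstOn

/-! ### Block sequences -/

/-- The `k`-th vector is supported in the interval `[M k, M (k + 1))`. -/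
structure IsBlockSequence {𝕜 : Type*} [RCLike 𝕜] {E : Type*} [NormedAddCommGroup E]
    [NormedSpace 𝕜 E] (co : E →ₗ[𝕜] (ℕ → 𝕜)) (b : ℕ → E) (M : ℕ → ℕ) : Prop where
  mono : Monotone M
  supp : ∀ k i, co (b k) i ≠ 0 → M k ≤ i ∧ i < M (k + 1)

namespace IsBlockSequence

variable {𝕜 : Type*} [RCLike 𝕜] {r : ℕ → ℕ → Prop} {w : ℕ → ℝ} {p : ℝ} {E : Type*}
    [NormedAddCommGroup E] [NormedSpace 𝕜 E] {co : E →ₗ[𝕜] (ℕ → 𝕜)} {b : ℕ → E} {M : ℕ → ℕ}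

theorem comp (hb : IsBlockSequence co b M) {φ : ℕ → ℕ} (hφ : StrictMono φ) :
    IsBlockSequence co (fun k => b (φ k)) (fun k => M (φ k)) where
  mono := hb.mono.comp hφ.monotone
  supp k i hi := by
    have := hb.supp _ i hi
    exact ⟨this.1, this.2.trans_le (hb.mono (Nat.succ_le_of_lt (hφ (Nat.lt_succ_self k))))⟩

theorem disjoint (hb : IsBlockSequence co b M) {k l : ℕ} (hkl : k ≠ l) (i : ℕ) :
    co (b k) i = 0 ∨ co (b l) i = 0 := by
  by_contra! hcon
  have h1 := hb.supp k i hcon.1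
  have h2 := hb.supp l i hcon.2
  rcases lt_or_gt_of_ne hkl with h | h
  · have := hb.mono (Nat.succ_le_of_lt h); simp only [Nat.succ_eq_add_one] at this; omega
  · have := hb.mono (Nat.succ_le_of_lt h); simp only [Nat.succ_eq_add_one] at this; omega

theorem co_linearCombination (co : E →ₗ[𝕜] (ℕ → 𝕜)) (b : ℕ → E) (f : ℕ →₀ 𝕜) :
    co (Finsupp.linearCombination 𝕜 b f) = ∑ k ∈ f.support, f k • co (b k) := by
  rw [Finsupp.linearCombination_apply, Finsupp.sum, map_sum]
  simp

/-- Along a fixed list the `p`-th powers of disjointly supported vectors add up exactly; every upper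
estimate for blocks comes from this. -/
theorem listSum_linearCombination (hb : IsBlockSequence co b M) (hp : 1 ≤ p) (f : ℕ →₀ 𝕜) (t : ℕ)
    (L : List ℕ) : listSum w p (co (Finsupp.linearCombination 𝕜 b f)) t L =
      ∑ k ∈ f.support, ‖f k‖ ^ p * listSum w p (co (b k)) t L := by
  rw [co_linearCombination, listSum_sum_of_disjoint hp]
  · exact Finset.sum_congr rfl fun k _ => listSum_smul _ _ _
  · intro k _ l _ hkl i
    rcases hb.disjoint hkl i with h | h <;> simp [h]

theorem co_linearCombination_apply (hb : IsBlockSequence co b M) (f : ℕ →₀ 𝕜) {k i : ℕ}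
    (hk : co (b k) i ≠ 0) : co (Finsupp.linearCombination 𝕜 b f) i = f k * co (b k) i := by
  rw [co_linearCombination, Finset.sum_apply, Finset.sum_eq_single k]
  · simp
  · intro l _ hlk
    simp [(hb.disjoint hlk i).resolve_right hk]
  · intro hk
    simp [Finsupp.notMem_support_iff.mp hk]

theorem exists_of_co_linearCombination_ne_zero (f : ℕ →₀ 𝕜) {i : ℕ}
    (hi : co (Finsupp.linearCombination 𝕜 b f) i ≠ 0) : ∃ k ∈ f.support, co (b k) i ≠ 0 := by
  rw [co_linearCombination, Finset.sum_apply] at hi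
  obtain ⟨k, hk, hki⟩ := Finset.exists_ne_zero_of_sum_ne_zero hi
  exact ⟨k, hk, fun h => hki (by simp [h])⟩

theorem le_of_co_linearCombination_ne_zero (hb : IsBlockSequence co b M) {f : ℕ →₀ 𝕜} {m i : ℕ}
    (hf : ∀ k ∈ f.support, m ≤ k) (hi : co (Finsupp.linearCombination 𝕜 b f) i ≠ 0) : M m ≤ i := by
  obtain ⟨k, hk, hki⟩ := exists_of_co_linearCombination_ne_zero f hi
  exact (hb.mono (hf k hk)).trans (hb.supp k i hki).1

theorem lt_of_co_linearCombination_ne_zero (hb : IsBlockSequence co b M) {f : ℕ →₀ 𝕜} {m i : ℕ}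
    (hf : ∀ k ∈ f.support, k < m) (hi : co (Finsupp.linearCombination 𝕜 b f) i ≠ 0) : i < M m := by
  obtain ⟨k, hk, hki⟩ := exists_of_co_linearCombination_ne_zero f hi
  exact (hb.supp k i hki).2.trans_le (hb.mono (Nat.succ_le_of_lt (hf k hk)))

theorem norm_co_linearCombination_le (hb : IsBlockSequence co b M) (h : IsListNormed r w p co)
    (f : ℕ →₀ 𝕜) {θ : ℝ} (hθ : 0 ≤ θ) (hf : ∀ k, ‖f k‖ * ‖b k‖ ≤ θ) (i : ℕ) :
    ‖co (Finsupp.linearCombination 𝕜 b f) i‖ ≤ θ := by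
  by_cases hi : co (Finsupp.linearCombination 𝕜 b f) i = 0
  · simpa [hi] using hθ
  · obtain ⟨k, -, hki⟩ := exists_of_co_linearCombination_ne_zero f hi
    rw [hb.co_linearCombination_apply f hki, norm_mul]
    exact (mul_le_mul_of_nonneg_left (h.norm_co_le _ _) (norm_nonneg _)).trans (hf k)

/-- Block sequences satisfy an upper `p`-estimate. -/
theorem norm_linearCombination_rpow_le (hb : IsBlockSequence co b M) (h : IsListNormed r w p co)
    (f : ℕ →₀ 𝕜) {C : ℝ} (hC : 0 ≤ C) (hbC : ∀ k, ‖b k‖ ≤ C) :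
    ‖Finsupp.linearCombination 𝕜 b f‖ ≤ C * (f.sum fun _ c => ‖c‖ ^ p) ^ (1 / p) := by
  have hp0 := h.pos
  have hS : 0 ≤ f.sum fun _ c => ‖c‖ ^ p := Finset.sum_nonneg fun k _ => by positivity
  refine h.norm_le _ _ (by positivity) fun L hL => ?_
  rw [Real.mul_rpow hC (by positivity), ← Real.rpow_mul hS, one_div, inv_mul_cancel₀ hp0.ne',
    Real.rpow_one, hb.listSum_linearCombination h.one_le, Finsupp.sum, Finset.mul_sum]
  refine Finset.sum_le_sum fun k _ => ?_
  rw [mul_comm]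
  refine mul_le_mul_of_nonneg_right ((h.listSum_le _ L hL).trans ?_) (by positivity)
  exact Real.rpow_le_rpow (norm_nonneg _) (hbC k) hp0.le

/-- If the shifted list sums of the blocks are uniformly small then so are those of short
combinations. -/
theorem listSum_linearCombination_le (hb : IsBlockSequence co b M) (hp : 1 ≤ p)
    (hw : w ∈ weightClass) (f : ℕ →₀ 𝕜) {s t : ℕ} {ε : ℝ} (hf : ∀ k, ‖f k‖ ≤ 1)
    (hs : f.support.card ≤ s) {L : List ℕ}
    (hL : ∀ k ∈ f.support, listSum w p (co (b k)) t L ≤ ε / (s + 1)) (hε : 0 ≤ ε) :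
    listSum w p (co (Finsupp.linearCombination 𝕜 b f)) t L ≤ ε := by
  rw [hb.listSum_linearCombination hp]
  have h1 : ∀ k ∈ f.support, ‖f k‖ ^ p * listSum w p (co (b k)) t L ≤ ε / (s + 1) := by
    intro k hk
    refine (mul_le_of_le_one_left (listSum_nonneg hw t L) ?_).trans (hL k hk)
    exact Real.rpow_le_one (norm_nonneg _) (hf k) (by linarith)
  refine (Finset.sum_le_card_nsmul _ _ _ h1).trans ?_
  rw [nsmul_eq_mul]
  calc (f.support.card : ℝ) * (ε / (s + 1)) ≤ (s + 1) * (ε / (s + 1)) := by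
        have : (f.support.card : ℝ) ≤ s := by exact_mod_cast hs
        gcongr
        linarith
    _ = ε := by field_simp

end IsBlockSequence

/-- The shifted list sums of the vectors `b n` are eventually uniformly small. -/
def EventuallySmallShifts {𝕜 : Type*} [RCLike 𝕜] (r : ℕ → ℕ → Prop) (w : ℕ → ℝ) (p : ℝ)
    {E : Type*} [NormedAddCommGroup E] [NormedSpace 𝕜 E] (co : E →ₗ[𝕜] (ℕ → 𝕜)) (b : ℕ → E) :
    Prop :=
  ∀ ε > 0, ∃ t N : ℕ, ∀ n ≥ N, ∀ L : List ℕ, L.Pairwise r → listSum w p (co (b n)) t L ≤ ε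

namespace EventuallySmallShifts

variable {𝕜 : Type*} [RCLike 𝕜] {r : ℕ → ℕ → Prop} {w : ℕ → ℝ} {p : ℝ} {E : Type*}
    [NormedAddCommGroup E] [NormedSpace 𝕜 E] {co : E →ₗ[𝕜] (ℕ → 𝕜)} {b : ℕ → E} {M : ℕ → ℕ}

/-- If all coordinates of `b n` were tiny, the first `t` entries of a list would contribute little
by flatness and the others little by smallness of the shifts, against the lower bound for the norm.
-/
theorem exists_le_norm_co (hs : EventuallySmallShifts r w p co b) (h : IsListNormed r w p co)
    {c : ℝ} (hc : 0 < c) (hbc : ∀ n, c ≤ ‖b n‖) :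
    ∃ δ > 0, ∃ N, ∀ n ≥ N, ∃ i, δ ≤ ‖co (b n) i‖ := by
  have hp0 := h.pos
  obtain ⟨t, N, htN⟩ := hs (c ^ p / 4) (by positivity)
  obtain ⟨θ, hθ, -, hθt⟩ := exists_pos_mul_rpow_le h.one_le t (ε := c ^ p / 4) (by positivity)
  refine ⟨θ, hθ, N, fun n hn => ?_⟩
  by_contra! hcon
  have hlt : (c ^ p / 2) ^ (1 / p) < ‖b n‖ := by
    refine lt_of_lt_of_le ?_ (hbc n)
    have h1 : c = (c ^ p) ^ (1 / p) := by
      rw [← Real.rpow_mul hc.le, one_div, mul_inv_cancel₀ hp0.ne', Real.rpow_one]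
    conv_rhs => rw [h1]
    refine Real.rpow_lt_rpow (by positivity) ?_ (by positivity)
    have : 0 < c ^ p := by positivity
    linarith
  obtain ⟨L, hL, hL2⟩ := h.exists_lt_listSum _ (by positivity) hlt
  rw [← Real.rpow_mul (by positivity), one_div, inv_mul_cancel₀ hp0.ne', Real.rpow_one,
    listSum_eq_take_add_drop 0 t, zero_add] at hL2
  have h1 := htN n hn (L.drop t) hL.drop
  have h2 := listSum_le_length h.weight h.one_le (t := 0) (L := L.take t) (δ := θ)
    fun i _ => (hcon i).le
  have h3 : ((L.take t).length : ℝ) * θ ^ p ≤ t * θ ^ p := by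
    have : ((L.take t).length : ℝ) ≤ t := by exact_mod_cast List.length_take_le _ _
    gcongr
  linarith

end EventuallySmallShifts

namespace IsBlockSequence

variable {𝕜 : Type*} [RCLike 𝕜] {r : ℕ → ℕ → Prop} {w : ℕ → ℝ} {p : ℝ} {E : Type*}
    [NormedAddCommGroup E] [NormedSpace 𝕜 E] {co : E →ₗ[𝕜] (ℕ → 𝕜)} {b : ℕ → E} {M : ℕ → ℕ}

/-- One large coordinate from each block gives an increasing list, admissible for both norms. The
condition `≠ 0` places the coordinate inside its block even when `δ = 0`. -/
theorem le_norm_sum_rpow (hb : IsBlockSequence co b M) (h : IsListNormed r w p co) {δ : ℝ}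
    (hδ : 0 ≤ δ) (m n : ℕ) (hbδ : ∀ k ≥ m, ∃ i, δ ≤ ‖co (b k) i‖ ∧ co (b k) i ≠ 0) :
    δ ^ p * ∑ j ∈ Finset.range n, w j ≤ ‖∑ k ∈ Finset.Ico m (m + n), b k‖ ^ p := by
  have hex : ∀ k, ∃ i, m ≤ k → δ ≤ ‖co (b k) i‖ ∧ co (b k) i ≠ 0 := fun k => by
    by_cases hk : m ≤ k
    · obtain ⟨i, hi⟩ := hbδ k hk
      exact ⟨i, fun _ => hi⟩
    · exact ⟨0, fun h => absurd h hk⟩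
  choose idx hidx using hex
  have hL : ((List.range' m n).map idx).Pairwise r := by
    rw [List.pairwise_map]
    refine List.Pairwise.imp_of_mem ?_ (List.pairwise_lt_range' (s := m) (n := n))
    intro k l hk hl hkl
    have hk' := (List.mem_range'_1.mp hk).1
    have hl' := (List.mem_range'_1.mp hl).1
    refine h.of_lt _ _ ?_
    have h1 := hb.supp k _ (hidx k hk').2
    have h2 := hb.supp l _ (hidx l hl').2
    exact h1.2.trans_le ((hb.mono (Nat.succ_le_of_lt hkl)).trans h2.1)
  refine le_trans ?_ (h.listSum_le _ _ hL)
  have h1 := le_listSum (a := co (∑ k ∈ Finset.Ico m (m + n), b k)) h.weight h.one_le (t := 0)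
    (L := (List.range' m n).map idx) hδ ?_
  · simpa using h1
  · intro i hi
    obtain ⟨k, hk, rfl⟩ := List.mem_map.mp hi
    have hk' := List.mem_range'_1.mp hk
    obtain ⟨h2, h3⟩ := hidx k hk'.1
    have h4 := hb.co_linearCombination_apply (constOn (Finset.Ico m (m + n)) 1) h3
    rw [linearCombination_constOn, one_smul, constOn_apply,
      if_pos (Finset.mem_Ico.mpr hk'), one_mul] at h4
    rwa [h4]

end IsBlockSequence

/-! ### Comparison of block sequences of the two spaces -/

section Comparison

variable {𝕜 : Type*} [RCLike 𝕜] {r : ℕ → ℕ → Prop} {w : ℕ → ℝ} {p : ℝ} {E : Type*}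
    [NormedAddCommGroup E] [NormedSpace 𝕜 E] {co : E →ₗ[𝕜] (ℕ → 𝕜)}

/-- Since `∑_{j<n} w j` is unbounded, the sum of `n` blocks with a coordinate of size `δ` has norm
at least `C / θ` for large `n`; dividing by the norm yields small equal coefficients. The length `n`
does not depend on the position `m`. -/
theorem IsBlockSequence.exists_normalized_constOn {b : ℕ → E} {M : ℕ → ℕ}
    (hb : IsBlockSequence co b M) (h : IsListNormed r w p co) {δ : ℝ} (hδ : 0 < δ) {N : ℕ}
    (hbδ : ∀ k ≥ N, ∃ i, δ ≤ ‖co (b k) i‖) {C θ : ℝ} (hC : 0 < C) (hθ : 0 < θ) :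
    ∃ n : ℕ, ∀ m ≥ N, ∃ c : ℝ, 0 < c ∧ c * C ≤ θ ∧
      ‖Finsupp.linearCombination 𝕜 b (constOn (Finset.Ico m (m + n)) (c : 𝕜))‖ = 1 := by
  have hp0 := h.pos
  obtain ⟨n, hn⟩ := ((tendsto_sum_weight h.weight).eventually_ge_atTop ((C / θ / δ) ^ p)).exists
  refine ⟨n, fun m hm => ?_⟩
  have h1 := hb.le_norm_sum_rpow h hδ.le m n fun k hk => by
    obtain ⟨i, hi⟩ := hbδ k (hm.trans hk)
    exact ⟨i, hi, fun h0 => by rw [h0, norm_zero] at hi; linarith⟩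
  set D := ‖∑ k ∈ Finset.Ico m (m + n), b k‖ with hD
  have h2 : C / θ ≤ D := by
    rw [← Real.rpow_le_rpow_iff (by positivity) (norm_nonneg _) hp0]
    refine le_trans ?_ h1
    calc (C / θ) ^ p = δ ^ p * (C / θ / δ) ^ p := by
          rw [← Real.mul_rpow hδ.le (by positivity)]
          congr 1
          field_simp
      _ ≤ _ := by gcongr
  have hD0 : 0 < D := lt_of_lt_of_le (by positivity) h2
  refine ⟨D⁻¹, by positivity, ?_, ?_⟩
  · rw [div_le_iff₀ hθ] at h2
    rw [inv_mul_le_iff₀ hD0]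
    linarith
  · rw [linearCombination_constOn, norm_smul, ← hD, RCLike.norm_ofReal, abs_of_pos (by positivity),
      inv_mul_cancel₀ hD0.ne']

/-- A flat normalised vector placed in front of `v` costs little if the shifted list sums of `v`
are small. -/
theorem listSum_add_le_of_front (hw : w ∈ weightClass) (hp : 1 ≤ p) {u v : ℕ → 𝕜} {m t : ℕ}
    {θ ε B : ℝ} (hu : ∀ i, u i ≠ 0 → i < m) (hv : ∀ i, v i ≠ 0 → m ≤ i) (hθ : ∀ i, ‖u i‖ ≤ θ)
    (htθ : t * θ ^ p ≤ ε)
    (hu1 : ∀ L : List ℕ, L.Pairwise (· < ·) → listSum w p u 0 L ≤ 1)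
    (hvB : ∀ L : List ℕ, L.Pairwise (· < ·) → listSum w p v 0 L ≤ B)
    (hvt : ∀ L : List ℕ, L.Pairwise (· < ·) → listSum w p v t L ≤ 1) {L : List ℕ}
    (hL : L.Pairwise (· < ·)) : listSum w p (u + v) 0 L ≤ max 2 (B + ε) := by
  have hθ0 : 0 ≤ θ := (norm_nonneg _).trans (hθ 0)
  have hu0 : ∀ i, ¬ i < m → u i = 0 := fun i hi => by
    by_contra hne
    exact hi (hu i hne)
  have hv0 : ∀ i, ¬ m ≤ i → v i = 0 := fun i hi => by
    by_contra hne
    exact hi (hv i hne)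
  set L1 := L.filter (· < m) with hL1
  set L2 := L.filter (m ≤ ·) with hL2
  have hm1 : ∀ i ∈ L1, i < m := fun i hi => by simpa using (List.mem_filter.mp hi).2
  have hm2 : ∀ i ∈ L2, m ≤ i := fun i hi => by simpa using (List.mem_filter.mp hi).2
  have hp1 : L1.Pairwise (· < ·) := hL.filter _
  have hp2 : L2.Pairwise (· < ·) := hL.filter _
  have hsplit : listSum w p (u + v) 0 L = listSum w p u 0 L1 + listSum w p v L1.length L2 := by
    rw [List.pairwise_lt_eq_filter_append m hL, ← hL1, ← hL2, listSum_append, zero_add]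
    congr 1
    · refine listSum_congr fun i hi => ?_
      rw [Pi.add_apply, hv0 i (by have := hm1 i hi; omega), add_zero]
    · refine listSum_congr fun i hi => ?_
      rw [Pi.add_apply, hu0 i (by have := hm2 i hi; omega), zero_add]
  rw [hsplit]
  -- With at least `t` entries in the front vector, `v` is met only from the weight `w t` on and the
  -- total is at most `1 + 1`. With at most `t`, flatness bounds the front contribution by `t * θ ^
  -- p ≤ ε`.
  rcases le_total t L1.length with ht | ht
  · refine le_max_of_le_left ?_
    linarith [hu1 L1 hp1, (listSum_anti hw ht L2).trans (hvt L2 hp2)]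
  · refine le_max_of_le_right ?_
    have h1 := listSum_le_length hw hp (t := 0) (L := L1) (δ := θ) fun i _ => hθ i
    have h2 : (L1.length : ℝ) * θ ^ p ≤ t * θ ^ p := by
      have : (L1.length : ℝ) ≤ t := by exact_mod_cast ht
      gcongr
    linarith [(listSum_anti hw (Nat.zero_le L1.length) L2).trans (hvB L2 hp2)]

/-- When the lists need not be increasing, list sums of disjoint flat vectors add up. -/
theorem exists_listSum_add_ge (hw : w ∈ weightClass) (hp : 1 ≤ p) {u v : ℕ → 𝕜} {m τ ℓ : ℕ}
    {θ κ B : ℝ} (hu : ∀ i, u i ≠ 0 → i < m) (hv : ∀ i, v i ≠ 0 → m ≤ i) (hθ : ∀ i, ‖u i‖ ≤ θ)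
    (hℓθ : ℓ * θ ^ p ≤ κ)
    (hu1 : ∃ L : List ℕ, L.Pairwise (· ≠ ·) ∧ 3 * κ ≤ listSum w p u 0 L)
    (huτ : ∀ L : List ℕ, L.Pairwise (· ≠ ·) → listSum w p u τ L ≤ κ)
    (hvB : ∃ L : List ℕ, L.Pairwise (· ≠ ·) ∧ L.length ≤ ℓ ∧ B ≤ listSum w p v 0 L) :
    ∃ L : List ℕ, L.Pairwise (· ≠ ·) ∧ L.length ≤ ℓ + τ ∧ B + κ ≤ listSum w p (u + v) 0 L := by
  have hθ0 : 0 ≤ θ := (norm_nonneg _).trans (hθ 0)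
  have hu0 : ∀ i, ¬ i < m → u i = 0 := fun i hi => by
    by_contra hne
    exact hi (hu i hne)
  have hv0 : ∀ i, ¬ m ≤ i → v i = 0 := fun i hi => by
    by_contra hne
    exact hi (hv i hne)
  obtain ⟨Lv, hLv, hLvℓ, hLvB⟩ := hvB
  obtain ⟨Lu, hLu, hLu3⟩ := hu1
  set L1 := Lv.filter (m ≤ ·) with hL1
  set L2 := Lu.filter (· < m) with hL2
  have hm1 : ∀ i ∈ L1, m ≤ i := fun i hi => by simpa using (List.mem_filter.mp hi).2
  have hm2 : ∀ i ∈ L2, i < m := fun i hi => by simpa using (List.mem_filter.mp hi).2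
  have hlen : L1.length ≤ ℓ := (List.length_filter_le _ _).trans hLvℓ
  have hB : B ≤ listSum w p v 0 L1 :=
    hLvB.trans (listSum_le_filter hw hp _ fun i _ hi => hv0 i hi)
  have h3 : 3 * κ ≤ listSum w p u 0 L2 :=
    hLu3.trans (listSum_le_filter hw hp _ fun i _ hi => hu0 i hi)
  have hp2 : L2.Pairwise (· ≠ ·) := hLu.filter _
  rw [listSum_eq_take_add_drop 0 τ, zero_add] at h3
  have h4 := huτ _ (hp2.drop (i := τ))
  -- Truncation at `τ` costs at most `κ` of the `3 * κ` and keeps the length of the final list under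
  -- control.
  set L3 := L2.take τ with hL3
  have h5 := listSum_eq_take_add_drop (w := w) (p := p) (a := u) 0 L1.length L3
  have h6 := listSum_le_length hw hp (t := 0) (L := L3.take L1.length) (δ := θ) fun i _ => hθ i
  have h7 : ((L3.take L1.length).length : ℝ) * θ ^ p ≤ ℓ * θ ^ p := by
    have : ((L3.take L1.length).length : ℝ) ≤ ℓ := by
      exact_mod_cast (List.length_take_le _ _).trans hlen
    gcongr
  have hm3 : ∀ i ∈ L3.drop L1.length, i < m := fun i hi =>
    hm2 i (List.mem_of_mem_take (List.mem_of_mem_drop hi))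
  -- The old stack takes over the first `L1.length` positions; the entries of `L3` behind them keep
  -- their own weights. The flat entries given up cost at most `ℓ * θ ^ p ≤ κ`, so at least `κ`
  -- remains. This list need not be increasing.
  refine ⟨L1 ++ L3.drop L1.length, ?_, ?_, ?_⟩
  · refine List.pairwise_append.mpr ⟨hLv.filter _, hp2.take.drop, fun i hi j hj => ?_⟩
    have := hm1 i hi
    have := hm3 j hj
    omega
  · rw [List.length_append, List.length_drop]
    have := List.length_take_le τ L2
    rw [← hL3] at this
    omega
  · rw [listSum_append, zero_add]
    have h8 : listSum w p (u + v) 0 L1 = listSum w p v 0 L1 := listSum_congr fun i hi => by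
      rw [Pi.add_apply, hu0 i (by have := hm1 i hi; omega), zero_add]
    have h9 : listSum w p (u + v) L1.length (L3.drop L1.length) =
        listSum w p u L1.length (L3.drop L1.length) := listSum_congr fun i hi => by
      rw [Pi.add_apply, hv0 i (by have := hm3 i hi; omega), add_zero]
    rw [h8, h9]
    rw [zero_add] at h5
    linarith

variable {F : Type*} [NormedAddCommGroup F] [NormedSpace 𝕜 F]

/-- There are combinations of the vectors `b k`, `k ≥ m`, with bounded norm for which the norm of
the corresponding combination of the `d k` is of order `K ^ (1/p)`, and which are of bounded
length, uniformly in `m`. -/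
def HasStackedCombinations (w : ℕ → ℝ) (p : ℝ) (co : E →ₗ[𝕜] (ℕ → 𝕜)) (co' : F →ₗ[𝕜] (ℕ → 𝕜))
    (b : ℕ → E) (d : ℕ → F) (κ : ℝ) (K : ℕ) : Prop :=
  ∃ s ℓ N : ℕ, ∀ m ≥ N, ∃ f : ℕ →₀ 𝕜, (∀ k ∈ f.support, m ≤ k) ∧ f.support.card ≤ s ∧
    (∀ k, ‖f k‖ ≤ 1) ∧
    (∀ L : List ℕ, L.Pairwise (· < ·) →
      listSum w p (co (Finsupp.linearCombination 𝕜 b f)) 0 L ≤ 4 - 2 * (1 / 2) ^ K) ∧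
    ∃ L : List ℕ, L.Pairwise (· ≠ ·) ∧ L.length ≤ ℓ ∧
      κ * K ≤ listSum w p (co' (Finsupp.linearCombination 𝕜 d f)) 0 L

variable {co' : F →ₗ[𝕜] (ℕ → 𝕜)} {b : ℕ → E} {d : ℕ → F} {M M' : ℕ → ℕ}

/-- The order of choices matters: `s` and `ℓ` for the old stack determine the shift `t`, then the
flatness `θ`, then the length `n` of the front vector, and finally the truncation length `τ`. All
are uniform in `m`, so the old stack can be started at `m + n`, behind a front vector on `[m, m +
n)`. -/
theorem HasStackedCombinations.succ (hE : IsListNormed (· < ·) w p co)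
    (hF : IsListNormed (· ≠ ·) w p co') (hb : IsBlockSequence co b M)
    (hd : IsBlockSequence co' d M') {C : ℝ} (hC : 1 ≤ C) (hbC : ∀ k, ‖b k‖ ≤ C)
    (hdC : ∀ k, ‖d k‖ ≤ C) {δ : ℝ} (hδ : 0 < δ) {N₀ : ℕ} (hbδ : ∀ k ≥ N₀, ∃ i, δ ≤ ‖co (b k) i‖)
    (hbs : EventuallySmallShifts (· < ·) w p co b) (hds : EventuallySmallShifts (· ≠ ·) w p co' d)
    (hbd : ∀ (f : ℕ →₀ 𝕜) (η : ℝ), (∀ k, ‖f k‖ ≤ η) →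
      ‖Finsupp.linearCombination 𝕜 b f‖ ≤ C * ‖Finsupp.linearCombination 𝕜 d f‖ + C * η)
    {κ : ℝ} (hκ : 0 < κ) (hκC : 3 * κ = (1 / (4 * C)) ^ p) {K : ℕ}
    (hK : HasStackedCombinations w p co co' b d κ K) :
    HasStackedCombinations w p co co' b d κ (K + 1) := by
  have hw := hE.weight
  have hp := hE.one_le
  have hC0 : 0 < C := by linarith
  obtain ⟨s, ℓ, N, hf⟩ := hK
  -- The old stack combines at most `s` blocks with coefficients of modulus at most `1`, so its list
  -- sums shifted by `t` are at most `1`.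
  obtain ⟨t, N₁, ht⟩ := hbs (1 / (s + 1)) (by positivity)
  obtain ⟨θ, hθ, hθ2, hθε⟩ := exists_pos_mul_rpow_le hp (t + ℓ) (ε := min ((1 / 2) ^ K) κ)
    (lt_min (by positivity) hκ)
  push_cast at hθε
  rw [add_mul] at hθε
  have hθp : 0 < θ ^ p := by positivity
  have htθ : t * θ ^ p ≤ (1 / 2) ^ K := by
    have : 0 ≤ ℓ * θ ^ p := by positivity
    linarith [hθε.trans (min_le_left _ _)]
  have hℓθ : ℓ * θ ^ p ≤ κ := by
    have : 0 ≤ t * θ ^ p := by positivity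
    linarith [hθε.trans (min_le_right _ _)]
  obtain ⟨n, hn⟩ := hb.exists_normalized_constOn hE hδ hbδ hC0 hθ
  -- The front vector uses at most `n` blocks, so its image has list sums at most `κ` beyond
  -- position `τ`.
  obtain ⟨τ, N₂, hτ⟩ := hds (κ / (n + 1)) (by positivity)
  refine ⟨s + n, ℓ + τ, max (max N N₀) (max N₁ N₂), fun m hm => ?_⟩
  have hmN : N ≤ m := ((le_max_left _ _).trans (le_max_left _ _)).trans hm
  have hmN₀ : N₀ ≤ m := ((le_max_right _ _).trans (le_max_left _ _)).trans hm
  have hmN₁ : N₁ ≤ m := ((le_max_left _ _).trans (le_max_right _ _)).trans hm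
  have hmN₂ : N₂ ≤ m := ((le_max_right _ _).trans (le_max_right _ _)).trans hm
  obtain ⟨c, hc, hcθ, hc1⟩ := hn m hmN₀
  obtain ⟨f, hfm, hfs, hf1, hfB, hfL⟩ := hf (m + n) (by omega)
  set g : ℕ →₀ 𝕜 := constOn (Finset.Ico m (m + n)) (c : 𝕜) with hg
  have hgs : ∀ k ∈ g.support, m ≤ k ∧ k < m + n := fun k hk =>
    Finset.mem_Ico.mp (support_constOn_subset _ _ hk)
  have hgc : ∀ k, ‖g k‖ ≤ c := fun k => by
    have := norm_constOn_le (Finset.Ico m (m + n)) (c : 𝕜) k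
    rwa [RCLike.norm_ofReal, abs_of_pos hc] at this
  have hcle : c ≤ 1 := by nlinarith
  have hgcard : g.support.card ≤ n := by
    have := Finset.card_le_card (support_constOn_subset (Finset.Ico m (m + n)) (c : 𝕜))
    simpa using this
  have hgθ : ∀ x : ℝ, x ≤ C → ∀ k, ‖g k‖ * x ≤ θ := fun x hx k => by
    refine le_trans ?_ hcθ
    exact (mul_le_mul_of_nonneg_left hx (norm_nonneg _)).trans
      (mul_le_mul_of_nonneg_right (hgc k) hC0.le)
  refine ⟨g + f, ?_, ?_, ?_, ?_, ?_⟩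
  · intro k hk
    rcases Finset.mem_union.mp (Finsupp.support_add hk) with hk | hk
    · exact (hgs k hk).1
    · have := hfm k hk; omega
  · have h1 := Finset.card_le_card (Finsupp.support_add (g₁ := g) (g₂ := f))
    have h2 := Finset.card_union_le g.support f.support
    omega
  · intro k
    rw [Finsupp.add_apply]
    by_cases hk : k ∈ f.support
    · have hgk : g k = 0 := by
        by_contra hne
        have h1 := hgs k (Finsupp.mem_support_iff.mpr hne)
        have h2 := hfm k hk
        omega
      rw [hgk, zero_add]
      exact hf1 k
    · rw [Finsupp.notMem_support_iff.mp hk, add_zero]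
      exact (hgc k).trans hcle
  · intro L hL
    rw [map_add, map_add]
    have h2K : (0 : ℝ) < (1 / 2) ^ K := by positivity
    have h2K1 : ((1 : ℝ) / 2) ^ K ≤ 1 := pow_le_one₀ (by norm_num) (by norm_num)
    refine (listSum_add_le_of_front hw hp (m := M (m + n)) (t := t) (θ := θ)
      (ε := (1 / 2) ^ K) (B := 4 - 2 * (1 / 2) ^ K)
      (fun i hi => hb.lt_of_co_linearCombination_ne_zero (fun k hk => (hgs k hk).2) hi)
      (fun i hi => hb.le_of_co_linearCombination_ne_zero hfm hi)
      (fun i => hb.norm_co_linearCombination_le hE g hθ.le (fun k => hgθ _ (hbC k) k) i) htθ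
      ?_ hfB ?_ hL).trans ?_
    · intro L hL
      have := hE.listSum_le (Finsupp.linearCombination 𝕜 b g) L hL
      rwa [hc1, Real.one_rpow] at this
    · intro L hL
      refine hb.listSum_linearCombination_le hp hw f hf1 hfs (fun k hk => ?_) zero_le_one
      have := hfm k hk
      exact ht k (by omega) L hL
    -- Adding `(1 / 2) ^ K` to `4 - 2 * (1 / 2) ^ K` gives exactly the bound for `K + 1`, which is
    -- also at least `2`.
    · rw [pow_succ]
      refine max_le ?_ ?_ <;> linarith
  · rw [map_add, map_add]
    have hκK : κ * ((K + 1 : ℕ) : ℝ) = κ * K + κ := by push_cast; ring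
    rw [hκK]
    refine exists_listSum_add_ge hw hp (m := M' (m + n)) (θ := θ)
      (fun i hi => hd.lt_of_co_linearCombination_ne_zero (fun k hk => (hgs k hk).2) hi)
      (fun i hi => hd.le_of_co_linearCombination_ne_zero hfm hi)
      (fun i => hd.norm_co_linearCombination_le hF g hθ.le (fun k => hgθ _ (hdC k) k) i) hℓθ
      ?_ ?_ hfL
    · have h1 := hbd g c hgc
      rw [hc1] at h1
      -- The error `C * c` is at most `θ ≤ 1 / 2`, so `C` times the norm of the image is at least `1
      -- / 2`.
      have h2 : 1 / (4 * C) < ‖Finsupp.linearCombination 𝕜 d g‖ := by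
        rw [div_lt_iff₀ (by positivity)]
        nlinarith
      obtain ⟨L, hL, hL2⟩ := hF.exists_lt_listSum _ (by positivity) h2
      exact ⟨L, hL, hκC ▸ hL2.le⟩
    · intro L hL
      refine hd.listSum_linearCombination_le hp hw g (fun k => (hgc k).trans hcle) hgcard
        (fun k hk => ?_) hκ.le
      have := hgs k hk
      exact hτ k (by omega) L hL

/-- Block sequences with eventually small shifts, bounded below, are not equivalent. -/
theorem not_equivalent_of_eventuallySmallShifts (hE : IsListNormed (· < ·) w p co)
    (hF : IsListNormed (· ≠ ·) w p co') (hb : IsBlockSequence co b M)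
    (hd : IsBlockSequence co' d M') {C : ℝ} (hC : 1 ≤ C) (hbC : ∀ k, ‖b k‖ ≤ C)
    (hdC : ∀ k, ‖d k‖ ≤ C) {c : ℝ} (hc : 0 < c) (hcb : ∀ k, c ≤ ‖b k‖)
    (hbs : EventuallySmallShifts (· < ·) w p co b) (hds : EventuallySmallShifts (· ≠ ·) w p co' d)
    (hbd : ∀ (f : ℕ →₀ 𝕜) (η : ℝ), (∀ k, ‖f k‖ ≤ η) →
      ‖Finsupp.linearCombination 𝕜 b f‖ ≤ C * ‖Finsupp.linearCombination 𝕜 d f‖ + C * η)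
    (hdb : ∀ (f : ℕ →₀ 𝕜) (η : ℝ), (∀ k, ‖f k‖ ≤ η) →
      ‖Finsupp.linearCombination 𝕜 d f‖ ≤ C * ‖Finsupp.linearCombination 𝕜 b f‖ + C * η) :
    False := by
  have hp0 := hE.pos
  have hC0 : 0 < C := by linarith
  obtain ⟨δ, hδ, N₀, hbδ⟩ := hbs.exists_le_norm_co hE hc hcb
  set κ : ℝ := (1 / (4 * C)) ^ p / 3 with hκ
  have hκ0 : 0 < κ := by positivity
  have key : ∀ K, HasStackedCombinations w p co co' b d κ K := by
    intro K
    induction K with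
    | zero =>
      refine ⟨0, 0, 0, fun m _ => ⟨0, by simp, by simp, by simp, fun L _ => ?_, [], by simp⟩⟩
      rw [map_zero, map_zero, listSum_eq_zero (a := (0 : ℕ → 𝕜)) hE.one_le fun _ _ => rfl]
      norm_num
    | succ K ih =>
      exact ih.succ hE hF hb hd hC hbC hdC hδ hbδ hbs hds hbd hκ0 (by rw [hκ]; ring)
  obtain ⟨K, hK⟩ := exists_nat_gt ((5 * C) ^ p / κ)
  obtain ⟨s, ℓ, N, hf⟩ := key K
  obtain ⟨f, -, -, hf1, hfB, L, hL, -, hLK⟩ := hf N le_rfl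
  have h1 : ‖Finsupp.linearCombination 𝕜 b f‖ ≤ 4 := by
    refine hE.norm_le _ _ (by norm_num) fun L hL => (hfB L hL).trans ?_
    have : (0 : ℝ) < (1 / 2) ^ K := by positivity
    have h4 : (4 : ℝ) ≤ 4 ^ p := by
      conv_lhs => rw [← Real.rpow_one 4]
      exact Real.rpow_le_rpow_of_exponent_le (by norm_num) hE.one_le
    linarith
  -- Norm at most `4` on the side of `b` and error at most `C`, uniformly in `K`; `K` was taken so
  -- large that `κ * K` exceeds `(5 * C) ^ p`.
  have h2 : ‖Finsupp.linearCombination 𝕜 d f‖ ≤ 5 * C := by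
    have := hdb f 1 hf1
    nlinarith
  have h3 := (hLK.trans (hF.listSum_le _ L hL)).trans
    (Real.rpow_le_rpow (norm_nonneg _) h2 hp0.le)
  rw [div_lt_iff₀ hκ0] at hK
  linarith

end Comparison

/-! ### Block subsequences -/

section Blocks

variable {𝕜 : Type*} [RCLike 𝕜] {r : ℕ → ℕ → Prop} {w : ℕ → ℝ} {p : ℝ} {E : Type*}
    [NormedAddCommGroup E] [NormedSpace 𝕜 E] {co : E →ₗ[𝕜] (ℕ → 𝕜)}

namespace IsListNormed

theorem norm_le_of_finite_support (h : IsListNormed r w p co) {a : E} {m : ℕ} {δ ε : ℝ}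
    (hε : 0 ≤ ε) (hm : ∀ i, co a i ≠ 0 → i < m) (hδ : ∀ i, ‖co a i‖ ≤ δ) (hmδ : m * δ ^ p ≤ ε ^ p) :
    ‖a‖ ≤ ε := by
  have hδ0 : 0 ≤ δ := (norm_nonneg _).trans (hδ 0)
  refine h.norm_le a ε hε fun L hL => ?_
  have h1 : listSum w p (co a) 0 L ≤ listSum w p (co a) 0 (L.filter (· < m)) :=
    listSum_le_filter h.weight h.one_le _ fun i _ hi => by
      by_contra hne
      exact hi (hm i hne)
  refine h1.trans ((listSum_le_length h.weight h.one_le fun i _ => hδ i).trans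
    (le_trans ?_ hmδ))
  have hnd : (L.filter (· < m)).Nodup := (hL.filter _).imp fun {i j} => h.ne_of i j
  have hlen : (L.filter (· < m)).length ≤ m := by
    rw [← List.toFinset_card_of_nodup hnd]
    conv_rhs => rw [← Finset.card_range m]
    refine Finset.card_le_card fun i hi => ?_
    simpa using (List.mem_filter.mp (List.mem_toFinset.mp hi)).2
  have : ((L.filter (· < m)).length : ℝ) ≤ m := by exact_mod_cast hlen
  gcongr

/-- Gliding hump: for large `n` the coordinates of `u n` below `m` are negligible, and its tail
beyond some `m'` is small in norm; `b` is the part in between. -/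
theorem exists_block_approximation (h : IsListNormed r w p co) {u : ℕ → E}
    (hu : ∀ i, Tendsto (fun n => co (u n) i) atTop (𝓝 0)) {ε : ℝ} (hε : 0 < ε) (N m : ℕ) :
    ∃ n m' : ℕ, ∃ b : E, N ≤ n ∧ m ≤ m' ∧ (∀ i, co b i ≠ 0 → m ≤ i ∧ i < m') ∧
      ‖u n - b‖ ≤ ε ∧ ‖b‖ ≤ ‖u n‖ := by
  have hp0 := h.pos
  obtain ⟨θ, hθ, -, hθm⟩ := exists_pos_mul_rpow_le h.one_le m (ε := (ε / 2) ^ p) (by positivity)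
  have hev : ∀ᶠ n in atTop, ∀ i < m, ‖co (u n) i‖ ≤ θ := by
    have : ∀ i ∈ Finset.range m, ∀ᶠ n in atTop, ‖co (u n) i‖ ≤ θ := fun i _ => by
      filter_upwards [(Metric.tendsto_nhds.mp (hu i)) θ hθ] with n hn
      rw [dist_zero_right] at hn
      exact hn.le
    filter_upwards [(Finset.eventually_all _).mpr this] with n hn i hi
    exact hn i (Finset.mem_range.mpr hi)
  obtain ⟨n, hn, hnN⟩ := (hev.and (eventually_ge_atTop N)).exists
  obtain ⟨m', hm'⟩ := h.exists_norm_tail_le (u n) (half_pos hε)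
  obtain ⟨b, hb⟩ := h.exists_restrict {i | m ≤ i ∧ i < max m m'} (u n)
  obtain ⟨a, ha⟩ := h.exists_restrict {i | i < m} (u n)
  obtain ⟨c, hc⟩ := h.exists_restrict {i | max m m' ≤ i} (u n)
  refine ⟨n, max m m', b, hnN, le_max_left _ _, fun i hi => ?_, ?_, ?_⟩
  · rw [hb] at hi
    have hmem : i ∈ {i | m ≤ i ∧ i < max m m'} := Set.mem_of_indicator_ne_zero hi
    exact hmem
  · have hsplit : u n - b = a + c := by
      refine h.injective (funext fun i => ?_)
      rw [map_sub, map_add, ha, hb, hc, Pi.sub_apply, Pi.add_apply]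
      simp only [Set.indicator_apply, Set.mem_ofPred_eq]
      rcases lt_or_ge i m with h1 | h1
      · have h2 : ¬ m ≤ i := by omega
        have h3 : ¬ max m m' ≤ i := fun h => h2 ((le_max_left _ _).trans h)
        rw [if_neg (fun h => h2 h.1), if_pos h1, if_neg h3]
        simp
      · have h2 : ¬ i < m := by omega
        rw [if_neg h2]
        rcases lt_or_ge i (max m m') with h3 | h3
        · rw [if_pos ⟨h1, h3⟩, if_neg (by omega)]
          simp
        · rw [if_neg (fun h => absurd h.2 (by omega)), if_pos h3]
          simp
    have h1 : ‖a‖ ≤ ε / 2 := by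
      refine h.norm_le_of_finite_support (m := m) (δ := θ) (by positivity) ?_ ?_ hθm
      · intro i hi
        rw [ha] at hi
        have hmem : i ∈ {i | i < m} := Set.mem_of_indicator_ne_zero hi
        exact hmem
      · intro i
        rw [ha, Set.indicator_apply]
        split_ifs with hi
        · exact hn i hi
        · simpa using hθ.le
    have h2 : ‖c‖ ≤ ε / 2 := by
      refine hm' c ?_ ?_
      · intro i hi
        rw [hc] at hi
        exact (le_max_right _ _).trans (Set.mem_of_indicator_ne_zero hi)
      · intro i
        rw [hc]
        exact norm_indicator_le_norm_self _ _
    rw [hsplit]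
    linarith [norm_add_le a c]
  · refine h.norm_le_of_norm_co_le fun i => ?_
    rw [hb]
    exact norm_indicator_le_norm_self _ _

/-- A coordinatewise null sequence has a subsequence that is a small perturbation of a block
sequence. -/
theorem exists_block_subsequence (h : IsListNormed r w p co) {u : ℕ → E}
    (hu : ∀ i, Tendsto (fun n => co (u n) i) atTop (𝓝 0)) {η : ℝ} (hη : 0 < η) :
    ∃ (φ : ℕ → ℕ) (b : ℕ → E) (M : ℕ → ℕ), StrictMono φ ∧ IsBlockSequence co b M ∧
      ∀ k, ‖u (φ k) - b k‖ ≤ η * (1 / 2) ^ k ∧ ‖b k‖ ≤ ‖u (φ k)‖ := by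
  have step := fun (k N m : ℕ) =>
    h.exists_block_approximation hu (ε := η * (1 / 2) ^ k) (by positivity) N m
  choose n m' b h1 h2 h3 h4 h5 using step
  -- The state consists of a lower bound for the next index and the left end of the next block.
  let S : ℕ → ℕ × ℕ := fun k =>
    Nat.rec (0, 0) (fun k s => (n k s.1 s.2 + 1, m' k s.1 s.2)) k
  have hS : ∀ k, S (k + 1) = (n k (S k).1 (S k).2 + 1, m' k (S k).1 (S k).2) := fun k => rfl
  refine ⟨fun k => n k (S k).1 (S k).2, fun k => b k (S k).1 (S k).2, fun k => (S k).2,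
    strictMono_nat_of_lt_succ fun k => ?_, ⟨monotone_nat_of_le_succ fun k => ?_, fun k i hi => ?_⟩,
    fun k => ⟨h4 _ _ _, h5 _ _ _⟩⟩
  · have := h1 (k + 1) (S (k + 1)).1 (S (k + 1)).2
    rw [hS] at this ⊢
    exact Nat.lt_of_succ_le this
  · rw [hS]
    exact h2 _ _ _
  · rw [hS]
    exact h3 _ _ _ i hi

end IsListNormed

/-- The `ℓ_p` norm of a finitely supported family. -/
noncomputable def finNorm (p : ℝ) (f : ℕ →₀ 𝕜) : ℝ := (f.sum fun _ c => ‖c‖ ^ p) ^ (1 / p)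

theorem finNorm_nonneg (p : ℝ) (f : ℕ →₀ 𝕜) : 0 ≤ finNorm p f :=
  Real.rpow_nonneg (Finset.sum_nonneg fun _ _ => by positivity) _

theorem finNorm_rpow (hp : 1 ≤ p) (f : ℕ →₀ 𝕜) : finNorm p f ^ p = f.sum fun _ c => ‖c‖ ^ p := by
  have hS : 0 ≤ f.sum fun _ c => ‖c‖ ^ p := Finset.sum_nonneg fun _ _ => by positivity
  rw [finNorm, ← Real.rpow_mul hS, one_div, inv_mul_cancel₀ (by linarith), Real.rpow_one]

theorem norm_apply_le_finNorm (hp : 1 ≤ p) (f : ℕ →₀ 𝕜) (k : ℕ) : ‖f k‖ ≤ finNorm p f := by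
  rw [← Real.rpow_le_rpow_iff (norm_nonneg _) (finNorm_nonneg p f) (by linarith), finNorm_rpow hp]
  by_cases hk : k ∈ f.support
  · exact Finset.single_le_sum (f := fun k => ‖f k‖ ^ p) (fun _ _ => by positivity) hk
  · rw [Finsupp.notMem_support_iff.mp hk, norm_zero, Real.zero_rpow (by linarith)]
    exact Finset.sum_nonneg fun _ _ => by positivity

/-- The errors are geometrically summable, so the supremum of the coefficients alone controls the
total error. -/
theorem norm_linearCombination_sub_le {x b : ℕ → E} {η θ : ℝ} (hη : 0 ≤ η)
    (hxb : ∀ k, ‖x k - b k‖ ≤ η * (1 / 2) ^ k) (f : ℕ →₀ 𝕜) (hf : ∀ k, ‖f k‖ ≤ θ) :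
    ‖Finsupp.linearCombination 𝕜 x f - Finsupp.linearCombination 𝕜 b f‖ ≤ 2 * η * θ := by
  have hθ : 0 ≤ θ := (norm_nonneg _).trans (hf 0)
  rw [Finsupp.linearCombination_apply, Finsupp.linearCombination_apply, Finsupp.sum, Finsupp.sum,
    ← Finset.sum_sub_distrib]
  refine (norm_sum_le _ _).trans ?_
  have h1 : ∀ k ∈ f.support, ‖f k • x k - f k • b k‖ ≤ η * θ * (1 / 2) ^ k := fun k _ => by
    rw [← smul_sub, norm_smul]
    calc ‖f k‖ * ‖x k - b k‖ ≤ θ * (η * (1 / 2) ^ k) := by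
          gcongr
          · exact hf k
          · exact hxb k
      _ = _ := by ring
  refine (Finset.sum_le_sum h1).trans ?_
  rw [← Finset.mul_sum]
  have h2 : ∑ k ∈ f.support, (1 / 2 : ℝ) ^ k ≤ 2 := by
    refine le_of_le_of_eq ?_ tsum_geometric_two
    exact summable_geometric_two.sum_le_tsum _ fun _ _ => by positivity
  calc η * θ * ∑ k ∈ f.support, (1 / 2 : ℝ) ^ k ≤ η * θ * 2 := by gcongr
    _ = _ := by ring

/-- A block sequence whose shifted list sums are not eventually small has a subsequence with a
lower `p`-estimate. -/
theorem IsBlockSequence.exists_lower_estimate {b : ℕ → E} {M : ℕ → ℕ}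
    (hb : IsBlockSequence co b M) (h : IsListNormed r w p co)
    (hs : ¬ EventuallySmallShifts r w p co b) :
    ∃ c > 0, ∀ N, ∃ φ : ℕ → ℕ, StrictMono φ ∧ (∀ k, N + k ≤ φ k) ∧
      ∀ f : ℕ →₀ 𝕜, c * finNorm p f ≤ ‖Finsupp.linearCombination 𝕜 (fun k => b (φ k)) f‖ := by
  have hp0 := h.pos
  unfold EventuallySmallShifts at hs
  push Not at hs
  obtain ⟨ε, hε, hbε⟩ := hs
  refine ⟨ε ^ (1 / p), by positivity, fun N₀ => ?_⟩
  -- Removing the zeros from the list confines it to the support of its block.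
  have step : ∀ T N : ℕ, ∃ n, ∃ L : List ℕ, N ≤ n ∧ L.Pairwise r ∧ (∀ i ∈ L, co (b n) i ≠ 0) ∧
      ε ≤ listSum w p (co (b n)) T L := by
    intro T N
    obtain ⟨n, hn, L, hL, hLε⟩ := hbε T N
    classical
    refine ⟨n, L.filter (fun i => co (b n) i ≠ 0), hn, hL.filter _, fun i hi => by
      simpa using (List.mem_filter.mp hi).2, hLε.le.trans ?_⟩
    exact listSum_le_filter h.weight h.one_le _ fun i _ hi => not_not.mp hi
  choose n Ls h1 h2 h3 h4 using step
  -- The state consists of the number of positions already used and a lower bound for the next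
  -- index; the next list is chosen for exactly that shift.
  let S : ℕ → ℕ × ℕ := fun k =>
    Nat.rec (0, N₀) (fun _ s => (s.1 + (Ls s.1 s.2).length, n s.1 s.2 + 1)) k
  have hS : ∀ k, S (k + 1) = ((S k).1 + (Ls (S k).1 (S k).2).length, n (S k).1 (S k).2 + 1) :=
    fun k => rfl
  set φ : ℕ → ℕ := fun k => n (S k).1 (S k).2 with hφ
  have hφmono : StrictMono φ := strictMono_nat_of_lt_succ fun k => by
    have := h1 (S (k + 1)).1 (S (k + 1)).2
    rw [hφ]
    simp only
    rw [hS] at this ⊢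
    exact Nat.lt_of_succ_le this
  refine ⟨φ, hφmono, fun k => ?_, fun f => ?_⟩
  · induction k with
    | zero => exact h1 0 N₀
    | succ k ih => have := hφmono (Nat.lt_succ_self k); simp only [Nat.succ_eq_add_one] at this; omega
  have hbφ := hb.comp hφmono
  set v := co (Finsupp.linearCombination 𝕜 (fun k => b (φ k)) f) with hv
  have key : ∀ K : ℕ, ∃ L : List ℕ, L.Pairwise r ∧ L.length = (S K).1 ∧
      (∀ i ∈ L, i < M (φ K)) ∧ ε * ∑ k ∈ Finset.range K, ‖f k‖ ^ p ≤ listSum w p v 0 L := by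
    intro K
    induction K with
    | zero => exact ⟨[], by simp [S]⟩
    | succ K ih =>
      obtain ⟨L, hL, hlen, hlt, hsum⟩ := ih
      set L' := Ls (S K).1 (S K).2 with hL'
      have hL'2 : ∀ i ∈ L', co (b (φ K)) i ≠ 0 := h3 _ _
      refine ⟨L ++ L', h.pairwise_append (B := M (φ K)) hL (h2 _ _) hlt ?_, ?_, ?_, ?_⟩
      · exact fun i hi => (hbφ.supp K i (hL'2 i hi)).1
      · rw [List.length_append, hlen, hS]
      · intro i hi
        rcases List.mem_append.mp hi with hi | hi
        · exact (hlt i hi).trans_le (hbφ.mono (Nat.le_succ K))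
        · exact (hbφ.supp K i (hL'2 i hi)).2
      · rw [listSum_append, zero_add, hlen, Finset.sum_range_succ, mul_add]
        refine add_le_add hsum ?_
        have h5 : listSum w p v (S K).1 L' = ‖f K‖ ^ p * listSum w p (co (b (φ K))) (S K).1 L' := by
          rw [← listSum_smul]
          refine listSum_congr fun i hi => ?_
          rw [hv, hbφ.co_linearCombination_apply f (hL'2 i hi)]
          rfl
        rw [h5, mul_comm]
        exact mul_le_mul_of_nonneg_left (h4 _ _) (by positivity)
  obtain ⟨K, hK⟩ := f.support.exists_nat_subset_range
  obtain ⟨L, hL, -, -, hsum⟩ := key K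
  rw [← Real.rpow_le_rpow_iff (mul_nonneg (by positivity) (finNorm_nonneg p f)) (norm_nonneg _) hp0,
    Real.mul_rpow (by positivity) (finNorm_nonneg p f), finNorm_rpow h.one_le,
    ← Real.rpow_mul hε.le, one_div, inv_mul_cancel₀ hp0.ne', Real.rpow_one]
  refine le_trans ?_ (hsum.trans (h.listSum_le _ L hL))
  refine mul_le_mul_of_nonneg_left ?_ hε.le
  exact Finset.sum_le_sum_of_subset_of_nonneg hK fun _ _ _ => by positivity

end Blocks

/-! ### Domination of sequences through norm estimates -/

section NormDominates

/-- `‖∑ f_n z_n‖ ≤ C ‖∑ f_n y_n‖` for all finitely supported families `f` of scalars. -/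
def NormDominates (𝕜 : Type*) [RCLike 𝕜] {E F : Type*} [NormedAddCommGroup E] [NormedSpace 𝕜 E]
    [NormedAddCommGroup F] [NormedSpace 𝕜 F] (y : ℕ → E) (z : ℕ → F) : Prop :=
  ∃ C > 0, ∀ f : ℕ →₀ 𝕜,
    ‖Finsupp.linearCombination 𝕜 z f‖ ≤ C * ‖Finsupp.linearCombination 𝕜 y f‖

/-- Cauchy sequences of finite combinations of `y`, eventually supported beyond any given index,
tend to zero. -/
def HasNullTails (𝕜 : Type*) [RCLike 𝕜] {X : Type*} [AddCommGroup X] [Module 𝕜 X]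
    [UniformSpace X] (y : ℕ → X) : Prop :=
  ∀ f : ℕ → ℕ →₀ 𝕜, (∀ n, ∀ k ∈ (f n).support, n ≤ k) →
    CauchySeq (fun n => Finsupp.linearCombination 𝕜 y (f n)) →
    Tendsto (fun n => Finsupp.linearCombination 𝕜 y (f n)) atTop (𝓝 0)

variable {𝕜 : Type*} [RCLike 𝕜] {E F G : Type*} [NormedAddCommGroup E] [NormedSpace 𝕜 E]
    [NormedAddCommGroup F] [NormedSpace 𝕜 F] [NormedAddCommGroup G] [NormedSpace 𝕜 G]
    {x : ℕ → E} {y : ℕ → F} {z : ℕ → G}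

namespace NormDominates

theorem trans (h1 : NormDominates 𝕜 x y) (h2 : NormDominates 𝕜 y z) : NormDominates 𝕜 x z := by
  obtain ⟨C, hC, h1⟩ := h1
  obtain ⟨D, hD, h2⟩ := h2
  refine ⟨D * C, by positivity, fun f => (h2 f).trans ?_⟩
  rw [mul_assoc]
  exact mul_le_mul_of_nonneg_left (h1 f) hD.le

theorem comp (h : NormDominates 𝕜 x y) (φ : ℕ → ℕ) :
    NormDominates 𝕜 (fun n => x (φ n)) (fun n => y (φ n)) := by
  obtain ⟨C, hC, h⟩ := h
  refine ⟨C, hC, fun f => ?_⟩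
  have := h (f.mapDomain φ)
  rwa [Finsupp.linearCombination_mapDomain, Finsupp.linearCombination_mapDomain] at this

theorem sub (h : NormDominates 𝕜 x y) (φ ψ : ℕ → ℕ) :
    NormDominates 𝕜 (fun n => x (φ n) - x (ψ n)) (fun n => y (φ n) - y (ψ n)) := by
  obtain ⟨C, hC, h⟩ := h
  refine ⟨C, hC, fun f => ?_⟩
  have h1 := h (f.mapDomain φ - f.mapDomain ψ)
  simp only [map_sub, Finsupp.linearCombination_mapDomain] at h1
  simpa [Finsupp.linearCombination_apply, smul_sub, Finsupp.sum_sub] using h1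

/-- One inequality carries the Cauchy property from `y` to `x`, the other carries the limit `0`
back; no completeness is needed. -/
theorem hasNullTails (h1 : NormDominates 𝕜 x y) (h2 : NormDominates 𝕜 y x)
    (hx : HasNullTails 𝕜 x) : HasNullTails 𝕜 y := by
  intro f hf hcau
  obtain ⟨C, hC, h1⟩ := h1
  obtain ⟨D, hD, h2⟩ := h2
  have hcx : CauchySeq fun n => Finsupp.linearCombination 𝕜 x (f n) := by
    rw [Metric.cauchySeq_iff'] at hcau ⊢
    intro ε hε
    obtain ⟨N, hN⟩ := hcau (ε / D) (by positivity)
    refine ⟨N, fun n hn => ?_⟩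
    have h3 := hN n hn
    rw [dist_eq_norm, ← map_sub] at h3 ⊢
    rw [lt_div_iff₀ hD] at h3
    linarith [h2 (f n - f N)]
  have := (hx f hf hcx).norm.const_mul C
  rw [norm_zero, mul_zero] at this
  exact squeeze_zero_norm (fun n => h1 (f n)) this

end NormDominates

/-- For unbounded `x` there is an increasing `φ` with `x (φ n) > n * x n`, which defeats every
constant `C`. -/
theorem bddAbove_of_subsequences {x : ℕ → ℝ} (hx : ∀ n, 0 < x n)
    (h : ∀ φ : ℕ → ℕ, StrictMono φ → ∃ C, ∀ n, x (φ n) ≤ C * x n) : BddAbove (Set.range x) := by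
  by_contra hcon
  have hfr : ∀ n : ℕ, ∃ᶠ k in atTop, n * x n < x k := by
    intro n hev
    refine hcon (Filter.IsBoundedUnder.bddAbove_range ⟨n * x n, ?_⟩)
    rw [eventually_map]
    filter_upwards [hev] with k hk
    exact not_lt.mp hk
  obtain ⟨φ, hφ, hlt⟩ := extraction_forall_of_frequently hfr
  obtain ⟨C, hC⟩ := h φ hφ
  obtain ⟨n, hn⟩ := exists_nat_gt C
  have := (hlt n).trans_le (hC n)
  have := lt_of_mul_lt_mul_right this (hx n).le
  linarith

/-- `bddAbove_of_subsequences` is applied to the norms and to their inverses. -/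
theorem exists_norm_bounds (hne : ∀ n, x n ≠ 0)
    (h1 : ∀ φ : ℕ → ℕ, StrictMono φ → NormDominates 𝕜 x fun n => x (φ n))
    (h2 : ∀ φ : ℕ → ℕ, StrictMono φ → NormDominates 𝕜 (fun n => x (φ n)) x) :
    ∃ c > 0, ∃ C > 0, ∀ n, c ≤ ‖x n‖ ∧ ‖x n‖ ≤ C := by
  obtain ⟨C, hC⟩ := bddAbove_of_subsequences (x := fun n => ‖x n‖)
    (fun n => norm_pos_iff.mpr (hne n)) fun φ hφ => by
      obtain ⟨C, -, hC⟩ := h1 φ hφ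
      refine ⟨C, fun n => ?_⟩
      simpa using hC (Finsupp.single n 1)
  obtain ⟨D, hD⟩ := bddAbove_of_subsequences (x := fun n => ‖x n‖⁻¹)
    (fun n => inv_pos.mpr (norm_pos_iff.mpr (hne n))) fun φ hφ => by
      obtain ⟨C, hC0, hC⟩ := h2 φ hφ
      refine ⟨C, fun n => ?_⟩
      have h3 : ‖x n‖ ≤ C * ‖x (φ n)‖ := by simpa using hC (Finsupp.single n 1)
      have h4 := norm_pos_iff.mpr (hne n)
      have h5 := norm_pos_iff.mpr (hne (φ n))
      rw [← div_eq_mul_inv, inv_eq_one_div, div_le_div_iff₀ h5 h4]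
      linarith
  have hC' : ∀ n, ‖x n‖ ≤ C := fun n => hC ⟨n, rfl⟩
  have hD' : ∀ n, ‖x n‖⁻¹ ≤ D := fun n => hD ⟨n, rfl⟩
  have h0 := norm_pos_iff.mpr (hne 0)
  have hD0 : 0 < D := (inv_pos.mpr h0).trans_le (hD' 0)
  refine ⟨D⁻¹, by positivity, C, h0.trans_le (hC' 0), fun n => ⟨?_, hC' n⟩⟩
  exact inv_le_of_inv_le₀ (norm_pos_iff.mpr (hne n)) (hD' n)

end NormDominates

/-! ### Coordinatewise convergence and estimates by the `ℓ_p` norm -/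

section Estimates

variable {𝕜 : Type*} [RCLike 𝕜] {r : ℕ → ℕ → Prop} {w : ℕ → ℝ} {p : ℝ} {E : Type*}
    [NormedAddCommGroup E] [NormedSpace 𝕜 E] {co : E →ₗ[𝕜] (ℕ → 𝕜)}

/-- Compactness of a product of balls gives a coordinatewise limit. List sums are finite, hence
continuous for this convergence, so the limit keeps the bound and belongs to the space. -/
theorem IsListNormed.exists_tendsto_co (h : IsListNormed r w p co) {y : ℕ → E} {C : ℝ}
    (hC : ∀ n, ‖y n‖ ≤ C) : ∃ φ : ℕ → ℕ, StrictMono φ ∧ ∃ v : E,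
      ∀ i, Tendsto (fun n => co (y (φ n)) i) atTop (𝓝 (co v i)) := by
  have hcomp : IsCompact (Set.pi Set.univ fun _ : ℕ => Metric.closedBall (0 : 𝕜) C) :=
    isCompact_univ_pi fun _ => isCompact_closedBall 0 C
  obtain ⟨v, -, φ, hφ, hlim⟩ := hcomp.tendsto_subseq (x := fun n => co (y n)) fun n i _ => by
    rw [mem_closedBall_zero_iff]
    exact (h.norm_co_le _ _).trans (hC n)
  rw [tendsto_pi_nhds] at hlim
  have hls : ∀ (t : ℕ) (L : List ℕ),
      Tendsto (fun n => listSum w p (co (y (φ n))) t L) atTop (𝓝 (listSum w p v t L)) := by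
    intro t L
    induction L generalizing t with
    | nil => simp
    | cons i L ih =>
      simp only [listSum_cons]
      exact (((hlim i).norm.rpow_const (Or.inr h.pos.le)).mul_const _).add (ih _)
  obtain ⟨v', rfl⟩ := h.exists_co v (C ^ p) fun L hL =>
    le_of_tendsto' (hls 0 L) fun n => (h.listSum_le _ L hL).trans
      (Real.rpow_le_rpow (norm_nonneg _) (hC _) h.pos.le)
  exact ⟨φ, hφ, v', hlim⟩

/-- A lower `p`-estimate passes from perturbed blocks to a sequence whose differences they
approximate. -/
theorem exists_lower_estimate_of_differences (h : IsListNormed r w p co) {y b : ℕ → E} {M : ℕ → ℕ}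
    (hsub : ∀ φ : ℕ → ℕ, StrictMono φ → NormDominates 𝕜 y fun n => y (φ n)) {α β : ℕ → ℕ}
    (hα : StrictMono α) (hβ : StrictMono β) (hb : IsBlockSequence co b M) {η : ℝ} (hη : 0 < η)
    (hyb : ∀ k, ‖y (α k) - y (β k) - b k‖ ≤ η * (1 / 2) ^ k)
    (hs : ¬ EventuallySmallShifts r w p co b) :
    ∃ C > 0, ∀ f : ℕ →₀ 𝕜, finNorm p f ≤ C * ‖Finsupp.linearCombination 𝕜 y f‖ := by
  obtain ⟨c, hc, hlow⟩ := hb.exists_lower_estimate h hs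
  -- Starting beyond `N` brings the total error below `c / 2` times the `ℓ_p` norm, half of the
  -- lower estimate for the blocks.
  obtain ⟨N, hN⟩ := exists_pow_lt_of_lt_one (show 0 < c / (4 * η) by positivity)
    (show (1 / 2 : ℝ) < 1 by norm_num)
  obtain ⟨φ, hφ, hφN, hφc⟩ := hlow N
  obtain ⟨A, hA, hyA⟩ := hsub _ (hα.comp hφ)
  obtain ⟨B, hB, hyB⟩ := hsub _ (hβ.comp hφ)
  refine ⟨2 / c * (A + B), by positivity, fun f => ?_⟩
  have h1 := norm_linearCombination_sub_le (η := η * (1 / 2) ^ N)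
    (x := fun k => y (α (φ k)) - y (β (φ k))) (b := fun k => b (φ k)) (by positivity)
    (fun k => (hyb (φ k)).trans ?_) f (norm_apply_le_finNorm h.one_le f)
  · have h2 : 2 * (η * (1 / 2) ^ N) * finNorm p f ≤ c / 2 * finNorm p f := by
      refine mul_le_mul_of_nonneg_right ?_ (finNorm_nonneg p f)
      rw [lt_div_iff₀ (by positivity)] at hN
      linarith
    have h3 : Finsupp.linearCombination 𝕜 (fun k => y (α (φ k)) - y (β (φ k))) f =
        Finsupp.linearCombination 𝕜 (fun k => y (α (φ k))) f -
          Finsupp.linearCombination 𝕜 (fun k => y (β (φ k))) f := by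
      simp [Finsupp.linearCombination_apply, smul_sub, Finsupp.sum_sub]
    have h4 := norm_sub_le (Finsupp.linearCombination 𝕜 (fun k => y (α (φ k))) f)
      (Finsupp.linearCombination 𝕜 (fun k => y (β (φ k))) f)
    rw [← h3] at h4
    have h5 := norm_sub_norm_le (Finsupp.linearCombination 𝕜 (fun k => b (φ k)) f)
      (Finsupp.linearCombination 𝕜 (fun k => y (α (φ k)) - y (β (φ k))) f)
    rw [norm_sub_rev] at h5
    have h6 := hφc f
    have h7 : ‖Finsupp.linearCombination 𝕜 (fun k => y (α (φ k))) f‖ ≤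
      A * ‖Finsupp.linearCombination 𝕜 y f‖ := hyA f
    have h8 : ‖Finsupp.linearCombination 𝕜 (fun k => y (β (φ k))) f‖ ≤
      B * ‖Finsupp.linearCombination 𝕜 y f‖ := hyB f
    have h9 : c / 2 * finNorm p f ≤ (A + B) * ‖Finsupp.linearCombination 𝕜 y f‖ := by linarith
    calc finNorm p f = 2 / c * (c / 2 * finNorm p f) := by field_simp
      _ ≤ 2 / c * ((A + B) * ‖Finsupp.linearCombination 𝕜 y f‖) := by gcongr
      _ = _ := by ring
  · rw [mul_assoc, ← pow_add]
    refine mul_le_mul_of_nonneg_left ?_ hη.le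
    exact pow_le_pow_of_le_one (by norm_num) (by norm_num) (hφN k)

theorem finNorm_constOn_le (hp : 1 ≤ p) (A : Finset ℕ) (c : 𝕜) :
    finNorm p (constOn A c) ≤ ‖c‖ * (A.card : ℝ) ^ (1 / p) := by
  have hp0 : 0 < p := by linarith
  rw [← Real.rpow_le_rpow_iff (finNorm_nonneg _ _) (by positivity) hp0, finNorm_rpow hp,
    Real.mul_rpow (norm_nonneg _) (by positivity), ← Real.rpow_mul (by positivity), one_div,
    inv_mul_cancel₀ hp0.ne', Real.rpow_one, mul_comm, ← nsmul_eq_mul]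
  refine (Finset.sum_le_sum_of_subset_of_nonneg (support_constOn_subset A c)
    fun _ _ _ => by positivity).trans ?_
  refine Finset.sum_le_card_nsmul _ _ _ fun k _ => ?_
  exact Real.rpow_le_rpow (norm_nonneg _) (norm_constOn_le A c k) hp0.le

/-- The differences from a coordinatewise limit `v` inherit the upper estimate of blocks; null tails
are what exclude `v ≠ 0` when `p > 1`. -/
theorem exists_upper_estimate (h : IsListNormed r w p co) {y : ℕ → E}
    (hsub : ∀ φ : ℕ → ℕ, StrictMono φ → NormDominates 𝕜 (fun n => y (φ n)) y) {C : ℝ}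
    (hC : ∀ n, ‖y n‖ ≤ C) (htail : HasNullTails 𝕜 y) :
    ∃ D > 0, ∀ f : ℕ →₀ 𝕜, ‖Finsupp.linearCombination 𝕜 y f‖ ≤ D * finNorm p f := by
  have hp0 := h.pos
  have hC0 : 0 ≤ C := (norm_nonneg _).trans (hC 0)
  rcases eq_or_lt_of_le h.one_le with hp1 | hp1
  · refine ⟨C + 1, by positivity, fun f => ?_⟩
    rw [Finsupp.linearCombination_apply]
    refine (norm_sum_le _ _).trans ?_
    rw [finNorm, ← hp1, div_one, Real.rpow_one, Finsupp.sum, Finset.mul_sum]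
    refine Finset.sum_le_sum fun k _ => ?_
    rw [norm_smul, Real.rpow_one, mul_comm]
    exact mul_le_mul_of_nonneg_right ((hC k).trans (by linarith)) (norm_nonneg _)
  obtain ⟨φ, hφ, v, hv⟩ := h.exists_tendsto_co hC
  obtain ⟨ψ, b, M, hψ, hb, hub⟩ := h.exists_block_subsequence (u := fun n => y (φ n) - v)
    (fun i => by
      have := (hv i).sub_const (co v i)
      rw [sub_self] at this
      simpa using this) one_pos
  set B := C + ‖v‖ with hB
  have hB0 : 0 ≤ B := by positivity
  have hbB : ∀ k, ‖b k‖ ≤ B := fun k => (hub k).2.trans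
    ((norm_sub_le _ _).trans (add_le_add (hC _) le_rfl))
  have hu : ∀ f : ℕ →₀ 𝕜,
      ‖Finsupp.linearCombination 𝕜 (fun k => y (φ (ψ k)) - v) f‖ ≤ (B + 2) * finNorm p f := by
    intro f
    have h1 := norm_linearCombination_sub_le zero_le_one (fun k => (hub k).1) f
      (norm_apply_le_finNorm h.one_le f)
    have h2 := hb.norm_linearCombination_rpow_le h f hB0 hbB
    have h3 := norm_sub_norm_le (Finsupp.linearCombination 𝕜 (fun k => y (φ (ψ k)) - v) f)
      (Finsupp.linearCombination 𝕜 b f)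
    rw [← finNorm] at h2
    linarith
  have hv0 : v = 0 := by
    -- Averages over `n + 1` indices beyond `n`: they reproduce `v` exactly, and the remainder is of
    -- order `(n + 1) ^ (1 / p - 1)`, which tends to `0` as `p > 1`.
    let f : ℕ → ℕ →₀ 𝕜 := fun n => constOn (Finset.Ico (n + 1) (2 * (n + 1)))
      ((((n + 1 : ℕ) : ℝ)⁻¹ : ℝ) : 𝕜)
    have hlc : ∀ n, Finsupp.linearCombination 𝕜 (fun k => y (φ (ψ k))) (f n) =
        v + Finsupp.linearCombination 𝕜 (fun k => y (φ (ψ k)) - v) (f n) := by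
      intro n
      simp only [f, linearCombination_constOn, Finset.sum_sub_distrib, smul_sub]
      rw [Finset.sum_const, Nat.card_Ico, ← Nat.cast_smul_eq_nsmul 𝕜, smul_smul]
      have h1 : ((((n + 1 : ℕ) : ℝ)⁻¹ : ℝ) : 𝕜) * ((2 * (n + 1) - (n + 1) : ℕ) : 𝕜) = 1 := by
        rw [show 2 * (n + 1) - (n + 1) = n + 1 by omega, RCLike.ofReal_inv, RCLike.ofReal_natCast]
        exact inv_mul_cancel₀ (Nat.cast_ne_zero.mpr (Nat.succ_ne_zero n))
      rw [h1, one_smul]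
      abel
    have hnull : Tendsto (fun n => Finsupp.linearCombination 𝕜 (fun k => y (φ (ψ k)) - v) (f n))
        atTop (𝓝 0) := by
      have hexp : Tendsto (fun n : ℕ => (B + 2) * ((n + 1 : ℕ) : ℝ) ^ (-(1 - 1 / p))) atTop
          (𝓝 0) := by
        have h1 : 0 < 1 - 1 / p := by
          rw [sub_pos, div_lt_one hp0]
          exact hp1
        have h2 := (tendsto_rpow_neg_atTop h1).comp
          (tendsto_natCast_atTop_atTop.comp (tendsto_add_atTop_nat 1))
        have h3 := h2.const_mul (B + 2)
        rw [mul_zero] at h3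
        exact h3
      refine squeeze_zero_norm (fun n => (hu (f n)).trans ?_) hexp
      refine mul_le_mul_of_nonneg_left ((finNorm_constOn_le h.one_le _ _).trans ?_) (by positivity)
      rw [RCLike.norm_ofReal, abs_of_nonneg (by positivity), Nat.card_Ico,
        show 2 * (n + 1) - (n + 1) = n + 1 by omega, neg_sub, sub_eq_add_neg,
        Real.rpow_add (by positivity), Real.rpow_neg_one, mul_comm]
    have hlim : Tendsto (fun n => Finsupp.linearCombination 𝕜 (fun k => y (φ (ψ k))) (f n)) atTop
        (𝓝 v) := by
      simp only [hlc]
      have := hnull.const_add v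
      rwa [add_zero] at this
    have hmap : ∀ n, Finsupp.linearCombination 𝕜 (fun k => y (φ (ψ k))) (f n) =
        Finsupp.linearCombination 𝕜 y ((f n).mapDomain (φ ∘ ψ)) := fun n => by
      rw [Finsupp.linearCombination_mapDomain]
      rfl
    simp only [hmap] at hlim
    refine tendsto_nhds_unique hlim (htail _ (fun n k hk => ?_) hlim.cauchySeq)
    classical
    obtain ⟨l, hl, rfl⟩ := Finset.mem_image.mp (Finsupp.mapDomain_support hk)
    have h1 := (Finset.mem_Ico.mp (support_constOn_subset _ _ hl)).1
    have h2 := (hφ.comp hψ).le_apply (x := l)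
    omega
  obtain ⟨D, hD, hyD⟩ := hsub _ (hφ.comp hψ)
  refine ⟨D * (B + 2), by positivity, fun f => (hyD f).trans ?_⟩
  rw [mul_assoc]
  refine mul_le_mul_of_nonneg_left ?_ hD.le
  have h1 := hu f
  rw [hv0] at h1
  simpa using h1

end Estimates

/-! ### Sequences common to the two spaces -/

section Core

variable {𝕜 : Type*} [RCLike 𝕜] {w : ℕ → ℝ} {p : ℝ} {E F : Type*}
    [NormedAddCommGroup E] [NormedSpace 𝕜 E] {co : E →ₗ[𝕜] (ℕ → 𝕜)}
    [NormedAddCommGroup F] [NormedSpace 𝕜 F] {co' : F →ₗ[𝕜] (ℕ → 𝕜)}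

theorem exists_separated_subsequences {X : Type*} [PseudoMetricSpace X] {y : ℕ → X}
    (hy : ¬ CauchySeq y) : ∃ ε > 0, ∃ α β : ℕ → ℕ, StrictMono α ∧ StrictMono β ∧
      ∀ k, ε ≤ dist (y (α k)) (y (β k)) := by
  rw [Metric.cauchySeq_iff] at hy
  push Not at hy
  obtain ⟨ε, hε, hy⟩ := hy
  choose m hm n hn hmn using hy
  let S : ℕ → ℕ := fun k => Nat.rec 0 (fun _ N => m N + n N + 1) k
  have hS : ∀ k, S (k + 1) = m (S k) + n (S k) + 1 := fun k => rfl
  refine ⟨ε, hε, fun k => m (S k), fun k => n (S k), strictMono_nat_of_lt_succ fun k => ?_,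
    strictMono_nat_of_lt_succ fun k => ?_, fun k => hmn _⟩
  · have := hm (S (k + 1))
    have := hS k
    omega
  · have := hn (S (k + 1))
    have := hS k
    omega

/-- Domination survives the passage to blocks only up to a multiple of the largest coefficient; this
suffices, since the combinations used later are flat or of bounded coefficients. -/
theorem norm_linearCombination_le_of_perturbation {x b : ℕ → E} {y d : ℕ → F} {C : ℝ} (hC : 0 < C)
    (hxy : ∀ f : ℕ →₀ 𝕜,
      ‖Finsupp.linearCombination 𝕜 y f‖ ≤ C * ‖Finsupp.linearCombination 𝕜 x f‖)
    {η : ℝ} (hη : 0 < η) (hη1 : η ≤ 1) (hxb : ∀ k, ‖x k - b k‖ ≤ η * (1 / 2) ^ k)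
    (hyd : ∀ k, ‖y k - d k‖ ≤ η * (1 / 2) ^ k) (f : ℕ →₀ 𝕜) {θ : ℝ} (hf : ∀ k, ‖f k‖ ≤ θ) :
    ‖Finsupp.linearCombination 𝕜 d f‖ ≤
      C * ‖Finsupp.linearCombination 𝕜 b f‖ + (2 * C + 2) * θ := by
  have hθ : 0 ≤ θ := (norm_nonneg _).trans (hf 0)
  have h1 := norm_linearCombination_sub_le hη.le hxb f hf
  have h2 := norm_linearCombination_sub_le hη.le hyd f hf
  have h3 := norm_sub_norm_le (Finsupp.linearCombination 𝕜 x f) (Finsupp.linearCombination 𝕜 b f)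
  have h4 := norm_sub_norm_le (Finsupp.linearCombination 𝕜 d f) (Finsupp.linearCombination 𝕜 y f)
  rw [norm_sub_rev] at h4
  have h5 := hxy f
  have h6 : 2 * η * θ ≤ 2 * θ := by nlinarith
  have h7 : C * ‖Finsupp.linearCombination 𝕜 x f‖ ≤
      C * (‖Finsupp.linearCombination 𝕜 b f‖ + 2 * θ) := by
    refine mul_le_mul_of_nonneg_left ?_ hC.le
    linarith
  linarith

/-- A sequence that is equivalent to all its subsequences and has equivalent copies in both spaces
satisfies two-sided `ℓ_p` estimates. -/
theorem exists_finNorm_estimates (hE : IsListNormed (· < ·) w p co)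
    (hF : IsListNormed (· ≠ ·) w p co') {y : ℕ → E} {z : ℕ → F} (hyz : NormDominates 𝕜 y z)
    (hzy : NormDominates 𝕜 z y) (hne : ∀ n, y n ≠ 0)
    (h1 : ∀ φ : ℕ → ℕ, StrictMono φ → NormDominates 𝕜 y fun n => y (φ n))
    (h2 : ∀ φ : ℕ → ℕ, StrictMono φ → NormDominates 𝕜 (fun n => y (φ n)) y)
    (htail : HasNullTails 𝕜 y) :
    (∃ D > 0, ∀ f : ℕ →₀ 𝕜, ‖Finsupp.linearCombination 𝕜 y f‖ ≤ D * finNorm p f) ∧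
      ∃ D > 0, ∀ f : ℕ →₀ 𝕜, finNorm p f ≤ D * ‖Finsupp.linearCombination 𝕜 y f‖ := by
  obtain ⟨c, hc, C, hC, hyC⟩ := exists_norm_bounds hne h1 h2
  refine ⟨exists_upper_estimate hE h2 (fun n => (hyC n).2) htail, ?_⟩
  obtain ⟨A, hA, hA'⟩ := hyz
  obtain ⟨B, hB, hB'⟩ := hzy
  have hzC : ∀ n, ‖z n‖ ≤ A * C := fun n => by
    have h3 : ‖z n‖ ≤ A * ‖y n‖ := by simpa using hA' (Finsupp.single n 1)
    exact h3.trans (mul_le_mul_of_nonneg_left (hyC n).2 hA.le)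
  obtain ⟨φ₁, hφ₁, v, hv⟩ := hE.exists_tendsto_co fun n => (hyC n).2
  obtain ⟨φ₂, hφ₂, v', hv'⟩ := hF.exists_tendsto_co fun n => hzC (φ₁ n)
  have hφ := hφ₁.comp hφ₂
  set φ := φ₁ ∘ φ₂ with hφdef
  -- Null tails would turn a Cauchy subsequence into a norm-null one, against the lower bound `c`.
  have hncau : ¬ CauchySeq fun n => y (φ n) := by
    intro hcau
    have h3 := htail (fun n => Finsupp.single (φ n) 1) (fun n k hk => ?_) (by simpa using hcau)
    · simp only [Finsupp.linearCombination_single, one_smul] at h3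
      obtain ⟨n, hn⟩ := ((tendsto_zero_iff_norm_tendsto_zero.mp h3).eventually_lt_const hc).exists
      exact absurd (hyC (φ n)).1 (not_le.mpr hn)
    · have h4 := Finset.mem_singleton.mp (Finsupp.support_single_subset hk)
      rw [h4]
      exact hφ.le_apply
  obtain ⟨ε, hε, α, β, hα, hβ, hαβ⟩ := exists_separated_subsequences hncau
  have hnull : ∀ i, Tendsto (fun n => co (y (φ (α n)) - y (φ (β n))) i) atTop (𝓝 0) := fun i => by
    have h3 := (hv i).comp (hφ₂.tendsto_atTop)
    have h4 := (h3.comp hα.tendsto_atTop).sub (h3.comp hβ.tendsto_atTop)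
    rw [sub_self] at h4
    simpa [hφdef] using h4
  have hnull' : ∀ i, Tendsto (fun n => co' (z (φ (α n)) - z (φ (β n))) i) atTop (𝓝 0) :=
    fun i => by
      have h4 := ((hv' i).comp hα.tendsto_atTop).sub ((hv' i).comp hβ.tendsto_atTop)
      rw [sub_self] at h4
      simpa [hφdef] using h4
  -- The bound `ε / 2` keeps the blocks away from zero; the bound `1` is required by the
  -- perturbation lemma.
  set η : ℝ := min 1 (ε / 2) with hη
  have hη0 : 0 < η := lt_min one_pos (half_pos hε)
  -- Blocks are found in `E` first and then in `F` along the indices obtained; thinning the blocks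
  -- of `E` accordingly leaves a block sequence, with both spaces on common indices.
  obtain ⟨ψ₁, b₁, M₁, hψ₁, hb₁, hyb₁⟩ := hE.exists_block_subsequence hnull hη0
  obtain ⟨ψ₂, d, M', hψ₂, hd, hzd⟩ := hF.exists_block_subsequence
    (fun i => (hnull' i).comp hψ₁.tendsto_atTop) hη0
  have hb := hb₁.comp hψ₂
  set b := fun k => b₁ (ψ₂ k) with hbdef
  have hyb : ∀ k, ‖y (φ (α (ψ₁ (ψ₂ k)))) - y (φ (β (ψ₁ (ψ₂ k)))) - b k‖ ≤ η * (1 / 2) ^ k := by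
    intro k
    refine (hyb₁ (ψ₂ k)).1.trans (mul_le_mul_of_nonneg_left ?_ hη0.le)
    exact pow_le_pow_of_le_one (by norm_num) (by norm_num) hψ₂.le_apply
  have hψ := hψ₁.comp hψ₂
  have hα' := hφ.comp (hα.comp hψ)
  have hβ' := hφ.comp (hβ.comp hψ)
  have hzy' : NormDominates 𝕜 z y := ⟨B, hB, hB'⟩
  have hyz' : NormDominates 𝕜 y z := ⟨A, hA, hA'⟩
  by_cases hbs : EventuallySmallShifts (· < ·) w p co b
  · by_cases hds : EventuallySmallShifts (· ≠ ·) w p co' d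
    · exfalso
      obtain ⟨A', hA0, hA''⟩ := hyz'.sub (fun k => φ (α (ψ₁ (ψ₂ k)))) fun k => φ (β (ψ₁ (ψ₂ k)))
      obtain ⟨B', hB0, hB''⟩ := hzy'.sub (fun k => φ (α (ψ₁ (ψ₂ k)))) fun k => φ (β (ψ₁ (ψ₂ k)))
      have hbC : ∀ k, ‖b k‖ ≤ 2 * C := fun k => by
        have h3 := (hyC (φ (α (ψ₁ (ψ₂ k))))).2
        have h4 := (hyC (φ (β (ψ₁ (ψ₂ k))))).2
        exact (hyb₁ (ψ₂ k)).2.trans ((norm_sub_le _ _).trans (by linarith))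
      have hdC : ∀ k, ‖d k‖ ≤ 2 * (A * C) := fun k => by
        have h3 := hzC (φ (α (ψ₁ (ψ₂ k))))
        have h4 := hzC (φ (β (ψ₁ (ψ₂ k))))
        exact (hzd k).2.trans ((norm_sub_le _ _).trans (by linarith))
      have hcb : ∀ k, ε / 2 ≤ ‖b k‖ := fun k => by
        have h3 := hαβ (ψ₁ (ψ₂ k))
        rw [dist_eq_norm] at h3
        have h4 := norm_sub_norm_le (y (φ (α (ψ₁ (ψ₂ k)))) - y (φ (β (ψ₁ (ψ₂ k))))) (b k)
        have h5 := hyb k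
        have h6 : η * (1 / 2) ^ k ≤ ε / 2 :=
          (mul_le_of_le_one_right hη0.le (pow_le_one₀ (by norm_num) (by norm_num))).trans
            (min_le_right _ _)
        linarith
      set K := 1 + 2 * C + 2 * (A * C) + (2 * A' + 2) + (2 * B' + 2) with hK
      have hAC : 0 < A * C := by positivity
      refine not_equivalent_of_eventuallySmallShifts hE hF hb hd (C := K) (by linarith)
        (fun k => (hbC k).trans (by linarith)) (fun k => (hdC k).trans (by linarith))
        (half_pos hε) hcb hbs hds (fun f θ hf => ?_) fun f θ hf => ?_
      · have hθ : 0 ≤ θ := (norm_nonneg _).trans (hf 0)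
        refine (norm_linearCombination_le_of_perturbation hB0 hB'' hη0 (min_le_left _ _)
          (fun k => (hzd k).1) hyb f hf).trans ?_
        refine add_le_add ?_ ?_ <;>
          exact mul_le_mul_of_nonneg_right (by linarith) (by positivity)
      · have hθ : 0 ≤ θ := (norm_nonneg _).trans (hf 0)
        refine (norm_linearCombination_le_of_perturbation hA0 hA'' hη0 (min_le_left _ _)
          hyb (fun k => (hzd k).1) f hf).trans ?_
        refine add_le_add ?_ ?_ <;>
          exact mul_le_mul_of_nonneg_right (by linarith) (by positivity)
    -- Here the lower estimate is obtained for `z` and carried to `y` by the equivalence.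
    · have hsubz : ∀ φ : ℕ → ℕ, StrictMono φ → NormDominates 𝕜 z fun n => z (φ n) :=
        fun φ hφ => (hzy'.trans (h1 φ hφ)).trans (hyz'.comp φ)
      obtain ⟨D, hD, hlow⟩ := exists_lower_estimate_of_differences hF hsubz hα' hβ' hd hη0
        (fun k => (hzd k).1) hds
      refine ⟨D * A, by positivity, fun f => (hlow f).trans ?_⟩
      rw [mul_assoc]
      exact mul_le_mul_of_nonneg_left (hA' f) hD.le
  · exact exists_lower_estimate_of_differences hE h1 hα' hβ' hb hη0 hyb hbs

end Core

/-! ### Unit vectors -/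

section UnitVectors

variable {𝕜 : Type*} [RCLike 𝕜] {r : ℕ → ℕ → Prop} {w : ℕ → ℝ} {p : ℝ} {E F : Type*}
    [NormedAddCommGroup E] [NormedSpace 𝕜 E] {co : E →ₗ[𝕜] (ℕ → 𝕜)}
    [NormedAddCommGroup F] [NormedSpace 𝕜 F]

namespace IsListNormed

theorem co_linearCombination_unit {e : ℕ → E} (he : ∀ n, co (e n) = Pi.single n 1) (f : ℕ →₀ 𝕜) :
    co (Finsupp.linearCombination 𝕜 e f) = f := by
  rw [IsBlockSequence.co_linearCombination]
  funext i
  simp only [he, Finset.sum_apply, Pi.smul_apply, Pi.single_apply, smul_eq_mul, mul_ite, mul_one,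
    mul_zero]
  rw [Finset.sum_ite_eq]
  split_ifs with hi
  · rfl
  · exact (Finsupp.notMem_support_iff.mp hi).symm

theorem exists_unit (h : IsListNormed r w p co) :
    ∃ e : ℕ → E, ∀ n, co (e n) = Pi.single n 1 := by
  have : ∀ n, ∃ e : E, co e = Pi.single n 1 := fun n => by
    refine h.exists_co _ 1 fun L hL => ?_
    have h1 := listSum_le_filter (a := (Pi.single n 1 : ℕ → 𝕜)) h.weight h.one_le (· = n) (t := 0)
      (L := L) fun i _ hi => Pi.single_eq_of_ne hi _
    refine h1.trans ?_
    have hnd : (L.filter (· = n)).Nodup := (hL.filter _).imp fun {i j} => h.ne_of i j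
    have hlen : (L.filter (· = n)).length ≤ 1 := by
      rw [← List.toFinset_card_of_nodup hnd, Finset.card_le_one]
      intro i hi j hj
      have hi' := (List.mem_filter.mp (List.mem_toFinset.mp hi)).2
      have hj' := (List.mem_filter.mp (List.mem_toFinset.mp hj)).2
      simp only [decide_eq_true_eq] at hi' hj'
      rw [hi', hj']
    have h2 := listSum_le_length (a := (Pi.single n 1 : ℕ → 𝕜)) h.weight h.one_le (t := 0)
      (L := L.filter (· = n)) (δ := 1) fun i _ => by
        by_cases hi : i = n <;> simp [hi]
    rw [Real.one_rpow, mul_one] at h2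
    exact h2.trans (by exact_mod_cast hlen)
  choose e he using this
  exact ⟨e, he⟩

/-- Increasing maps preserve and reflect `r`, so lists can be pushed forward by `φ`; conversely,
entries outside the range of `φ` meet only zeros and may be deleted. -/
theorem norm_unit_comp (h : IsListNormed r w p co) {e : ℕ → E}
    (he : ∀ n, co (e n) = Pi.single n 1) {φ : ℕ → ℕ} (hφ : StrictMono φ) (f : ℕ →₀ 𝕜) :
    ‖Finsupp.linearCombination 𝕜 (fun n => e (φ n)) f‖ = ‖Finsupp.linearCombination 𝕜 e f‖ := by
  have hmap : Finsupp.linearCombination 𝕜 (fun n => e (φ n)) f =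
      Finsupp.linearCombination 𝕜 e (f.mapDomain φ) := by
    rw [Finsupp.linearCombination_mapDomain]
    rfl
  have hpull : ∀ L : List ℕ, listSum w p (f.mapDomain φ) 0 (L.map φ) = listSum w p f 0 L :=
    fun L => by
      rw [listSum_map]
      simp only [Finsupp.mapDomain_apply hφ.injective]
  rw [hmap]
  refine le_antisymm (h.norm_le _ _ (norm_nonneg _) fun L hL => ?_)
    (h.norm_le _ _ (norm_nonneg _) fun L hL => ?_)
  · classical
    rw [co_linearCombination_unit he]
    have h1 := listSum_le_filter (a := (f.mapDomain φ : ℕ → 𝕜)) h.weight h.one_le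
      (· ∈ Set.range φ) (t := 0) (L := L) fun i _ hi => Finsupp.mapDomain_of_notMem_range f i hi
    refine h1.trans ?_
    obtain ⟨L', hL'⟩ : ∃ L' : List ℕ, L'.map φ = L.filter (· ∈ Set.range φ) := by
      have : L.filter (· ∈ Set.range φ) ∈ Set.range (List.map φ) := by
        rw [Set.range_list_map]
        intro i hi
        simpa using (List.mem_filter.mp hi).2
      exact this
    have hp' : L'.Pairwise r := by
      have h2 : (L'.map φ).Pairwise r := hL' ▸ hL.filter _
      rw [List.pairwise_map] at h2
      exact h2.imp fun {i j} => (h.strictMono φ hφ i j).mp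
    rw [← hL', hpull, ← co_linearCombination_unit he f]
    exact h.listSum_le _ L' hp'
  · rw [co_linearCombination_unit he, ← hpull, ← co_linearCombination_unit he (f.mapDomain φ)]
    refine h.listSum_le _ _ ?_
    rw [List.pairwise_map]
    exact hL.imp fun {i j} => (h.strictMono φ hφ i j).mpr

/-- Subtracting from `f n` a term supported beyond the support of `f n` does not decrease the norm,
so the Cauchy condition already bounds the norm of the combination itself. -/
theorem hasNullTails_unit (h : IsListNormed r w p co) {e : ℕ → E}
    (he : ∀ n, co (e n) = Pi.single n 1) : HasNullTails 𝕜 e := by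
  intro f hf hcau
  rw [Metric.cauchySeq_iff] at hcau
  rw [Metric.tendsto_atTop]
  intro ε hε
  obtain ⟨N, hN⟩ := hcau ε hε
  refine ⟨N, fun n hn => ?_⟩
  obtain ⟨m, hm⟩ := (f n).support.exists_nat_subset_range
  have h1 := hN n hn (max N m) (le_max_left _ _)
  rw [dist_zero_right]
  rw [dist_eq_norm] at h1
  refine lt_of_le_of_lt (h.norm_le_of_norm_co_le fun i => ?_) h1
  rw [map_sub, co_linearCombination_unit he, co_linearCombination_unit he, Pi.sub_apply]
  by_cases hi : i ∈ (f n).support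
  · have h2 : f (max N m) i = 0 := by
      by_contra hne
      have h3 := hf _ i (Finsupp.mem_support_iff.mpr hne)
      have h4 := Finset.mem_range.mp (hm hi)
      exact absurd ((le_max_right N m).trans h3) (not_le.mpr h4)
    rw [h2, sub_zero]
  · rw [Finsupp.notMem_support_iff.mp hi, norm_zero]
    exact norm_nonneg _

theorem norm_sum_unit_rpow_le (h : IsListNormed r w p co) {e : ℕ → E}
    (he : ∀ n, co (e n) = Pi.single n 1) (n : ℕ) :
    ‖∑ k ∈ Finset.range n, e k‖ ^ p ≤ ∑ j ∈ Finset.range n, w j := by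
  have hp0 := h.pos
  have hS : 0 ≤ ∑ j ∈ Finset.range n, w j := Finset.sum_nonneg fun j _ => (h.weight.2.2.1 j).le
  have hco : co (∑ k ∈ Finset.range n, e k) = constOn (Finset.range n) (1 : 𝕜) := by
    rw [← co_linearCombination_unit he, linearCombination_constOn, one_smul]
  suffices ‖∑ k ∈ Finset.range n, e k‖ ≤ (∑ j ∈ Finset.range n, w j) ^ (1 / p) by
    have h1 := Real.rpow_le_rpow (norm_nonneg _) this hp0.le
    rwa [← Real.rpow_mul hS, one_div, inv_mul_cancel₀ hp0.ne', Real.rpow_one] at h1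
  refine h.norm_le _ _ (by positivity) fun L hL => ?_
  rw [← Real.rpow_mul hS, one_div, inv_mul_cancel₀ hp0.ne', Real.rpow_one, hco]
  refine (listSum_le_filter h.weight h.one_le (· < n) fun i _ hi => ?_).trans ?_
  · rw [constOn_apply, if_neg (by simpa using hi)]
  have hnd : (L.filter (· < n)).Nodup := (hL.filter _).imp fun {i j} => h.ne_of i j
  have hlen : (L.filter (· < n)).length ≤ n := by
    rw [← List.toFinset_card_of_nodup hnd]
    conv_rhs => rw [← Finset.card_range n]
    refine Finset.card_le_card fun i hi => ?_
    simpa using (List.mem_filter.mp (List.mem_toFinset.mp hi)).2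
  rw [listSum_eq_sum]
  refine (Finset.sum_le_sum fun j _ => ?_).trans
    (Finset.sum_le_sum_of_subset_of_nonneg (Finset.range_mono hlen)
      fun j _ _ => (h.weight.2.2.1 j).le)
  rw [zero_add]
  refine mul_le_of_le_one_left (h.weight.2.2.1 j).le (Real.rpow_le_one (norm_nonneg _) ?_ hp0.le)
  simpa using norm_constOn_le (Finset.range n) (1 : 𝕜) _

/-- The unit vectors do not satisfy a lower `p`-estimate. -/
theorem not_lower_estimate_unit (h : IsListNormed r w p co) {e : ℕ → E}
    (he : ∀ n, co (e n) = Pi.single n 1) {D : ℝ} (hD : 0 < D)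
    (hlow : ∀ f : ℕ →₀ 𝕜, finNorm p f ≤ D * ‖Finsupp.linearCombination 𝕜 e f‖) : False := by
  have hp0 := h.pos
  -- The estimate for the sum of `n` unit vectors would read `n ≤ D ^ p * ∑_{j<n} w j`, but the
  -- averages of `w` tend to `0`.
  have hces := h.weight.2.2.2.1.cesaro
  have hev := hces.eventually_lt_const (show (0 : ℝ) < (D ^ p)⁻¹ by positivity)
  obtain ⟨n, hn, hn1⟩ := (hev.and (eventually_ge_atTop 1)).exists
  have hn0 : (0 : ℝ) < n := by exact_mod_cast hn1
  have h1 := hlow (constOn (Finset.range n) (1 : 𝕜))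
  rw [linearCombination_constOn, one_smul] at h1
  have h2 := Real.rpow_le_rpow (finNorm_nonneg _ _) h1 hp0.le
  rw [finNorm_rpow h.one_le, Real.mul_rpow hD.le (norm_nonneg _),
    Finsupp.sum_of_support_subset _ (support_constOn_subset _ _) _
      (by simp [Real.zero_rpow hp0.ne'])] at h2
  have h3 : ∑ k ∈ Finset.range n, ‖constOn (Finset.range n) (1 : 𝕜) k‖ ^ p = n := by
    rw [Finset.sum_congr rfl (g := fun _ => (1 : ℝ)) fun k hk => by
      rw [constOn_apply, if_pos hk, norm_one, Real.one_rpow]]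
    simp
  rw [h3] at h2
  have h4 := h2.trans (mul_le_mul_of_nonneg_left (h.norm_sum_unit_rpow_le he n) (by positivity))
  rw [inv_mul_lt_iff₀ hn0, ← div_eq_mul_inv, lt_div_iff₀ (by positivity)] at hn
  linarith

end IsListNormed

end UnitVectors

/-! ### Non-embeddability in terms of unit vectors -/

section Embeddings

variable {𝕜 : Type*} [RCLike 𝕜] {w : ℕ → ℝ} {p : ℝ} {E F : Type*}
    [NormedAddCommGroup E] [NormedSpace 𝕜 E] {co : E →ₗ[𝕜] (ℕ → 𝕜)}
    [NormedAddCommGroup F] [NormedSpace 𝕜 F] {co' : F →ₗ[𝕜] (ℕ → 𝕜)}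

theorem IsIsomorphicToSubspace.exists_normDominates (h : IsIsomorphicToSubspace 𝕜 E F)
    (e : ℕ → E) : ∃ y : ℕ → F, NormDominates 𝕜 e y ∧ NormDominates 𝕜 y e := by
  obtain ⟨V, ⟨T⟩⟩ := h
  have hlc : ∀ f : ℕ →₀ 𝕜, Finsupp.linearCombination 𝕜 (fun n => (T (e n) : F)) f =
      T (Finsupp.linearCombination 𝕜 e f) := fun f => by
    simp [Finsupp.linearCombination_apply, Finsupp.sum]
  refine ⟨fun n => T (e n), ⟨‖(T : E →L[𝕜] V)‖ + 1, by positivity, fun f => ?_⟩,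
    ⟨‖(T.symm : V →L[𝕜] E)‖ + 1, by positivity, fun f => ?_⟩⟩
  · rw [hlc]
    refine ((T : E →L[𝕜] V).le_opNorm (Finsupp.linearCombination 𝕜 e f)).trans ?_
    exact mul_le_mul_of_nonneg_right (by linarith) (norm_nonneg _)
  · rw [hlc]
    have h1 := (T.symm : V →L[𝕜] E).le_opNorm (T (Finsupp.linearCombination 𝕜 e f))
    simp only [ContinuousLinearEquiv.coe_coe, ContinuousLinearEquiv.symm_apply_apply] at h1
    exact h1.trans (mul_le_mul_of_nonneg_right (by linarith) (norm_nonneg _))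

/-- Unit vectors of either space are isometrically equivalent to their subsequences and have null
tails. Both properties pass to the other sequence, so the two-sided `ℓ_p` estimates apply. The
disjunction serves both embedding statements. -/
theorem not_normDominates_unit (hE : IsListNormed (· < ·) w p co)
    (hF : IsListNormed (· ≠ ·) w p co') {y : ℕ → E} {z : ℕ → F}
    (h : (∀ n, co (y n) = Pi.single n 1) ∨ ∀ n, co' (z n) = Pi.single n 1)
    (hyz : NormDominates 𝕜 y z) (hzy : NormDominates 𝕜 z y) : False := by
  have hy0 : ∀ n, y n ≠ 0 := by
    intro n hn
    rcases h with h | h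
    · have h1 := h n
      rw [hn, map_zero] at h1
      simpa using congrFun h1 n
    · obtain ⟨B, hB, hB'⟩ := hyz
      have h1 : ‖z n‖ ≤ B * ‖y n‖ := by simpa using hB' (Finsupp.single n 1)
      rw [hn, norm_zero, mul_zero, norm_le_zero_iff] at h1
      have h2 := h n
      rw [h1, map_zero] at h2
      simpa using congrFun h2 n
  have hsub : ∀ φ : ℕ → ℕ, StrictMono φ →
      NormDominates 𝕜 y (fun n => y (φ n)) ∧ NormDominates 𝕜 (fun n => y (φ n)) y := by
    intro φ hφ
    rcases h with h | h
    · exact ⟨⟨1, one_pos, fun f => by rw [hE.norm_unit_comp h hφ, one_mul]⟩,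
        ⟨1, one_pos, fun f => by rw [hE.norm_unit_comp h hφ, one_mul]⟩⟩
    · have h1 : NormDominates 𝕜 z fun n => z (φ n) :=
        ⟨1, one_pos, fun f => by rw [hF.norm_unit_comp h hφ, one_mul]⟩
      have h2 : NormDominates 𝕜 (fun n => z (φ n)) z :=
        ⟨1, one_pos, fun f => by rw [hF.norm_unit_comp h hφ, one_mul]⟩
      exact ⟨(hyz.trans h1).trans (hzy.comp φ), ((hyz.comp φ).trans h2).trans hzy⟩
  have htail : HasNullTails 𝕜 y := by
    rcases h with h | h
    · exact hE.hasNullTails_unit h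
    · exact hzy.hasNullTails hyz (hF.hasNullTails_unit h)
  obtain ⟨-, D, hD, hlow⟩ := exists_finNorm_estimates hE hF hyz hzy hy0
    (fun φ hφ => (hsub φ hφ).1) (fun φ hφ => (hsub φ hφ).2) htail
  rcases h with h | h
  · exact hE.not_lower_estimate_unit h hD hlow
  · obtain ⟨A, hA, hA'⟩ := hzy
    refine hF.not_lower_estimate_unit h (D := D * A) (by positivity) fun f => (hlow f).trans ?_
    rw [mul_assoc]
    exact mul_le_mul_of_nonneg_left (hA' f) hD.le

end Embeddings

/-! ### The spaces `g(w,p)` and `d(w,p)` -/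

section Spaces

variable {𝕜 : Type*} [RCLike 𝕜] {w : ℕ → ℝ} {p : ℝ}

theorem ofReal_listSum (hw : w ∈ weightClass) (hp : 1 ≤ p) (a : ℕ → 𝕜) (L : List ℕ) :
    ENNReal.ofReal (listSum w p a 0 L) =
      ∑ j ∈ Finset.range L.length, ‖a (L.getD j 0)‖ₑ ^ p * ENNReal.ofReal (w j) := by
  rw [listSum_eq_sum, ENNReal.ofReal_sum_of_nonneg]
  · refine Finset.sum_congr rfl fun j _ => ?_
    rw [zero_add, ENNReal.ofReal_mul (by positivity),
      ← ENNReal.ofReal_rpow_of_nonneg (norm_nonneg _) (by linarith), ofReal_norm]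
  · intro j _
    have := hw.2.2.1 (0 + j)
    positivity

/-- Partial sums of the series are list sums, and by `hr` every admissible list is an initial
segment of some member of the family; so infinite rearrangements may be replaced by finite lists. -/
theorem iSup_weightedSum_le_iff (hw : w ∈ weightClass) (hp : 1 ≤ p) {r : ℕ → ℕ → Prop} {ι : Type*}
    (Φ : ι → ℕ → ℕ) (hΦ : ∀ i N, ((List.range N).map (Φ i)).Pairwise r)
    (hr : ∀ L : List ℕ, L.Pairwise r → ∃ i, ∀ j < L.length, Φ i j = L.getD j 0) (a : ℕ → 𝕜)
    {M : ℝ} (hM : 0 ≤ M) :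
    (⨆ i, weightedSum w p fun j => ‖a (Φ i j)‖ₑ) ≤ ENNReal.ofReal M ↔
      ∀ L : List ℕ, L.Pairwise r → listSum w p a 0 L ≤ M ^ p := by
  have hp0 : 0 < p := by linarith
  have h1 : ∀ i, weightedSum w p (fun j => ‖a (Φ i j)‖ₑ) ≤ ENNReal.ofReal M ↔
      ∀ N, ∑ j ∈ Finset.range N, ‖a (Φ i j)‖ₑ ^ p * ENNReal.ofReal (w j) ≤
        ENNReal.ofReal (M ^ p) := by
    intro i
    rw [weightedSum, one_div, ENNReal.rpow_inv_le_iff hp0, ENNReal.ofReal_rpow_of_nonneg hM hp0.le,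
      ENNReal.tsum_eq_iSup_nat, iSup_le_iff]
  rw [iSup_le_iff]
  simp only [h1]
  constructor
  · intro h L hL
    obtain ⟨i, hi⟩ := hr L hL
    rw [← ENNReal.ofReal_le_ofReal_iff (by positivity), ofReal_listSum hw hp]
    refine le_trans (le_of_eq (Finset.sum_congr rfl fun j hj => ?_)) (h i L.length)
    rw [hi j (Finset.mem_range.mp hj)]
  · intro h i N
    have h2 := ENNReal.ofReal_le_ofReal (h _ (hΦ i N))
    rw [ofReal_listSum hw hp] at h2
    refine le_trans (le_of_eq ?_) h2
    rw [List.length_map, List.length_range]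
    refine Finset.sum_congr rfl fun j hj => ?_
    have hj' := Finset.mem_range.mp hj
    rw [List.getD_eq_getElem _ _ (by simpa using hj'), List.getElem_map, List.getElem_range]

theorem exists_strictMono_extension (L : List ℕ) (hL : L.Pairwise (· < ·)) :
    ∃ φ : {φ : ℕ → ℕ // StrictMono φ}, ∀ j < L.length, φ.1 j = L.getD j 0 := by
  obtain ⟨B, hB⟩ := L.exists_forall_lt
  refine ⟨⟨fun j => if j < L.length then L.getD j 0 else B + j, fun i j hij => ?_⟩,
    fun j hj => if_pos hj⟩
  simp only
  by_cases hj : j < L.length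
  · have hi : i < L.length := hij.trans hj
    rw [if_pos hi, if_pos hj, List.getD_eq_getElem _ _ hi, List.getD_eq_getElem _ _ hj]
    exact List.pairwise_iff_getElem.mp hL i j hi hj hij
  · rw [if_neg hj]
    by_cases hi : i < L.length
    · rw [if_pos hi, List.getD_eq_getElem _ _ hi]
      have := hB _ (List.getElem_mem hi)
      omega
    · rw [if_neg hi]
      omega

theorem exists_perm_extension (L : List ℕ) (hL : L.Pairwise (· ≠ ·)) :
    ∃ π : Equiv.Perm ℕ, ∀ j < L.length, π j = L.getD j 0 := by
  have hnd : L.Nodup := hL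
  obtain ⟨π, hπ⟩ := Cardinal.extend_function_of_lt (α := ℕ) (β := ℕ) (s := {k | k < L.length})
    ⟨fun k => L[k.1]'k.2, fun x y hxy => Subtype.ext ((hnd.getElem_inj_iff).mp hxy)⟩
    (by
      rw [Cardinal.mk_nat]
      exact Cardinal.lt_aleph0_iff_finite.mpr (Set.finite_lt_nat _).to_subtype) ⟨Equiv.refl ℕ⟩
  refine ⟨π, fun j hj => ?_⟩
  rw [List.getD_eq_getElem _ _ hj]
  exact hπ ⟨j, hj⟩

theorem garlingENorm_le_iff (hw : w ∈ weightClass) (hp : 1 ≤ p) (a : ℕ → 𝕜) {M : ℝ} (hM : 0 ≤ M) :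
    garlingENorm w p a ≤ ENNReal.ofReal M ↔
      ∀ L : List ℕ, L.Pairwise (· < ·) → listSum w p a 0 L ≤ M ^ p := by
  refine iSup_weightedSum_le_iff hw hp
    (fun φ : {φ : ℕ → ℕ // StrictMono φ} => φ.1) (fun φ N => ?_) exists_strictMono_extension a hM
  rw [List.pairwise_map]
  exact List.pairwise_lt_range.imp fun {i j} hij => φ.2 hij

theorem lorentzENorm_le_iff (hw : w ∈ weightClass) (hp : 1 ≤ p) (a : ℕ → 𝕜) {M : ℝ} (hM : 0 ≤ M) :
    lorentzENorm w p a ≤ ENNReal.ofReal M ↔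
      ∀ L : List ℕ, L.Pairwise (· ≠ ·) → listSum w p a 0 L ≤ M ^ p := by
  rw [lorentzENorm_eq_iSup hw.2.1 hw.2.2.1 hp]
  refine iSup_weightedSum_le_iff hw hp (fun π : Equiv.Perm ℕ => (π : ℕ → ℕ)) (fun π N => ?_)
    exists_perm_extension a hM
  rw [List.pairwise_map]
  exact List.pairwise_lt_range.imp fun {i j} hij h => hij.ne (π.injective h)

/-- The inclusion of `g(w,p)` in the space of all sequences. -/
def GarlingSpace.coord (w : weightClass) (p : ℝ) [Fact (1 ≤ p)] (𝕜 : Type*) [RCLike 𝕜] :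
    GarlingSpace w p 𝕜 →ₗ[𝕜] (ℕ → 𝕜) :=
  (garlingSubmodule w p 𝕜).subtype

/-- The inclusion of `d(w,p)` in the space of all sequences. -/
def LorentzSpace.coord (w : weightClass) (p : ℝ) [Fact (1 ≤ p)] (𝕜 : Type*) [RCLike 𝕜] :
    LorentzSpace w p 𝕜 →ₗ[𝕜] (ℕ → 𝕜) :=
  (lorentzSubmodule w p 𝕜).subtype

theorem rpow_one_div_rpow_max (hp : 1 ≤ p) (M : ℝ) :
    M ≤ ((max M 0) ^ (1 / p)) ^ p := by
  rw [← Real.rpow_mul (le_max_right _ _), one_div, inv_mul_cancel₀ (by linarith), Real.rpow_one]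
  exact le_max_left _ _

theorem GarlingSpace.isListNormed (w : weightClass) (p : ℝ) [hp : Fact (1 ≤ p)] (𝕜 : Type*)
    [RCLike 𝕜] : IsListNormed (· < ·) w.1 p (GarlingSpace.coord w p 𝕜) where
  weight := w.2
  one_le := hp.out
  of_lt _ _ h := h
  ne_of _ _ h := ne_of_lt h
  strictMono _ hφ _ _ := hφ.lt_iff_lt
  listSum_le a := by
    refine (garlingENorm_le_iff w.2 hp.out a.1 (norm_nonneg a)).mp ?_
    change _ ≤ ENNReal.ofReal (garlingENorm w.1 p a.1).toReal
    rw [ENNReal.ofReal_toReal (ne_of_lt a.2)]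
  norm_le a M hM h := by
    change (garlingENorm w.1 p a.1).toReal ≤ M
    exact ENNReal.toReal_le_of_le_ofReal hM ((garlingENorm_le_iff w.2 hp.out a.1 hM).mpr h)
  exists_co b M h := by
    have h1 := (garlingENorm_le_iff w.2 hp.out b (M := (max M 0) ^ (1 / p)) (by positivity)).mpr
      fun L hL => (h L hL).trans (rpow_one_div_rpow_max hp.out M)
    exact ⟨(⟨b, h1.trans_lt ENNReal.ofReal_lt_top⟩ : garlingSubmodule w p 𝕜), rfl⟩

theorem LorentzSpace.isListNormed (w : weightClass) (p : ℝ) [hp : Fact (1 ≤ p)] (𝕜 : Type*)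
    [RCLike 𝕜] : IsListNormed (· ≠ ·) w.1 p (LorentzSpace.coord w p 𝕜) where
  weight := w.2
  one_le := hp.out
  of_lt _ _ h := ne_of_lt h
  ne_of _ _ h := h
  strictMono _ hφ _ _ := hφ.injective.ne_iff
  listSum_le a := by
    refine (lorentzENorm_le_iff w.2 hp.out a.1 (norm_nonneg a)).mp ?_
    change _ ≤ ENNReal.ofReal (lorentzENorm w.1 p a.1).toReal
    rw [ENNReal.ofReal_toReal (ne_of_lt a.2.2)]
  norm_le a M hM h := by
    change (lorentzENorm w.1 p a.1).toReal ≤ M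
    exact ENNReal.toReal_le_of_le_ofReal hM ((lorentzENorm_le_iff w.2 hp.out a.1 hM).mpr h)
  exists_co b M h := by
    have h1 := (lorentzENorm_le_iff w.2 hp.out b (M := (max M 0) ^ (1 / p)) (by positivity)).mpr
      fun L hL => (h L hL).trans (rpow_one_div_rpow_max hp.out M)
    -- Membership in `c₀`, which is part of the definition of `d(w,p)`, follows from bounded list
    -- sums.
    have h2 : Tendsto b atTop (𝓝 0) := tendsto_zero_of_listSum_le w.2 hp.out fun L hL =>
      h L (hL.imp fun {i j} hij => ne_of_lt hij)
    exact ⟨(⟨b, h2, h1.trans_lt ENNReal.ofReal_lt_top⟩ : lorentzSubmodule w p 𝕜), rfl⟩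

end Spaces

/-! ### Domination and equivalence of sequences in topological vector spaces -/

section Dominates

variable {𝕜 : Type*} [RCLike 𝕜]
  {X : Type*} [AddCommGroup X] [Module 𝕜 X] [TopologicalSpace X] [IsTopologicalAddGroup X]
  [ContinuousSMul 𝕜 X]
  {Y : Type*} [AddCommGroup Y] [Module 𝕜 Y] [TopologicalSpace Y] [IsTopologicalAddGroup Y]
  [ContinuousSMul 𝕜 Y]
  {Z : Type*} [AddCommGroup Z] [Module 𝕜 Z] [TopologicalSpace Z] [IsTopologicalAddGroup Z]
  [ContinuousSMul 𝕜 Z]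
  {x : ℕ → X} {y : ℕ → Y} {z : ℕ → Z}

variable (𝕜) in
/-- Finite combinations of `x` as elements of its closed linear span. -/
noncomputable def spanCombination (x : ℕ → X) : (ℕ →₀ 𝕜) →ₗ[𝕜] closedSpan 𝕜 x :=
  Finsupp.linearCombination 𝕜 fun n => ⟨x n, mem_closedSpan 𝕜 x n⟩

theorem coe_spanCombination (f : ℕ →₀ 𝕜) :
    (spanCombination 𝕜 x f : X) = Finsupp.linearCombination 𝕜 x f := by
  simp [spanCombination, Finsupp.linearCombination_apply, Finsupp.sum]

theorem denseRange_spanCombination : DenseRange (spanCombination 𝕜 x) := by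
  intro v
  rw [Topology.IsInducing.subtypeVal.closure_eq_preimage_closure_image, Set.mem_preimage]
  refine closure_mono ?_ (show (v : X) ∈ closure (Submodule.span 𝕜 (Set.range x) : Set X) from v.2)
  intro u hu
  obtain ⟨f, rfl⟩ := (Finsupp.mem_span_range_iff_exists_finsupp (R := 𝕜)).mp hu
  refine ⟨spanCombination 𝕜 x f, ⟨f, rfl⟩, ?_⟩
  rw [coe_spanCombination, Finsupp.linearCombination_apply]

theorem map_spanCombination (T : closedSpan 𝕜 x →L[𝕜] closedSpan 𝕜 y)
    (hT : ∀ n, T ⟨x n, mem_closedSpan 𝕜 x n⟩ = ⟨y n, mem_closedSpan 𝕜 y n⟩) (f : ℕ →₀ 𝕜) :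
    T (spanCombination 𝕜 x f) = spanCombination 𝕜 y f := by
  rw [spanCombination, spanCombination, Finsupp.linearCombination_apply,
    Finsupp.linearCombination_apply, Finsupp.sum, Finsupp.sum, map_sum]
  exact Finset.sum_congr rfl fun n _ => by rw [map_smul, hT]

theorem comp_eq_id_of_equivalent [T2Space X] (T : closedSpan 𝕜 x →L[𝕜] closedSpan 𝕜 y)
    (hT : ∀ n, T ⟨x n, mem_closedSpan 𝕜 x n⟩ = ⟨y n, mem_closedSpan 𝕜 y n⟩)
    (S : closedSpan 𝕜 y →L[𝕜] closedSpan 𝕜 x)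
    (hS : ∀ n, S ⟨y n, mem_closedSpan 𝕜 y n⟩ = ⟨x n, mem_closedSpan 𝕜 x n⟩)
    (v : closedSpan 𝕜 x) : S (T v) = v := by
  have h : (fun v => S (T v)) = id := (denseRange_spanCombination (𝕜 := 𝕜) (x := x)).equalizer
    (S.continuous.comp T.continuous) continuous_id
    (funext fun f => by
      simp only [Function.comp_apply, map_spanCombination T hT, map_spanCombination S hS, id])
  exact congrFun h v

theorem Dominates.trans (h1 : Dominates 𝕜 x y) (h2 : Dominates 𝕜 y z) : Dominates 𝕜 x z := by
  obtain ⟨T, hT⟩ := h1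
  obtain ⟨S, hS⟩ := h2
  exact ⟨S.comp T, fun n => by rw [ContinuousLinearMap.comp_apply, hT, hS]⟩

theorem EquivalentSequences.trans (h1 : EquivalentSequences 𝕜 x y)
    (h2 : EquivalentSequences 𝕜 y z) : EquivalentSequences 𝕜 x z :=
  ⟨h1.1.trans h2.1, h2.2.trans h1.2⟩

theorem EquivalentSequences.symm (h : EquivalentSequences 𝕜 x y) : EquivalentSequences 𝕜 y x :=
  ⟨h.2, h.1⟩

/-- The operator is restricted to the smaller closed span; density of finite combinations and
closedness show that its values lie in the span of the corresponding subsequence. -/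
theorem Dominates.comp (h : Dominates 𝕜 x y) (φ : ℕ → ℕ) :
    Dominates 𝕜 (fun n => x (φ n)) fun n => y (φ n) := by
  obtain ⟨T, hT⟩ := h
  have hle : closedSpan 𝕜 (fun n => x (φ n)) ≤ closedSpan 𝕜 x :=
    Submodule.topologicalClosure_mono (Submodule.span_mono (Set.range_comp_subset_range φ x))
  let J : closedSpan 𝕜 (fun n => x (φ n)) →L[𝕜] closedSpan 𝕜 x :=
    { Submodule.inclusion hle with
      cont := continuous_inclusion hle }
  let g : closedSpan 𝕜 (fun n => x (φ n)) →L[𝕜] Y := (closedSpan 𝕜 y).subtypeL.comp (T.comp J)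
  have hg : ∀ n, g ⟨x (φ n), mem_closedSpan 𝕜 (fun n => x (φ n)) n⟩ = y (φ n) := fun n =>
    congrArg Subtype.val (hT (φ n))
  have hmem : ∀ v, g v ∈ closedSpan 𝕜 fun n => y (φ n) := by
    intro v
    refine (denseRange_spanCombination (𝕜 := 𝕜) (x := fun n => x (φ n))).induction_on
      (p := fun v => g v ∈ closedSpan 𝕜 fun n => y (φ n)) v ?_ fun f => ?_
    · exact (Submodule.isClosed_topologicalClosure _).preimage g.continuous
    · rw [spanCombination, Finsupp.linearCombination_apply, Finsupp.sum, map_sum]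
      refine Submodule.sum_mem _ fun n _ => ?_
      rw [map_smul, hg]
      exact Submodule.smul_mem _ _ (mem_closedSpan 𝕜 (fun n => y (φ n)) n)
  exact ⟨g.codRestrict _ hmem, fun n => Subtype.ext (hg n)⟩

theorem EquivalentSequences.comp (h : EquivalentSequences 𝕜 x y) (φ : ℕ → ℕ) :
    EquivalentSequences 𝕜 (fun n => x (φ n)) fun n => y (φ n) :=
  ⟨h.1.comp φ, h.2.comp φ⟩

/-- If `x n = 0`, its coefficient in an expansion of `0` is arbitrary. -/
theorem IsBasicSequence.ne_zero (h : IsBasicSequence 𝕜 x) (n : ℕ) : x n ≠ 0 := by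
  intro hn
  have hx : ∀ c : 𝕜, ∀ N, ∑ k ∈ Finset.range N, (Pi.single n c : ℕ → 𝕜) k • x k = 0 := fun c N =>
    Finset.sum_eq_zero fun k _ => by
      by_cases hk : k = n
      · rw [hk, hn, smul_zero]
      · rw [Pi.single_eq_of_ne hk, zero_smul]
  have h1 := (h 0 (zero_mem _)).unique (y₁ := Pi.single n 0) (y₂ := Pi.single n 1)
    (by simp only [hx]; exact tendsto_const_nhds) (by simp only [hx]; exact tendsto_const_nhds)
  simpa using congrFun h1 n

end Dominates

/-! ### Null tails and completeness of closed spans -/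

section Tails

variable {𝕜 : Type*} [RCLike 𝕜]
  {X : Type*} [AddCommGroup X] [Module 𝕜 X] [UniformSpace X] [IsUniformAddGroup X]
  [ContinuousSMul 𝕜 X] {x : ℕ → X}

/-- The limit lies in the closed span of every tail of `x`. A tail is equivalent to `x`, so the
limit has expansions whose first `M` coefficients vanish, for every `M`, and uniqueness makes all
coefficients zero. Continuity of the coefficient functionals is not used. -/
theorem IsBasicSequence.hasNullTails [CompleteSpace X] [T2Space X] (hx : IsBasicSequence 𝕜 x)
    (hsub : ∀ φ : ℕ → ℕ, StrictMono φ → EquivalentSequences 𝕜 (fun n => x (φ n)) x) :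
    HasNullTails 𝕜 x := by
  intro f hf hcau
  obtain ⟨v, hv⟩ := cauchySeq_tendsto_of_complete hcau
  have hmem : ∀ M, v ∈ closedSpan 𝕜 fun n => x (n + M) := by
    intro M
    refine (Submodule.isClosed_topologicalClosure _).mem_of_tendsto hv ?_
    filter_upwards [eventually_ge_atTop M] with n hn
    rw [Finsupp.linearCombination_apply]
    refine Submodule.sum_mem _ fun k hk => Submodule.smul_mem _ _ ?_
    have hk' := hf n k hk
    have h1 := mem_closedSpan 𝕜 (fun n => x (n + M)) (k - M)
    simp only [show k - M + M = k by omega] at h1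
    exact h1
  have hexp : ∀ M, ∃ c : ℕ → 𝕜, (∀ k < M, c k = 0) ∧
      Tendsto (fun N => ∑ n ∈ Finset.range N, c n • x n) atTop (𝓝 v) := by
    intro M
    -- `A` carries `v` to the span of `x`, where it is expanded; `B` brings the expansion back along
    -- the tail.
    obtain ⟨⟨A, hA⟩, B, hB⟩ := hsub (fun n => n + M) fun i j hij => by simpa using hij
    obtain ⟨a, ha, -⟩ := hx _ (A ⟨v, hmem M⟩).2
    have h1 : Tendsto (fun N => ∑ n ∈ Finset.range N, a n • (⟨x n, mem_closedSpan 𝕜 x n⟩ :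
        closedSpan 𝕜 x)) atTop (𝓝 (A ⟨v, hmem M⟩)) := by
      rw [tendsto_subtype_rng]
      simpa using ha
    have h2 := (continuous_subtype_val.comp B.continuous).continuousAt.tendsto.comp h1
    simp only [Function.comp_apply, comp_eq_id_of_equivalent A hA B hB] at h2
    have h3 : ∀ N, ((B (∑ n ∈ Finset.range N, a n • (⟨x n, mem_closedSpan 𝕜 x n⟩ :
        closedSpan 𝕜 x)) : closedSpan 𝕜 fun n => x (n + M)) : X) =
        ∑ n ∈ Finset.range N, a n • x (n + M) := fun N => by
      rw [map_sum, Submodule.coe_sum]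
      exact Finset.sum_congr rfl fun n _ => by rw [map_smul, hB]; rfl
    refine ⟨fun k => if k < M then 0 else a (k - M), fun k hk => if_pos hk, ?_⟩
    rw [← tendsto_add_atTop_iff_nat M]
    refine h2.congr fun N => ?_
    simp only [Function.comp_apply]
    rw [h3, add_comm N M, Finset.sum_range_add]
    have h4 : ∑ k ∈ Finset.range M, (if k < M then (0 : 𝕜) else a (k - M)) • x k = 0 :=
      Finset.sum_eq_zero fun k hk => by rw [if_pos (Finset.mem_range.mp hk), zero_smul]
    rw [h4, zero_add]
    refine Finset.sum_congr rfl fun n _ => ?_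
    rw [if_neg (by omega), show M + n - M = n by omega, add_comm M n]
  have hvx : v ∈ closedSpan 𝕜 x := hmem 0
  obtain ⟨c, hc, hcu⟩ := hx v hvx
  have hc0 : c = 0 := funext fun k => by
    obtain ⟨d, hd, hdv⟩ := hexp (k + 1)
    rw [← hcu d hdv, hd k (Nat.lt_succ_self k)]
    rfl
  have hv0 : v = 0 := by
    refine tendsto_nhds_unique hc ?_
    simp [hc0]
  rwa [hv0] at hv

variable {Y : Type*} [AddCommGroup Y] [Module 𝕜 Y] [UniformSpace Y] [IsUniformAddGroup Y]
  [ContinuousSMul 𝕜 Y] {y : ℕ → Y}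

theorem EquivalentSequences.hasNullTails (h : EquivalentSequences 𝕜 x y)
    (hx : HasNullTails 𝕜 x) : HasNullTails 𝕜 y := by
  intro f hf hcau
  have : IsUniformAddGroup (closedSpan 𝕜 x) :=
    inferInstanceAs (IsUniformAddGroup (closedSpan 𝕜 x).toAddSubgroup)
  have : IsUniformAddGroup (closedSpan 𝕜 y) :=
    inferInstanceAs (IsUniformAddGroup (closedSpan 𝕜 y).toAddSubgroup)
  obtain ⟨⟨T, hT⟩, S, hS⟩ := h
  have h1 : CauchySeq fun n => spanCombination 𝕜 y (f n) := by
    refine isUniformEmbedding_subtype_val.isUniformInducing.cauchy_map_iff.mp ?_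
    rw [Filter.map_map]
    change CauchySeq fun n => (spanCombination 𝕜 y (f n) : Y)
    simpa only [coe_spanCombination] using hcau
  have h2 := (uniformContinuous_subtype_val.comp S.uniformContinuous).comp_cauchySeq h1
  simp only [Function.comp_def, map_spanCombination S hS, coe_spanCombination] at h2
  have h3 : Tendsto (fun n => spanCombination 𝕜 x (f n)) atTop (𝓝 0) := by
    rw [tendsto_subtype_rng]
    simpa only [coe_spanCombination, Submodule.coe_zero] using hx f hf h2
  have h4 := ((continuous_subtype_val.comp T.continuous).tendsto _).comp h3
  simpa only [Function.comp_def, map_spanCombination T hT, coe_spanCombination, map_zero,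
    Submodule.coe_zero] using h4

/-- The two operators are mutually inverse and uniformly continuous, so completeness of the span
comes from `X`, whether or not `Y` is complete. -/
theorem EquivalentSequences.completeSpace [CompleteSpace X] [T2Space X] [T2Space Y]
    (h : EquivalentSequences 𝕜 x y) : CompleteSpace (closedSpan 𝕜 y) := by
  have : IsUniformAddGroup (closedSpan 𝕜 x) :=
    inferInstanceAs (IsUniformAddGroup (closedSpan 𝕜 x).toAddSubgroup)
  have : IsUniformAddGroup (closedSpan 𝕜 y) :=
    inferInstanceAs (IsUniformAddGroup (closedSpan 𝕜 y).toAddSubgroup)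
  obtain ⟨⟨T, hT⟩, S, hS⟩ := h
  have : CompleteSpace (closedSpan 𝕜 x) :=
    (Submodule.isClosed_topologicalClosure _).completeSpace_coe
  let e : closedSpan 𝕜 x ≃ᵤ closedSpan 𝕜 y :=
    { toFun := T
      invFun := S
      left_inv := comp_eq_id_of_equivalent T hT S hS
      right_inv := comp_eq_id_of_equivalent S hS T hT
      uniformContinuous_toFun := T.uniformContinuous
      uniformContinuous_invFun := S.uniformContinuous }
  exact e.completeSpace_iff.mp this

end Tails

/-! ### Domination as a norm inequality on finite combinations -/

section Normed

variable {𝕜 : Type*} [RCLike 𝕜] {E F : Type*} [NormedAddCommGroup E] [NormedSpace 𝕜 E]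
    [NormedAddCommGroup F] [NormedSpace 𝕜 F] {y : ℕ → E} {z : ℕ → F}

theorem Dominates.normDominates (h : Dominates 𝕜 y z) : NormDominates 𝕜 y z := by
  obtain ⟨T, hT⟩ := h
  refine ⟨‖T‖ + 1, by positivity, fun f => ?_⟩
  rw [← coe_spanCombination (x := y), ← coe_spanCombination (x := z), ← map_spanCombination T hT]
  exact (T.le_opNorm _).trans (mul_le_mul_of_nonneg_right (by linarith) (norm_nonneg _))

/-- The operator is defined on the dense subspace of finite combinations and extended by continuity,
which is where completeness of the target enters. -/
theorem NormDominates.dominates [CompleteSpace (closedSpan 𝕜 z)] (h : NormDominates 𝕜 y z) :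
    Dominates 𝕜 y z := by
  obtain ⟨C, -, hC⟩ := h
  have hnorm : ∃ C, ∀ f, ‖spanCombination 𝕜 z f‖ ≤ C * ‖spanCombination 𝕜 y f‖ := by
    refine ⟨C, fun f => ?_⟩
    have := hC f
    rwa [← coe_spanCombination (x := y), ← coe_spanCombination (x := z)] at this
  refine ⟨(spanCombination 𝕜 z).extendOfNorm (spanCombination 𝕜 y), fun n => ?_⟩
  have h1 := LinearMap.extendOfNorm_eq denseRange_spanCombination hnorm (Finsupp.single n 1)
  simpa [spanCombination] using h1

theorem norm_linearCombination_ellpUnitVector (p : ℝ) [hp : Fact (1 ≤ p)] (f : ℕ →₀ 𝕜) :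
    ‖Finsupp.linearCombination 𝕜 (ellpUnitVector p 𝕜) f‖ = finNorm p f := by
  have hp0 : 0 < p := zero_lt_one.trans_le hp.out
  have hpr : (ENNReal.ofReal p).toReal = p := ENNReal.toReal_ofReal hp0.le
  have h1 := lp.norm_sum_single (p := ENNReal.ofReal p) (E := fun _ : ℕ => 𝕜) (by rwa [hpr]) f
    f.support
  rw [hpr] at h1
  have h2 : Finsupp.linearCombination 𝕜 (ellpUnitVector p 𝕜) f =
      ∑ i ∈ f.support, lp.single (ENNReal.ofReal p) i (f i) := by
    rw [Finsupp.linearCombination_apply, Finsupp.sum]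
    refine Finset.sum_congr rfl fun i _ => ?_
    rw [ellpUnitVector, ← lp.single_smul, smul_eq_mul, mul_one]
  rw [h2, finNorm, Finsupp.sum, ← h1, ← Real.rpow_mul (norm_nonneg _), one_div,
    mul_inv_cancel₀ hp0.ne', Real.rpow_one]

end Normed

/-! ### The main theorem -/

theorem mainTheorem8 (𝕜 : Type*) [RCLike 𝕜] (p : ℝ) [Fact (1 ≤ p)] (w : weightClass) :
    (∀ (X : Type*) [AddCommGroup X] [Module 𝕜 X] [UniformSpace X] [IsUniformAddGroup X]
        [ContinuousSMul 𝕜 X], IsQuasiBanach 𝕜 X →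
      ∀ x : ℕ → X, IsSubsymmetric 𝕜 x →
        (∃ y : ℕ → GarlingSpace w p 𝕜, IsBasicSequence 𝕜 y ∧ EquivalentSequences 𝕜 x y) →
        (∃ z : ℕ → LorentzSpace w p 𝕜, IsBasicSequence 𝕜 z ∧ EquivalentSequences 𝕜 x z) →
        EquivalentSequences 𝕜 x (ellpUnitVector p 𝕜)) ∧
    ¬ IsIsomorphicToSubspace 𝕜 (LorentzSpace w p 𝕜) (GarlingSpace w p 𝕜) ∧
    ¬ IsIsomorphicToSubspace 𝕜 (GarlingSpace w p 𝕜) (LorentzSpace w p 𝕜) := by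
  have hG := GarlingSpace.isListNormed w p 𝕜
  have hL := LorentzSpace.isListNormed w p 𝕜
  refine ⟨?_, fun h => ?_, fun h => ?_⟩
  · rintro X _ _ _ _ _ hX x hx ⟨y, hy, hxy⟩ ⟨z, -, hxz⟩
    have := hX.complete
    have := hX.hausdorff
    have hyz := hxy.symm.trans hxz
    have hsub : ∀ φ : ℕ → ℕ, StrictMono φ → EquivalentSequences 𝕜 (fun n => y (φ n)) y :=
      fun φ hφ => ((hxy.symm.comp φ).trans (hx.subsequences φ hφ)).trans hxy
    -- Null tails and completeness are obtained in `X` and transported to the span of `y`.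
    have htail := hxy.hasNullTails (hx.basic.hasNullTails hx.subsequences)
    obtain ⟨⟨C, hC, hup⟩, D, hD, hlow⟩ := exists_finNorm_estimates hG hL hyz.1.normDominates
      hyz.2.normDominates hy.ne_zero (fun φ hφ => (hsub φ hφ).2.normDominates)
      (fun φ hφ => (hsub φ hφ).1.normDominates) htail
    have hcy : CompleteSpace (closedSpan 𝕜 y) := hxy.completeSpace
    have hce : CompleteSpace (closedSpan 𝕜 (ellpUnitVector p 𝕜)) :=
      (Submodule.isClosed_topologicalClosure _).completeSpace_coe
    refine hxy.trans ⟨NormDominates.dominates ⟨D, hD, fun f => ?_⟩,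
      NormDominates.dominates ⟨C, hC, fun f => ?_⟩⟩
    · rw [norm_linearCombination_ellpUnitVector]
      exact hlow f
    · rw [norm_linearCombination_ellpUnitVector]
      exact hup f
  · obtain ⟨e, he⟩ := hL.exists_unit
    obtain ⟨y, hey, hye⟩ := h.exists_normDominates e
    exact not_normDominates_unit hG hL (Or.inr he) hye hey
  · obtain ⟨e, he⟩ := hG.exists_unit
    obtain ⟨z, hez, hze⟩ := h.exists_normDominates e
    exact not_normDominates_unit hG hL (Or.inl he) hez hze
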